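/- **Setting.** There are $k\ge 2$ arms with means $\mu_1,\dots,\mu_k\in\mathbb R$ and known standard deviations $\sigma_1,\dots,\sigma_k>0$; the best arm $b$ is unique, i.e. $\mu_b>\mu_i$ for all $i\ne b$. The rewards $X_{i,t}\sim\mathcal N(\mu_i,\sigma_i^2)$ are independent over arms $i$ and rounds $t=1,2,\dots$. In round $t$ one arm $I_t$ is pulled, depending only on information that is independent of the rewards of round $t$ (the past, and possibly randomization for ties), and $X_{I_t,t}$ is observed. Each arm has a posterior mean $\theta_{i,t}$ and a posterior variance $\lambda_{i,t}^2$, started from the non-informative prior $\theta_{i,1}=0$, $\lambda_{i,1}^2=\infty$. If $I_t=i$, then $$\theta_{i,t+1}=\frac{\lambda_{i,t}^{-2}\theta_{i,t}+\sigma_i^{-2}X_{i,t}}{\lambda_{i,t}^{-2}+\sigma_i^{-2}},\qquad \lambda_{i,t+1}^2=(\lambda_{i,t}^{-2}+\sigma_i^{-2})^{-1},$$ and both are unchanged if $I_t\neq i$. The knowledge gradient (KG) algorithm pulls $I_t\in\arg\max_i v_{i,t}$ (ties broken in any non-anticipating way), where $$v_{i,t}=\zeta_{i,t}\,f\!\left(-\frac{|\theta_{i,t}-\max_{j\ne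 i}\theta_{j,t}|}{\zeta_{i,t}}\right),\quad \zeta_{i,t}^2=\lambda_{i,t}^2-(\lambda_{i,t}^{-2}+\sigma_i^{-2})^{-1},\quad f(x)=x\Phi(x)+\phi(x),$$ $\Phi,\phi$ are the standard normal distribution function and density, and $v_{i,t}=\infty$ if $\zeta_{i,t}=\infty$ (arm $i$ not yet pulled). Let $N_{i,t}$ be the number of pulls of arm $i$ in rounds $1,\dots,t$, and let $R_t=\sum_{i\ne b}(\mu_b-\mu_i)\,\mathbb E[N_{i,t}]$ be the cumulative regret. Put $\sigma_{\max}=\max_i\sigma_i$, $\sigma_{\min}=\min_i\sigma_i$, $\delta_{\max}=\max_{i\ne j}|\mu_i-\mu_j|$, $m=\mu_b-\max_{j\ne b}\mu_j$, $\ell=\max\{\ln(27\delta_{\max}^3/(8\sigma_{\min}^4)),0\}$, $$q(s)=4\sigma_{\max}k^{-1/8}s^{-1/8}\exp\left\{-\frac{k^{1/4}s^{1/4}}{8\sigma_{\max}^2}\right\},$$ and, for $i\ne b$, $\underline\rho_{i,b,t}=\min\{\underline\rho^{(1)}_{i,b,t},\underline\rho^{(2)}_{i,b,t}\}$, $\overline\rho_{i,b,t}=\max\{\overline\rho^{(1)}_{i,b,t},\overline\rho^{(2)}_{i,b,t}\}$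 with $$\underline\rho^{(1)}_{i,b,t}=\frac{m-(\frac34t)^{-1/4}}{\left(1+(\frac{3t}{4k})^{-3/4}\right)^2\sigma_b}\left(\frac{(\mu_b-\mu_i+(\frac34t)^{-1/4})^2}{\sigma_i^2}+\frac{16k}{\sqrt{3t}}+\frac{8k\ell}{3t}\right)^{-1/2},$$ $$\underline\rho^{(2)}_{i,b,t}=\frac{m-t^{-1/4}}{\left(1+(\frac tk)^{-3/4}\right)\sigma_b}\left(\frac{(\mu_b-\mu_i+t^{-1/4})^2}{\sigma_i^2}+\frac{8k}{\sqrt t}+\frac{2k\ell}{t}\right)^{-1/2},$$ $$\overline\rho^{(1)}_{i,b,t}=\frac{\left(1+(\frac tk)^{-3/4}\right)\sigma_i}{\mu_b-\mu_i-t^{-1/4}}\left(\frac{(m+t^{-1/4})^2}{\sigma_b^2}+\frac{8k}{\sqrt t}+\frac{2k\ell}{t}\right)^{1/2},$$ $$\overline\rho^{(2)}_{i,b,t}=\frac{\left(1+(\frac{3t}{4k})^{-3/4}\right)^2\sigma_i}{\mu_b-\mu_i-(\frac34t)^{-1/4}}\left(\frac{(m+(\frac34t)^{-1/4})^2}{\sigma_b^2}+\frac{16k}{\sqrt{3t}}+\frac{8k\ell}{3t}\right)^{1/2}.$$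 **Theorem.** Under the KG algorithm: 1. There is a $T$ such that for all rounds $t>T$ $$R_t<\frac{\sum_{i\ne b}(\mu_b-\mu_i)\,\overline\rho_{i,b,t}}{1+\sum_{i\ne b}\underline\rho_{i,b,t}}\,t+k\sum_{i\ne b}(\mu_b-\mu_i)\,q\!\left(\tfrac34t\right)t.$$ 2. $$\lim_{t\to\infty}\frac{R_t}{t}=\frac{\sum_{i\ne b}\sigma_i}{\dfrac{\sigma_b}{\mu_b-\max_{j\ne b}\mu_j}+\sum_{i\ne b}\dfrac{\sigma_i}{\mu_b-\mu_i}}.$$ -/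

import Mathlib

open MeasureTheory ProbabilityTheory Filter Topology
open scoped ENNReal

noncomputable section

namespace KG

/-! Rounds are numbered from `0`: `a s` is the arm pulled and `x s` the reward observed in the
round with index `s`, and an index `t` on a state variable means "after `t` rounds", that is
after the rounds `0, …, t - 1`. -/

/-- `max_{j ≠ i} y_j`. -/
def maxOther {k : ℕ} (y : Fin k → ℝ) (i : Fin k) : ℝ := ⨆ j : {j : Fin k // j ≠ i}, y j

/-- The posterior variance `(λ⁻² + σ⁻²)⁻¹` after one more observation with noise level `σ`,
when the current variance is `l = λ² ∈ [0, ∞]`. -/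
def newVar (σ : ℝ) (l : ℝ≥0∞) : ℝ≥0∞ := (l⁻¹ + (ENNReal.ofReal (σ ^ 2))⁻¹)⁻¹

/-- The posterior variance `λ_i²` after `t` rounds, started from the non-informative prior
`λ_i² = ∞`. -/
def postVar {k : ℕ} (σ : Fin k → ℝ) (a : ℕ → Fin k) : ℕ → Fin k → ℝ≥0∞
  | 0, _ => ⊤
  | t + 1, i => if a t = i then newVar (σ i) (postVar σ a t i) else postVar σ a t i

/-- The posterior mean `θ_i` after `t` rounds, started from `θ_i = 0`. -/
def postMean {k : ℕ} (σ : Fin k → ℝ) (a : ℕ → Fin k) (x : ℕ → ℝ) : ℕ → Fin k → ℝ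
  | 0, _ => 0
  | t + 1, i =>
    if a t = i then
      ((postVar σ a t i)⁻¹.toReal * postMean σ a x t i + (σ i ^ 2)⁻¹ * x t) /
        ((postVar σ a t i)⁻¹.toReal + (σ i ^ 2)⁻¹)
    else postMean σ a x t i

/-- `f(z) = z Φ(z) + φ(z)` with the distribution function `Φ` and the density `φ` of the
standard normal distribution. -/
def f (z : ℝ) : ℝ := z * cdf (gaussianReal 0 1) z + gaussianPDFReal 0 1 z

/-- `ζ_i²`, the decrease of the posterior variance of arm `i` if it is pulled next. -/
def zetaSq {k : ℕ} (σ : Fin k → ℝ) (a : ℕ → Fin k) (t : ℕ) (i : Fin k) : ℝ≥0∞ :=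
  postVar σ a t i - newVar (σ i) (postVar σ a t i)

/-- The knowledge gradient `v_i = ζ_i f(-|θ_i - max_{j ≠ i} θ_j| / ζ_i)` after `t` rounds. It is
`∞` for `ζ_i = ∞`, which is the case exactly as long as arm `i` has not been pulled. -/
def kgValue {k : ℕ} (σ : Fin k → ℝ) (a : ℕ → Fin k) (x : ℕ → ℝ) (t : ℕ) (i : Fin k) : EReal :=
  if zetaSq σ a t i = ⊤ then ⊤
  else
    ((√(zetaSq σ a t i).toReal *
      f (-(|postMean σ a x t i - maxOther (postMean σ a x t) i| /
        √(zetaSq σ a t i).toReal)) : ℝ) : EReal)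

/-- In every round the arm pulled maximizes the knowledge gradient. -/
def IsKGPath {k : ℕ} (σ : Fin k → ℝ) (a : ℕ → Fin k) (x : ℕ → ℝ) : Prop :=
  ∀ (t : ℕ) (i : Fin k), kgValue σ a x t i ≤ kgValue σ a x t (a t)

/-- The number of pulls of arm `i` in the first `t` rounds. -/
def pulls {k : ℕ} (a : ℕ → Fin k) (t : ℕ) (i : Fin k) : ℕ :=
  ((Finset.range t).filter (fun s => a s = i)).card

/-- The cumulative regret `R_t = ∑_{i ≠ b} (μ_b - μ_i) E[N_{i,t}]` after `t` rounds. -/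
def cumRegret {k : ℕ} {Ω : Type*} [MeasurableSpace Ω] (P : Measure Ω) (μ : Fin k → ℝ) (b : Fin k)
    (I : ℕ → Ω → Fin k) (t : ℕ) : ℝ :=
  ∑ i ∈ Finset.univ.erase b, (μ b - μ i) * ∫ ω, (pulls (fun s => I s ω) t i : ℝ) ∂P

def sigmaMax {k : ℕ} (σ : Fin k → ℝ) : ℝ := ⨆ i, σ i

def sigmaMin {k : ℕ} (σ : Fin k → ℝ) : ℝ := ⨅ i, σ i

/-- `δ_max = max_{i ≠ j} |μ_i - μ_j|`. -/
def deltaMax {k : ℕ} (μ : Fin k → ℝ) : ℝ :=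
  ⨆ p : {p : Fin k × Fin k // p.1 ≠ p.2}, |μ p.1.1 - μ p.1.2|

/-- `q(s) = 4 σ_max k^(-1/8) s^(-1/8) exp(-k^(1/4) s^(1/4) / (8 σ_max²))`. -/
def q {k : ℕ} (σ : Fin k → ℝ) (s : ℝ) : ℝ :=
  4 * sigmaMax σ * (k : ℝ) ^ (-(1 / 8) : ℝ) * s ^ (-(1 / 8) : ℝ) *
    Real.exp (-((k : ℝ) ^ (1 / 4 : ℝ) * s ^ (1 / 4 : ℝ) / (8 * sigmaMax σ ^ 2)))

/-- `max {ln (27 δ_max³ / (8 σ_min⁴)), 0}`. -/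
def logTerm {k : ℕ} (μ σ : Fin k → ℝ) : ℝ :=
  max (Real.log (27 * deltaMax μ ^ 3 / (8 * sigmaMin σ ^ 4))) 0

def rhoLow1 {k : ℕ} (μ σ : Fin k → ℝ) (b i : Fin k) (t : ℝ) : ℝ :=
  (μ b - maxOther μ b - (3 / 4 * t) ^ (-(1 / 4) : ℝ)) /
      ((1 + (3 * t / (4 * k)) ^ (-(3 / 4) : ℝ)) ^ 2 * σ b) *
    ((μ b - μ i + (3 / 4 * t) ^ (-(1 / 4) : ℝ)) ^ 2 / σ i ^ 2 + 16 * k / √(3 * t)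
      + 8 * k * logTerm μ σ / (3 * t)) ^ (-(1 / 2) : ℝ)

def rhoLow2 {k : ℕ} (μ σ : Fin k → ℝ) (b i : Fin k) (t : ℝ) : ℝ :=
  (μ b - maxOther μ b - t ^ (-(1 / 4) : ℝ)) / ((1 + (t / k) ^ (-(3 / 4) : ℝ)) * σ b) *
    ((μ b - μ i + t ^ (-(1 / 4) : ℝ)) ^ 2 / σ i ^ 2 + 8 * k / √t
      + 2 * k * logTerm μ σ / t) ^ (-(1 / 2) : ℝ)

def rhoUp1 {k : ℕ} (μ σ : Fin k → ℝ) (b i : Fin k) (t : ℝ) : ℝ :=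
  (1 + (t / k) ^ (-(3 / 4) : ℝ)) * σ i / (μ b - μ i - t ^ (-(1 / 4) : ℝ)) *
    ((μ b - maxOther μ b + t ^ (-(1 / 4) : ℝ)) ^ 2 / σ b ^ 2 + 8 * k / √t
      + 2 * k * logTerm μ σ / t) ^ (1 / 2 : ℝ)

def rhoUp2 {k : ℕ} (μ σ : Fin k → ℝ) (b i : Fin k) (t : ℝ) : ℝ :=
  (1 + (3 * t / (4 * k)) ^ (-(3 / 4) : ℝ)) ^ 2 * σ i /
      (μ b - μ i - (3 / 4 * t) ^ (-(1 / 4) : ℝ)) *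
    ((μ b - maxOther μ b + (3 / 4 * t) ^ (-(1 / 4) : ℝ)) ^ 2 / σ b ^ 2 + 16 * k / √(3 * t)
      + 8 * k * logTerm μ σ / (3 * t)) ^ (1 / 2 : ℝ)

/-- The lower bound on `N_{i,t} / N_{b,t}`. -/
def rhoLow {k : ℕ} (μ σ : Fin k → ℝ) (b i : Fin k) (t : ℝ) : ℝ :=
  min (rhoLow1 μ σ b i t) (rhoLow2 μ σ b i t)

/-- The upper bound on `N_{i,t} / N_{b,t}`. -/
def rhoUp {k : ℕ} (μ σ : Fin k → ℝ) (b i : Fin k) (t : ℝ) : ℝ :=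
  max (rhoUp1 μ σ b i t) (rhoUp2 μ σ b i t)

end KG

end

/-!
The knowledge gradient `ζ f(-Δ/ζ)` of an arm with `n` samples has `ζ ≈ σ / n`, and `f` decays like
a Gaussian tail, so that maximizing it amounts to balancing the exponents `n_i Δ_i / σ_i`, where
`Δ_i` is the gap of arm `i` to the best of the other arms. As soon as all sample means are accurate,
`Δ_i` is close to the true gap `d_i` (`μ_b - μ_i` for `i ≠ b`, and `μ_b - max_{j ≠ b} μ_j` for
`b`), and looking at the last pull of each arm gives `n_i d_i / σ_i ≈ n_j d_j / σ_j` for all pairs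
(`KG.pulls_balance`). The shares `n_i / t` are then nearly proportional to `σ_i / d_i`, which is the
limit in the second claim.

The first claim follows from a rate. On a typical path the shares are within `O(t ^ (-15/32))` of
their limits (`KG.eventually_abs_pulls_sub_le`), paths fail to be typical with probability
`O(t ^ (-5/16))`, and hence `R_t = L t + O(t ^ (11/16))`. The bounds `rhoUp` and `rhoLow` on the
other hand leave a margin of order `t ^ (-1/4)` on the favourable side of the limiting ratios
(`KG.le_rhoUp`, `KG.rhoLow_le`), so that the claimed bound exceeds `L t` by a multiple of
`t ^ (3/4)`; the term with `q` only has to be nonnegative.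

The main difficulty is to exclude that an arm is starved, for instance because the first samples of
the best arm are bad. The knowledge gradient of an arm with few samples is not too small; hence an
arm `j` that is pulled meanwhile, and has many samples, must be close to a tie with its competitor
`l`, which is then well sampled too, so that `μ_j = μ_l` by accuracy of the means
(`KG.exists_many_tieRounds`). Suboptimal arms of equal means can indeed be close to a tie, but
not for long: the difference of their sample means behaves like a random walk, and a convex
function of it gains a definite amount in every round close to a tie, while its size after `t`
rounds is controlled by second moments. This discrete version of Tanaka's formula
(`KG.tiePotential_succ_ge`, `KG.IsSampling.integral_card_tieRounds_le`) bounds the expected number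
of such rounds by `O(h t ^ (3/2))` if closeness means a distance of at most `h`. Accuracy of the
sample means comes from the exponential martingale (`KG.IsSampling.lintegral_exp_noiseSum`)
and a union bound over rounds and sample sizes.
-/

/-! ### The function `f` -/

namespace KG

lemma gaussianPDFReal_std (x : ℝ) :
    gaussianPDFReal 0 1 x = (√(2 * Real.pi))⁻¹ * Real.exp (-(1 / 2) * x ^ 2) := by
  simp only [gaussianPDFReal, NNReal.coe_one, mul_one, sub_zero]
  congr 2
  ring

lemma integrable_mul_gaussianPDFReal_std :
    Integrable (fun x : ℝ => x * gaussianPDFReal 0 1 x) := by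
  have h := (integrable_mul_exp_neg_mul_sq (b := 1 / 2) (by norm_num)).const_mul
    (√(2 * Real.pi))⁻¹
  refine h.congr (Eventually.of_forall fun x => ?_)
  simp only [gaussianPDFReal_std]
  ring

lemma tendsto_gaussianPDFReal_std_atBot :
    Tendsto (gaussianPDFReal 0 1) atBot (𝓝 0) := by
  have h1 : Tendsto (fun x : ℝ => -(1 / 2) * x ^ 2) atBot atBot := by
    have h2 : Tendsto (fun x : ℝ => x ^ 2) atBot atTop := by
      refine ((tendsto_pow_atTop two_ne_zero).comp tendsto_neg_atBot_atTop).congr fun x => ?_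
      simp
    exact h2.const_mul_atTop_of_neg (by norm_num)
  have h3 := (Real.tendsto_exp_atBot.comp h1).const_mul (√(2 * Real.pi))⁻¹
  rw [mul_zero] at h3
  exact h3.congr fun x => (gaussianPDFReal_std x).symm

lemma hasDerivAt_gaussianPDFReal_std (x : ℝ) :
    HasDerivAt (gaussianPDFReal 0 1) (-(x * gaussianPDFReal 0 1 x)) x := by
  have h : HasDerivAt (fun y : ℝ => (√(2 * Real.pi))⁻¹ * Real.exp (-(1 / 2) * y ^ 2))
      ((√(2 * Real.pi))⁻¹ * (Real.exp (-(1 / 2) * x ^ 2) * (-(1 / 2) * (2 * x)))) x := by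
    have h1 : HasDerivAt (fun y : ℝ => -(1 / 2) * y ^ 2) (-(1 / 2) * (2 * x)) x := by
      simpa using (hasDerivAt_pow 2 x).const_mul (-(1 / 2) : ℝ)
    exact h1.exp.const_mul _
  have e : gaussianPDFReal 0 1 =
      fun y : ℝ => (√(2 * Real.pi))⁻¹ * Real.exp (-(1 / 2) * y ^ 2) :=
    funext gaussianPDFReal_std
  rw [gaussianPDFReal_std, e]
  convert h using 1
  ring

lemma integrable_posPart_mul_pdf (z : ℝ) :
    Integrable (fun u : ℝ => max (z - u) 0 * gaussianPDFReal 0 1 u) := by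
  have h : Integrable (fun u : ℝ => z * gaussianPDFReal 0 1 u - u * gaussianPDFReal 0 1 u) :=
    ((integrable_gaussianPDFReal 0 1).const_mul z).sub integrable_mul_gaussianPDFReal_std
  refine h.abs.mono' ?_ (Eventually.of_forall fun u => ?_)
  · exact (((continuous_const.sub continuous_id).max continuous_const).measurable.mul
      (measurable_gaussianPDFReal 0 1)).aestronglyMeasurable
  · have hp := gaussianPDFReal_nonneg 0 1 u
    rw [← sub_mul, Real.norm_eq_abs, abs_mul, abs_mul, abs_of_nonneg hp,
      abs_of_nonneg (le_max_right _ _)]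
    exact mul_le_mul_of_nonneg_right (max_le (le_abs_self _) (abs_nonneg _)) hp

/-- `f(z) = E (z - Z)⁺` for a standard normal `Z`. -/
lemma f_eq_integral (z : ℝ) : f z = ∫ u, max (z - u) 0 * gaussianPDFReal 0 1 u := by
  have h1 : ∫ u, max (z - u) 0 * gaussianPDFReal 0 1 u
      = ∫ u in Set.Iic z, (z * gaussianPDFReal 0 1 u - u * gaussianPDFReal 0 1 u) := by
    rw [← integral_indicator measurableSet_Iic]
    congr 1
    ext u
    by_cases hu : u ≤ z
    · rw [Set.indicator_of_mem (by exact hu), max_eq_left (by linarith)]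
      ring
    · rw [Set.indicator_of_notMem (by exact hu), max_eq_right (by linarith), zero_mul]
  have h2 : ∫ u in Set.Iic z, -(u * gaussianPDFReal 0 1 u) = gaussianPDFReal 0 1 z - 0 :=
    integral_Iic_of_hasDerivAt_of_tendsto' (fun x _ => hasDerivAt_gaussianPDFReal_std x)
      integrable_mul_gaussianPDFReal_std.neg.integrableOn tendsto_gaussianPDFReal_std_atBot
  have h3 : cdf (gaussianReal 0 1) z = ∫ u in Set.Iic z, gaussianPDFReal 0 1 u := by
    rw [cdf_eq_real, Measure.real, gaussianReal_apply_eq_integral 0 one_ne_zero,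
      ENNReal.toReal_ofReal]
    exact setIntegral_nonneg measurableSet_Iic fun u _ => gaussianPDFReal_nonneg 0 1 u
  rw [h1, integral_sub ((integrable_gaussianPDFReal 0 1).const_mul z).integrableOn
    integrable_mul_gaussianPDFReal_std.integrableOn, integral_const_mul, ← h3, f]
  rw [integral_neg] at h2
  linarith

lemma f_strictMono : StrictMono f := by
  intro y z hyz
  rw [f_eq_integral, f_eq_integral, ← sub_pos,
    ← integral_sub (integrable_posPart_mul_pdf z) (integrable_posPart_mul_pdf y)]
  have hpos : ∀ u, 0 < gaussianPDFReal 0 1 u := fun u => gaussianPDFReal_pos 0 1 u one_ne_zero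
  have hnn : ∀ u, 0 ≤ max (z - u) 0 * gaussianPDFReal 0 1 u
      - max (y - u) 0 * gaussianPDFReal 0 1 u := fun u => by
    rw [← sub_mul]
    exact mul_nonneg (sub_nonneg.2 (max_le_max_right _ (by linarith))) (hpos u).le
  rw [integral_pos_iff_support_of_nonneg hnn
    ((integrable_posPart_mul_pdf z).sub (integrable_posPart_mul_pdf y))]
  refine lt_of_lt_of_le (b := volume (Set.Iio z)) (by simp) (measure_mono fun u hu => ?_)
  have hu' : u < z := hu
  rw [Function.mem_support, ← sub_mul]
  refine (mul_pos (sub_pos.2 ?_) (hpos u)).ne'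
  exact max_lt (lt_max_of_lt_left (by linarith)) (lt_max_of_lt_left (by linarith))

lemma f_nonneg (z : ℝ) : 0 ≤ f z := by
  rw [f_eq_integral]
  exact integral_nonneg fun u => mul_nonneg (le_max_right _ _) (gaussianPDFReal_nonneg 0 1 u)

lemma f_pos (z : ℝ) : 0 < f z :=
  (f_nonneg (z - 1)).trans_lt (f_strictMono (by linarith))

/-- The Gaussian decay of `f` at `-∞`, in ratio form: it follows from the substitution
`u ↦ u - 1` in `f(z - 1) = E (z - 1 - Z)⁺`. -/
lemma f_sub_one_le (z : ℝ) : f (z - 1) ≤ Real.exp z * f z := by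
  rw [f_eq_integral, f_eq_integral, ← integral_const_mul,
    ← integral_sub_right_eq_self (fun u => max (z - 1 - u) 0 * gaussianPDFReal 0 1 u) 1]
  refine integral_mono ?_ ((integrable_posPart_mul_pdf z).const_mul _) fun u => ?_
  · exact (integrable_posPart_mul_pdf (z - 1)).comp_sub_right 1
  · have e : z - 1 - (u - 1) = z - u := by ring
    simp only [e]
    rcases le_or_gt z u with h | h
    · rw [max_eq_right (by linarith)]
      simp
    · rw [mul_left_comm]
      refine mul_le_mul_of_nonneg_left ?_ (le_max_right _ _)
      rw [gaussianPDFReal_std, gaussianPDFReal_std, mul_left_comm]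
      refine mul_le_mul_of_nonneg_left ?_ (by positivity)
      rw [← Real.exp_add, Real.exp_le_exp]
      nlinarith

/-! ### Comparison of two values `ζ f(-Δ/ζ)` -/

/-- An arm with the smaller `ζ` and the larger value has the smaller `Δ / ζ`. -/
lemma div_le_div_of_value_le {zi zj Di Dj : ℝ} (hzi : 0 < zi) (hij : zj ≤ zi)
    (hv : zi * f (-(Di / zi)) ≤ zj * f (-(Dj / zj))) : Dj / zj ≤ Di / zi := by
  by_contra! h
  have h1 : f (-(Dj / zj)) < f (-(Di / zi)) := f_strictMono (by linarith)
  have h2 : zj * f (-(Dj / zj)) ≤ zi * f (-(Dj / zj)) :=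
    mul_le_mul_of_nonneg_right hij (f_nonneg _)
  have h3 := mul_lt_mul_of_pos_left h1 hzi
  linarith

/-- An arm with the smaller gap and the smaller value has the smaller `ζ`. -/
lemma zeta_le_of_value_le {zl zj Dl Dj : ℝ} (hzl : 0 < zl) (hzj : 0 < zj) (hDj : 0 ≤ Dj)
    (hD : Dl ≤ Dj)
    (hv : zl * f (-(Dl / zl)) ≤ zj * f (-(Dj / zj))) : zl ≤ zj := by
  by_contra! h
  have h0 : Dl / zl ≤ Dj / zj :=
    (div_le_div_of_nonneg_right hD hzl.le).trans (div_le_div_of_nonneg_left hDj hzj h.le)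
  have h1 : f (-(Dj / zj)) ≤ f (-(Dl / zl)) := f_strictMono.monotone (by linarith)
  have h2 : zj * f (-(Dl / zl)) < zl * f (-(Dl / zl)) := mul_lt_mul_of_pos_right h (f_pos _)
  have h3 := mul_le_mul_of_nonneg_left h1 hzj.le
  linarith

/-- For comparable `ζ` the values determine the order of the `Δ / ζ` up to an error `1`: a step of
`1` costs a factor `exp (-Δ/ζ)`, which beats any constant ratio of the `ζ`. -/
lemma div_le_div_add_one_of_value_le {zi zj Di Dj C : ℝ} (hzi : 0 < zi)
    (hC : zj ≤ C * zi) (hexp : C < Real.exp (Di / zi))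
    (hv : zi * f (-(Di / zi)) ≤ zj * f (-(Dj / zj))) : Dj / zj ≤ Di / zi + 1 := by
  by_contra! h
  have h1 : f (-(Dj / zj)) ≤ f (-(Di / zi) - 1) := f_strictMono.monotone (by linarith)
  have h2 := f_sub_one_le (-(Di / zi))
  have h3 : zj * f (-(Dj / zj)) ≤ (C * zi) * f (-(Dj / zj)) :=
    mul_le_mul_of_nonneg_right hC (f_nonneg _)
  have hf := f_pos (-(Di / zi))
  have he := Real.exp_pos (-(Di / zi))
  have hfj := f_pos (-(Dj / zj))
  have h4 : (C * zi) * f (-(Dj / zj)) < zi * f (-(Di / zi)) := by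
    have h5 : C * f (-(Dj / zj)) < Real.exp (Di / zi) * f (-(Dj / zj)) :=
      mul_lt_mul_of_pos_right hexp hfj
    have h6 : Real.exp (Di / zi) * f (-(Dj / zj)) ≤ f (-(Di / zi)) := by
      calc _ ≤ Real.exp (Di / zi) * (Real.exp (-(Di / zi)) * f (-(Di / zi))) :=
            mul_le_mul_of_nonneg_left (h1.trans h2) (Real.exp_pos _).le
        _ = f (-(Di / zi)) := by rw [← mul_assoc, ← Real.exp_add]; simp
    nlinarith
  linarith

end KG

/-! ### The state of the algorithm along a path -/

namespace KG

variable {k : ℕ}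

/-- `∑ (x_s - μ_i)` over the rounds `s < t` in which arm `i` is pulled. -/
noncomputable def noiseSum (μ : Fin k → ℝ) (a : ℕ → Fin k) (x : ℕ → ℝ) (t : ℕ) (i : Fin k) : ℝ :=
  ∑ s ∈ Finset.range t, if a s = i then x s - μ i else 0

lemma noiseSum_zero (μ : Fin k → ℝ) (a : ℕ → Fin k) (x : ℕ → ℝ) (i : Fin k) :
    noiseSum μ a x 0 i = 0 := by simp [noiseSum]

lemma noiseSum_succ (μ : Fin k → ℝ) (a : ℕ → Fin k) (x : ℕ → ℝ) (t : ℕ) (i : Fin k) :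
    noiseSum μ a x (t + 1) i = noiseSum μ a x t i + if a t = i then x t - μ i else 0 := by
  simp [noiseSum, Finset.sum_range_succ]

lemma pulls_zero (a : ℕ → Fin k) (i : Fin k) : pulls a 0 i = 0 := by simp [pulls]

lemma pulls_succ (a : ℕ → Fin k) (t : ℕ) (i : Fin k) :
    pulls a (t + 1) i = pulls a t i + if a t = i then 1 else 0 := by
  rw [pulls, Finset.range_add_one, Finset.filter_insert]
  split_ifs with h
  · rw [Finset.card_insert_of_notMem (by simp), pulls]
  · rw [pulls, add_zero]

lemma pulls_mono (a : ℕ → Fin k) (i : Fin k) : Monotone fun t => pulls a t i :=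
  monotone_nat_of_le_succ fun t => by rw [pulls_succ]; omega

lemma pulls_le (a : ℕ → Fin k) (t : ℕ) (i : Fin k) : pulls a t i ≤ t := by
  simpa [pulls] using Finset.card_filter_le (Finset.range t) (fun s => a s = i)

lemma sum_pulls (a : ℕ → Fin k) (t : ℕ) : ∑ i, pulls a t i = t := by
  simpa [pulls] using (Finset.card_eq_sum_card_fiberwise (s := Finset.range t) (f := a)
    (t := Finset.univ) (fun _ _ => Finset.mem_coe.2 (Finset.mem_univ _))).symm

/-- The last pull of arm `j` in the rounds `u, …, t - 1`. -/
lemma exists_last_pull (a : ℕ → Fin k) (j : Fin k) {u t : ℕ} (hut : u ≤ t)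
    (h : pulls a u j < pulls a t j) :
    ∃ s, u ≤ s ∧ s < t ∧ a s = j ∧ pulls a s j + 1 = pulls a t j := by
  induction t, hut using Nat.le_induction with
  | base => exact absurd h (lt_irrefl _)
  | succ t hut ih =>
    by_cases hj : a t = j
    · exact ⟨t, hut, t.lt_succ_self, hj, by rw [pulls_succ, if_pos hj]⟩
    · rw [pulls_succ, if_neg hj, add_zero] at h ⊢
      obtain ⟨s, h1, h2, h3, h4⟩ := ih h
      exact ⟨s, h1, h2.trans t.lt_succ_self, h3, h4⟩

/-- All but `m` of the pulls of arm `j` happen after at least `m` earlier pulls of it. -/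
lemma pulls_le_card_add (a : ℕ → Fin k) (j : Fin k) (m t : ℕ) :
    pulls a t j ≤ ((Finset.range t).filter fun s => a s = j ∧ m ≤ pulls a s j).card + m := by
  suffices h : pulls a t j
      ≤ ((Finset.range t).filter fun s => a s = j ∧ m ≤ pulls a s j).card + min m (pulls a t j) by
    omega
  induction t with
  | zero => simp [pulls_zero]
  | succ t ih =>
    rw [Finset.range_add_one, Finset.filter_insert, pulls_succ]
    have hs : t ∉ (Finset.range t).filter fun s => a s = j ∧ m ≤ pulls a s j := by simp
    by_cases hj : a t = j
    · by_cases hm : m ≤ pulls a t j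
      · simp only [hj, hm, and_self, if_true, Finset.card_insert_of_notMem hs]
        omega
      · simp only [hj, hm, and_false, if_true, if_false]
        omega
    · simp only [hj, false_and, if_false]
      omega

lemma newVar_top (s : ℝ) : newVar s ⊤ = ENNReal.ofReal (s ^ 2) := by simp [newVar]

lemma newVar_ofReal {s : ℝ} (hs : 0 < s) {n : ℕ} (hn : 0 < n) :
    newVar s (ENNReal.ofReal (s ^ 2 / n)) = ENNReal.ofReal (s ^ 2 / (n + 1)) := by
  have hn' : (0 : ℝ) < n := by exact_mod_cast hn
  rw [newVar, ← ENNReal.ofReal_inv_of_pos (by positivity),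
    ← ENNReal.ofReal_inv_of_pos (by positivity),
    ← ENNReal.ofReal_add (by positivity) (by positivity),
    ← ENNReal.ofReal_inv_of_pos (by positivity)]
  congr 1
  field_simp

lemma postVar_eq {σ : Fin k → ℝ} (hσ : ∀ i, 0 < σ i) (a : ℕ → Fin k) (t : ℕ) (i : Fin k) :
    postVar σ a t i =
      if pulls a t i = 0 then ⊤ else ENNReal.ofReal (σ i ^ 2 / (pulls a t i : ℝ)) := by
  induction t with
  | zero => simp [postVar, pulls_zero]
  | succ t ih =>
    rw [postVar, pulls_succ]
    by_cases hi : a t = i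
    · rw [if_pos hi, if_pos hi, if_neg (Nat.succ_ne_zero _), ih]
      by_cases h0 : pulls a t i = 0
      · rw [if_pos h0, newVar_top, h0]
        simp
      · rw [if_neg h0, newVar_ofReal (hσ i) (Nat.pos_of_ne_zero h0)]
        push_cast
        rfl
    · rw [if_neg hi, if_neg hi, ih, add_zero]

lemma zetaSq_eq_top {σ : Fin k → ℝ} (hσ : ∀ i, 0 < σ i) {a : ℕ → Fin k} {t : ℕ} {i : Fin k}
    (h : pulls a t i = 0) : zetaSq σ a t i = ⊤ := by
  rw [zetaSq, postVar_eq hσ, if_pos h, newVar_top]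
  exact ENNReal.top_sub ENNReal.ofReal_ne_top

lemma zetaSq_eq_ofReal {σ : Fin k → ℝ} (hσ : ∀ i, 0 < σ i) {a : ℕ → Fin k} {t : ℕ} {i : Fin k}
    (h : 0 < pulls a t i) : zetaSq σ a t i =
      ENNReal.ofReal (σ i ^ 2 / ((pulls a t i : ℝ) * (pulls a t i + 1))) := by
  have hn' : (0 : ℝ) < pulls a t i := by exact_mod_cast h
  have := hσ i
  rw [zetaSq, postVar_eq hσ, if_neg h.ne', newVar_ofReal (hσ i) h,
    ← ENNReal.ofReal_sub _ (by positivity)]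
  congr 1
  field_simp
  ring

/-- The posterior mean is the sample mean. -/
lemma postMean_eq {σ : Fin k → ℝ} (hσ : ∀ i, 0 < σ i) (μ : Fin k → ℝ) (a : ℕ → Fin k)
    (x : ℕ → ℝ) {t : ℕ} {i : Fin k} (h : 0 < pulls a t i) :
    postMean σ a x t i = μ i + noiseSum μ a x t i / pulls a t i := by
  have hi := hσ i
  induction t with
  | zero => simp [pulls_zero] at h
  | succ t ih =>
    rw [postMean, noiseSum_succ]
    rw [pulls_succ] at h ⊢
    by_cases ha : a t = i
    · rw [if_pos ha, if_pos ha, if_pos ha, postVar_eq hσ]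
      by_cases h0 : pulls a t i = 0
      · have hS : noiseSum μ a x t i = 0 := by
          refine Finset.sum_eq_zero fun s hs => if_neg fun hsi => ?_
          have : s ∈ (Finset.range t).filter (fun s => a s = i) := Finset.mem_filter.2 ⟨hs, hsi⟩
          rw [Finset.card_eq_zero.1 h0] at this
          simp at this
        rw [if_pos h0, hS, h0]
        simp
        field_simp
      · have hn' : (0 : ℝ) < pulls a t i := by exact_mod_cast Nat.pos_of_ne_zero h0
        rw [if_neg h0, ih (Nat.pos_of_ne_zero h0), ← ENNReal.ofReal_inv_of_pos (by positivity),
          ENNReal.toReal_ofReal (by positivity)]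
        push_cast
        field_simp
        ring
    · rw [if_neg ha, if_neg ha, if_neg ha, add_zero, add_zero]
      rw [if_neg ha, add_zero] at h
      exact ih h

/-- `ζ_i` as a real number, for an arm that has been pulled. -/
noncomputable def zeta (σ : Fin k → ℝ) (a : ℕ → Fin k) (t : ℕ) (i : Fin k) : ℝ :=
  √(zetaSq σ a t i).toReal

/-- The gap `|θ_i - max_{j ≠ i} θ_j|` of an arm. -/
noncomputable def gap (y : Fin k → ℝ) (i : Fin k) : ℝ := |y i - maxOther y i|

lemma gap_nonneg (y : Fin k → ℝ) (i : Fin k) : 0 ≤ gap y i := abs_nonneg _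

lemma zeta_sq {σ : Fin k → ℝ} (hσ : ∀ i, 0 < σ i) {a : ℕ → Fin k} {t : ℕ} {i : Fin k}
    (h : 0 < pulls a t i) :
    zeta σ a t i ^ 2 = σ i ^ 2 / ((pulls a t i : ℝ) * (pulls a t i + 1)) := by
  have := hσ i
  rw [zeta, zetaSq_eq_ofReal hσ h, Real.sq_sqrt ENNReal.toReal_nonneg,
    ENNReal.toReal_ofReal (by positivity)]

lemma zeta_pos {σ : Fin k → ℝ} (hσ : ∀ i, 0 < σ i) {a : ℕ → Fin k} {t : ℕ} {i : Fin k}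
    (h : 0 < pulls a t i) :
    0 < zeta σ a t i := by
  have hn' : (0 : ℝ) < pulls a t i := by exact_mod_cast h
  have h1 := zeta_sq hσ h
  have h2 : 0 < zeta σ a t i ^ 2 := by
    have := hσ i
    rw [h1]; positivity
  have h3 : 0 ≤ zeta σ a t i := Real.sqrt_nonneg _
  exact lt_of_le_of_ne h3 fun h4 => by simp [← h4] at h2

lemma zeta_le {σ : Fin k → ℝ} (hσ : ∀ i, 0 < σ i) {a : ℕ → Fin k} {t : ℕ} {i : Fin k}
    (h : 0 < pulls a t i) :
    zeta σ a t i ≤ σ i / pulls a t i := by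
  have hn' : (0 : ℝ) < pulls a t i := by exact_mod_cast h
  have hs := hσ i
  refine (pow_le_pow_iff_left₀ (zeta_pos hσ h).le (by positivity) two_ne_zero).1 ?_
  rw [zeta_sq hσ h, div_pow]
  exact div_le_div_of_nonneg_left (by positivity) (by positivity) (by nlinarith)

lemma le_zeta {σ : Fin k → ℝ} (hσ : ∀ i, 0 < σ i) {a : ℕ → Fin k} {t : ℕ} {i : Fin k}
    (h : 0 < pulls a t i) :
    σ i / (pulls a t i + 1) ≤ zeta σ a t i := by
  have hn' : (0 : ℝ) < pulls a t i := by exact_mod_cast h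
  have hs := hσ i
  refine (pow_le_pow_iff_left₀ (by positivity) (zeta_pos hσ h).le two_ne_zero).1 ?_
  rw [zeta_sq hσ h, div_pow]
  exact div_le_div_of_nonneg_left (by positivity) (by positivity) (by nlinarith)

lemma kgValue_eq {σ : Fin k → ℝ} (hσ : ∀ i, 0 < σ i) {a : ℕ → Fin k} {t : ℕ} {i : Fin k}
    (h : 0 < pulls a t i)
    (x : ℕ → ℝ) : kgValue σ a x t i =
    ((zeta σ a t i * f (-(gap (postMean σ a x t) i / zeta σ a t i)) : ℝ) : EReal) := by
  rw [kgValue, if_neg (by rw [zetaSq_eq_ofReal hσ h]; exact ENNReal.ofReal_ne_top)]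
  rfl

lemma kgValue_eq_top {σ : Fin k → ℝ} (hσ : ∀ i, 0 < σ i) {a : ℕ → Fin k} {t : ℕ} {i : Fin k}
    (h : pulls a t i = 0) (x : ℕ → ℝ) : kgValue σ a x t i = ⊤ := by
  rw [kgValue, if_pos (zetaSq_eq_top hσ h)]

/-- No arm is pulled twice before every arm has been pulled. -/
lemma pulls_pos_of_pulled {σ : Fin k → ℝ} (hσ : ∀ i, 0 < σ i) {a : ℕ → Fin k} {x : ℕ → ℝ}
    (hKG : IsKGPath σ a x) {s : ℕ} (h : 0 < pulls a s (a s)) (i : Fin k) : 0 < pulls a s i := by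
  by_contra! h0
  have h1 := hKG s i
  rw [kgValue_eq_top hσ (Nat.le_zero.1 h0), kgValue_eq hσ h, top_le_iff] at h1
  exact EReal.coe_ne_top _ h1

lemma value_le_of_pulled {σ : Fin k → ℝ} (hσ : ∀ i, 0 < σ i) {a : ℕ → Fin k} {x : ℕ → ℝ}
    (hKG : IsKGPath σ a x) {s : ℕ} (h : 0 < pulls a s (a s)) (i : Fin k) :
    zeta σ a s i * f (-(gap (postMean σ a x s) i / zeta σ a s i)) ≤
    zeta σ a s (a s) * f (-(gap (postMean σ a x s) (a s) / zeta σ a s (a s))) := by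
  have h1 := hKG s i
  rw [kgValue_eq hσ (pulls_pos_of_pulled hσ hKG h i), kgValue_eq hσ h] at h1
  exact_mod_cast h1

/-! ### The maximum over the other arms -/

lemma le_maxOther (y : Fin k → ℝ) {i j : Fin k} (h : j ≠ i) : y j ≤ maxOther y i :=
  le_ciSup (f := fun j : {j : Fin k // j ≠ i} => y j) (Set.finite_range _).bddAbove ⟨j, h⟩

lemma nonempty_other (hk : 2 ≤ k) (i : Fin k) : Nonempty {j : Fin k // j ≠ i} := by
  have : Nontrivial (Fin k) := Fin.nontrivial_iff_two_le.2 hk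
  obtain ⟨j, hj⟩ := exists_ne i
  exact ⟨⟨j, hj⟩⟩

lemma maxOther_le (hk : 2 ≤ k) {y : Fin k → ℝ} {i : Fin k} {c : ℝ} (h : ∀ j ≠ i, y j ≤ c) :
    maxOther y i ≤ c :=
  have := nonempty_other hk i
  ciSup_le fun j => h j j.2

lemma exists_eq_maxOther (hk : 2 ≤ k) (y : Fin k → ℝ) (i : Fin k) :
    ∃ j ≠ i, maxOther y i = y j := by
  have := nonempty_other hk i
  obtain ⟨j, hj⟩ := exists_eq_ciSup_of_finite (f := fun j : {j : Fin k // j ≠ i} => y j)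
  exact ⟨j, j.2, hj.symm⟩

/-- Every arm `j` has a competitor `l`: the gap of `j` is its distance to `l`, and the gap of `l`
is not larger. -/
lemma exists_competitor (hk : 2 ≤ k) (y : Fin k → ℝ) (j : Fin k) :
    ∃ l ≠ j, gap y j = |y j - y l| ∧ gap y l ≤ gap y j := by
  obtain ⟨l, hl, h⟩ := exists_eq_maxOther hk y j
  refine ⟨l, hl, by rw [gap, h], ?_⟩
  have h1 : y j ≤ maxOther y l := le_maxOther y hl.symm
  rw [gap, gap, h]
  rcases le_total (y j) (y l) with h2 | h2
  · have h3 : maxOther y l ≤ y l := maxOther_le hk fun i _ => by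
      by_cases hij : i = j
      · rwa [hij]
      · exact (le_maxOther y hij).trans h.le
    rw [abs_of_nonneg (by linarith), abs_of_nonpos (by linarith)]
    linarith
  · have h3 : maxOther y l ≤ y j := maxOther_le hk fun i _ => by
      by_cases hij : i = j
      · rw [hij]
      · exact (le_maxOther y hij).trans (h.le.trans h2)
    rw [abs_of_nonpos (by linarith), abs_of_nonneg (by linarith)]
    linarith

lemma abs_gap_sub_gap_le (hk : 2 ≤ k) {y z : Fin k → ℝ} {e : ℝ} (h : ∀ i, |y i - z i| ≤ e)
    (i : Fin k) : |gap y i - gap z i| ≤ 2 * e := by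
  have h1 : |maxOther y i - maxOther z i| ≤ e := by
    rw [abs_sub_le_iff]
    constructor
    · rw [sub_le_iff_le_add]
      refine maxOther_le hk fun j hj => ?_
      have := (abs_sub_le_iff.1 (h j)).1
      have := le_maxOther z hj
      linarith
    · rw [sub_le_iff_le_add]
      refine maxOther_le hk fun j hj => ?_
      have := (abs_sub_le_iff.1 (h j)).2
      have := le_maxOther y hj
      linarith
  refine (abs_abs_sub_abs_le_abs_sub _ _).trans ?_
  have e1 : y i - maxOther y i - (z i - maxOther z i)
      = (y i - z i) - (maxOther y i - maxOther z i) := by ring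
  rw [e1]
  refine (abs_sub _ _).trans ?_
  linarith [h i]

end KG

/-! ### Typical paths, and the comparison of knowledge gradients -/

namespace KG

variable {k : ℕ}

/-- The error `θ_i - μ_i` of the sample mean (`0` for an arm that has not been pulled). -/
noncomputable def sampleErr (μ : Fin k → ℝ) (a : ℕ → Fin k) (x : ℕ → ℝ) (t : ℕ) (i : Fin k) : ℝ :=
  noiseSum μ a x t i / pulls a t i

/-- All noise sums up to time `t` stay below `r` times their natural scale. -/
def NoiseBound (μ : Fin k → ℝ) (a : ℕ → Fin k) (x : ℕ → ℝ) (r : ℝ) (t : ℕ) : Prop :=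
  ∀ s ≤ t, ∀ i, |noiseSum μ a x s i| ≤ r * √(pulls a s i)

/-- Arm `j` is pulled in round `s` while `j` and `l` have at least `m` samples and errors within
`h` of each other. For two arms of the same mean this says that `j` is pulled close to a tie with
`l`. The bound `1` on the error of `j` is harmless, and makes the next sample of `j` move its mean
with probability bounded below. -/
def NearTie (μ : Fin k → ℝ) (a : ℕ → Fin k) (x : ℕ → ℝ) (m h : ℝ) (s : ℕ) (j l : Fin k) : Prop :=
  a s = j ∧ (m ≤ pulls a s j ∧ m ≤ pulls a s l) ∧
    |sampleErr μ a x s j - sampleErr μ a x s l| ≤ h ∧ |sampleErr μ a x s j| ≤ 1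

open Classical in
/-- The rounds `s < t` in which arm `j` is pulled close to a tie with `l`. -/
noncomputable def tieRounds (μ : Fin k → ℝ) (a : ℕ → Fin k) (x : ℕ → ℝ) (m h : ℝ) (t : ℕ)
    (j l : Fin k) : Finset ℕ :=
  (Finset.range t).filter fun s => NearTie μ a x m h s j l

lemma NoiseBound.sampleErr_le {μ : Fin k → ℝ} {a : ℕ → Fin k} {x : ℕ → ℝ} {r : ℝ} {t s : ℕ}
    (hA : NoiseBound μ a x r t) (hr : 0 ≤ r) (hs : s ≤ t) {i : Fin k} {m : ℝ} (hm : 0 < m)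
    (h : m ≤ pulls a s i) : |sampleErr μ a x s i| ≤ r / √m := by
  have hn : (0 : ℝ) < pulls a s i := hm.trans_le h
  have hsq : (0 : ℝ) < √(pulls a s i) := Real.sqrt_pos.2 hn
  calc |sampleErr μ a x s i| = |noiseSum μ a x s i| / pulls a s i := by
        rw [sampleErr, abs_div, abs_of_pos hn]
    _ ≤ r * √(pulls a s i) / pulls a s i := div_le_div_of_nonneg_right (hA s hs i) hn.le
    _ = r / √(pulls a s i) := by
        rw [div_eq_div_iff hn.ne' hsq.ne', mul_assoc, Real.mul_self_sqrt hn.le]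
    _ ≤ r / √m := div_le_div_of_nonneg_left hr (Real.sqrt_pos.2 hm) (Real.sqrt_le_sqrt h)

lemma postMean_sub_eq {σ : Fin k → ℝ} (hσ : ∀ i, 0 < σ i) (μ : Fin k → ℝ) {a : ℕ → Fin k}
    (x : ℕ → ℝ) {s : ℕ} {i : Fin k} (h : 0 < pulls a s i) :
    postMean σ a x s i - μ i = sampleErr μ a x s i := by
  rw [postMean_eq hσ μ a x h, sampleErr]
  ring

lemma exists_pulls_ge (hk : 0 < k) (a : ℕ → Fin k) (t : ℕ) : ∃ j, (t : ℝ) / k ≤ pulls a t j := by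
  by_contra! h
  have : Nonempty (Fin k) := ⟨⟨0, hk⟩⟩
  have h1 : ∑ i, (pulls a t i : ℝ) < ∑ _i : Fin k, (t : ℝ) / k :=
    Finset.sum_lt_sum_of_nonempty Finset.univ_nonempty fun i _ => h i
  have h2 : ∑ i, (pulls a t i : ℝ) = t := by exact_mod_cast sum_pulls a t
  have hk' : (k : ℝ) ≠ 0 := by positivity
  simp only [Finset.sum_const, Finset.card_univ, Fintype.card_fin, nsmul_eq_mul] at h1
  rw [h2, mul_div_cancel₀ _ hk'] at h1
  exact lt_irrefl _ h1

/-- The competitor of an arm that is pulled has been sampled about as often as that arm, since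
otherwise it would have the larger knowledge gradient. -/
lemma exists_competitor_of_pulled (hk : 2 ≤ k) {σ : Fin k → ℝ} {sm sM : ℝ}
    (hsm : 0 < sm) (hσm : ∀ i, sm ≤ σ i) (hσM : ∀ i, σ i ≤ sM)
    {a : ℕ → Fin k} {x : ℕ → ℝ} (hKG : IsKGPath σ a x) {s : ℕ} (h : 0 < pulls a s (a s)) :
    ∃ l ≠ a s, gap (postMean σ a x s) (a s) = |postMean σ a x s (a s) - postMean σ a x s l| ∧
      sm / sM * pulls a s (a s) ≤ pulls a s l + 1 := by
  have hσ : ∀ i, 0 < σ i := fun i => hsm.trans_le (hσm i)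
  obtain ⟨l, hl, h1, h2⟩ := exists_competitor hk (postMean σ a x s) (a s)
  refine ⟨l, hl, h1, ?_⟩
  have hpl := pulls_pos_of_pulled hσ hKG h l
  have h3 := zeta_le_of_value_le (zeta_pos hσ hpl) (zeta_pos hσ h) (gap_nonneg _ _) h2
    (value_le_of_pulled hσ hKG h l)
  have h4 := (le_zeta hσ hpl).trans (h3.trans (zeta_le hσ h))
  have hj : (0 : ℝ) < pulls a s (a s) := by exact_mod_cast h
  have hsM : 0 < sM := (hσ l).trans_le (hσM l)
  rw [div_le_div_iff₀ (by positivity) hj] at h4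
  rw [div_mul_eq_mul_div, div_le_iff₀ hsM]
  nlinarith [hσm l, hσM (a s), mul_le_mul_of_nonneg_right (hσm l) hj.le,
    mul_le_mul_of_nonneg_right (hσM (a s)) (by positivity : (0 : ℝ) ≤ pulls a s l + 1)]

/-- If arm `i` has few samples while the much sampled arm `j` is pulled, then `j` is close to a
tie with its competitor, and both have the same mean. -/
lemma exists_mem_tieRounds (hk : 2 ≤ k) {μ σ : Fin k → ℝ} {sm sM dM : ℝ}
    (hsm : 0 < sm) (hσm : ∀ i, sm ≤ σ i) (hσM : ∀ i, σ i ≤ sM) (hdM : ∀ i, gap μ i ≤ dM)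
    {a : ℕ → Fin k} {x : ℕ → ℝ} (hKG : IsKGPath σ a x) {t : ℕ} {r m h n₀ : ℝ} (hr : 0 ≤ r)
    (hA : NoiseBound μ a x r t) (hm1 : 1 ≤ m) (hn0 : n₀ + 1 ≤ 2 * m)
    (hh : (dM + 2 * r) * (n₀ + 1) ≤ 2 * m * h)
    (hacc : r / √m ≤ 1) (hμ : ∀ j l, μ j ≠ μ l → h + 2 * (r / √m) < |μ j - μ l|)
    {i : Fin k} (hi : (pulls a t i : ℝ) < n₀) {j : Fin k} {s : ℕ} (hst : s < t) (hsj : a s = j)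
    (hcn : 2 * m ≤ sm / sM * pulls a s j) :
    ∃ l, j ≠ l ∧ μ j = μ l ∧ s ∈ tieRounds μ a x m h t j l := by
  have hσ : ∀ i, 0 < σ i := fun i => hsm.trans_le (hσm i)
  have hsM : 0 < sM := (hσ i).trans_le (hσM i)
  have hm0 : 0 < m := by linarith
  have hc1 : sm / sM ≤ 1 := (div_le_one hsM).2 ((hσm i).trans (hσM i))
  have hc0 : 0 < sm / sM := div_pos hsm hsM
  have hn00 : 0 < n₀ := lt_of_le_of_lt (Nat.cast_nonneg _) hi
  have hnj : (0 : ℝ) < pulls a s j := by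
    by_contra! hneg
    have := mul_nonpos_of_nonneg_of_nonpos hc0.le hneg
    linarith
  have hnj' : 0 < pulls a s (a s) := by rw [hsj]; exact_mod_cast hnj
  obtain ⟨l, hl, hgap, hlj⟩ := exists_competitor_of_pulled hk hsm hσm hσM hKG hnj'
  rw [hsj] at hl hgap hlj
  have hmj : m ≤ pulls a s j := by
    have := mul_le_of_le_one_left hnj.le hc1
    linarith
  have hml : m ≤ pulls a s l := by linarith
  have hnl : 0 < pulls a s l := by
    have : (0 : ℝ) < pulls a s l := by linarith
    exact_mod_cast this
  have hni := pulls_pos_of_pulled hσ hKG hnj' i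
  have hnin : (pulls a s i : ℝ) < n₀ :=
    lt_of_le_of_lt (by exact_mod_cast pulls_mono a i hst.le) hi
  have hni' : (0 : ℝ) < pulls a s i := by exact_mod_cast hni
  have hej := hA.sampleErr_le hr hst.le hm0 hmj
  have hel := hA.sampleErr_le hr hst.le hm0 hml
  have hv := value_le_of_pulled hσ hKG hnj' i
  rw [hsj] at hv hnj'
  -- the rarely sampled arm has the larger `ζ`
  have hz : zeta σ a s j ≤ zeta σ a s i := by
    by_contra! hlt
    have h1 := (le_zeta hσ hni).trans_lt (hlt.trans_le (zeta_le hσ hnj'))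
    rw [div_lt_div_iff₀ (by positivity) hnj] at h1
    have h2 : sm * pulls a s j < sM * (pulls a s i + 1) := by
      nlinarith [mul_le_mul_of_nonneg_right (hσm i) hnj.le,
        mul_le_mul_of_nonneg_right (hσM j) (by positivity : (0 : ℝ) ≤ pulls a s i + 1)]
    have h3 : sm / sM * pulls a s j < pulls a s i + 1 := by
      rw [div_mul_eq_mul_div, div_lt_iff₀ hsM]; linarith
    linarith
  have hq := div_le_div_of_value_le (zeta_pos hσ hni) hz hv
  have hgi : gap (postMean σ a x s) i ≤ dM + 2 * r := by
    have h1 : ∀ p, |postMean σ a x s p - μ p| ≤ r := fun p => by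
      have hp := pulls_pos_of_pulled hσ hKG (by rw [hsj]; exact hnj') p
      rw [postMean_sub_eq hσ μ x hp]
      have := hA.sampleErr_le hr hst.le one_pos
        (by exact_mod_cast hp : (1 : ℝ) ≤ pulls a s p)
      simpa using this
    have h2 := (abs_sub_le_iff.1 (abs_gap_sub_gap_le hk h1 i)).1
    linarith [hdM i]
  have hgj : gap (postMean σ a x s) j ≤ h := by
    have hzi := zeta_pos hσ hni
    have hzj := zeta_pos hσ hnj'
    have h1 : gap (postMean σ a x s) j ≤
        zeta σ a s j * (gap (postMean σ a x s) i / zeta σ a s i) := by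
      rw [div_le_iff₀ hzj] at hq
      linarith
    have h2 : gap (postMean σ a x s) i / zeta σ a s i
        ≤ gap (postMean σ a x s) i / (σ i / (pulls a s i + 1)) :=
      div_le_div_of_nonneg_left (gap_nonneg _ _) (div_pos (hσ i) (by positivity))
        (le_zeta hσ hni)
    have h3 : gap (postMean σ a x s) i / (σ i / (pulls a s i + 1))
        ≤ (dM + 2 * r) * (n₀ + 1) / sm := by
      rw [div_div_eq_mul_div]
      have h0 := gap_nonneg (postMean σ a x s) i
      exact div_le_div₀ (mul_nonneg (h0.trans hgi) (by linarith))
        (mul_le_mul hgi (by linarith) (by positivity) (h0.trans hgi)) hsm (hσm i)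
    have h4 : zeta σ a s j ≤ sM / pulls a s j :=
      (zeta_le hσ hnj').trans (div_le_div_of_nonneg_right (hσM j) hnj.le)
    have h5 : zeta σ a s j * (gap (postMean σ a x s) i / zeta σ a s i)
        ≤ sM / pulls a s j * ((dM + 2 * r) * (n₀ + 1) / sm) :=
      mul_le_mul h4 (h2.trans h3) (div_nonneg (gap_nonneg _ _) hzi.le) (by positivity)
    have h6 : sM / pulls a s j * ((dM + 2 * r) * (n₀ + 1) / sm)
        ≤ sM / pulls a s j * (2 * m * h / sm) := by gcongr
    have hh0 : 0 ≤ h := by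
      have h0 := gap_nonneg (postMean σ a x s) i
      have h01 : 0 ≤ 2 * m * h := (mul_nonneg (h0.trans hgi) (by linarith)).trans hh
      exact nonneg_of_mul_nonneg_right h01 (by linarith)
    have h7 : sM / pulls a s j * (2 * m * h / sm)
        ≤ sM / pulls a s j * (sm / sM * pulls a s j * h / sm) := by gcongr
    have h8 : sM / pulls a s j * (sm / sM * pulls a s j * h / sm) = h := by
      field_simp
    linarith
  have hd : postMean σ a x s j - postMean σ a x s l
      = (sampleErr μ a x s j - sampleErr μ a x s l) + (μ j - μ l) := by
    rw [← postMean_sub_eq hσ μ x hnj', ← postMean_sub_eq hσ μ x hnl]; ring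
  have heq : μ j = μ l := by
    by_contra hne
    have h1 := hμ j l hne
    have h2 : |μ j - μ l| ≤ h + 2 * (r / √m) := by
      have e : μ j - μ l = (postMean σ a x s j - postMean σ a x s l)
        - (sampleErr μ a x s j - sampleErr μ a x s l) := by rw [hd]; ring
      rw [e]
      refine (abs_sub _ _).trans ?_
      have h3 := abs_sub (sampleErr μ a x s j) (sampleErr μ a x s l)
      rw [← hgap]
      linarith
    linarith
  refine ⟨l, hl.symm, heq, ?_⟩
  simp only [tieRounds, Finset.mem_filter]
  refine ⟨Finset.mem_range.2 hst, hsj, ⟨hmj, hml⟩, ?_, hej.trans hacc⟩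
  rw [heq, sub_self, add_zero] at hd
  rw [← hd, ← hgap]
  exact hgj

/-- If some arm has few samples, then a frequently pulled arm `j` is pulled close to a tie, and
hence close to a tie with a fixed arm of the same mean in a fraction of all rounds. -/
lemma exists_many_tieRounds (hk : 2 ≤ k) {μ σ : Fin k → ℝ} {sm sM dM : ℝ}
    (hsm : 0 < sm) (hσm : ∀ i, sm ≤ σ i) (hσM : ∀ i, σ i ≤ sM) (hdM : ∀ i, gap μ i ≤ dM)
    {a : ℕ → Fin k} {x : ℕ → ℝ} (hKG : IsKGPath σ a x) {t : ℕ} {r m h n₀ : ℝ} (hr : 0 ≤ r)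
    (hA : NoiseBound μ a x r t) (ht : 4 * (k : ℝ) ≤ t) (hm1 : 1 ≤ m)
    (hm : m = sm / sM / (4 * k) * t) (hn0 : n₀ + 1 ≤ 2 * m)
    (hh : (dM + 2 * r) * (n₀ + 1) ≤ 2 * m * h)
    (hacc : r / √m ≤ 1) (hμ : ∀ j l, μ j ≠ μ l → h + 2 * (r / √m) < |μ j - μ l|)
    {i : Fin k} (hi : (pulls a t i : ℝ) < n₀) :
    ∃ j l, j ≠ l ∧ μ j = μ l ∧ (t : ℝ) / (4 * k ^ 2) ≤ (tieRounds μ a x m h t j l).card := by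
  have hσ : ∀ i, 0 < σ i := fun i => hsm.trans_le (hσm i)
  have hk0 : (0 : ℝ) < k := by exact_mod_cast (by omega : 0 < k)
  have hsM : 0 < sM := (hσ i).trans_le (hσM i)
  have ht0 : (0 : ℝ) < t := by nlinarith
  obtain ⟨j, hj⟩ := exists_pulls_ge (by omega : 0 < k) a t
  set M : ℕ := ⌈(t : ℝ) / (2 * k)⌉₊ with hM
  have hMle : (t : ℝ) / (2 * k) ≤ M := Nat.le_ceil _
  have hMlt : (M : ℝ) < (t : ℝ) / (2 * k) + 1 := Nat.ceil_lt_add_one (by positivity)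
  have h2m : sm / sM * ((t : ℝ) / (2 * k)) = 2 * m := by rw [hm]; field_simp; ring
  have hc0 : 0 < sm / sM := div_pos hsm hsM
  have hkey : ∀ s < t, a s = j → M ≤ pulls a s j →
      ∃ l, j ≠ l ∧ μ j = μ l ∧ s ∈ tieRounds μ a x m h t j l := by
    intro s hst hsj hMs
    have hMs' : (t : ℝ) / (2 * k) ≤ pulls a s j := hMle.trans (by exact_mod_cast hMs)
    refine exists_mem_tieRounds hk hsm hσm hσM hdM hKG hr hA hm1 hn0 hh hacc hμ hi hst hsj ?_
    rw [← h2m]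
    exact mul_le_mul_of_nonneg_left hMs' hc0.le
  by_contra! hcon
  have hcard := pulls_le_card_add a j M t
  set S := (Finset.range t).filter fun s => a s = j ∧ M ≤ pulls a s j with hS
  classical
  set Lj := Finset.univ.filter fun l => j ≠ l ∧ μ j = μ l with hLj
  have hsub : S ⊆ Lj.biUnion fun l => tieRounds μ a x m h t j l := by
    intro s hs
    rw [hS, Finset.mem_filter, Finset.mem_range] at hs
    obtain ⟨l, h1, h2, h3⟩ := hkey s hs.1 hs.2.1 hs.2.2
    exact Finset.mem_biUnion.2 ⟨l, Finset.mem_filter.2 ⟨Finset.mem_univ _, h1, h2⟩, h3⟩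
  have h1 : (S.card : ℝ) ≤ ∑ l ∈ Lj, ((tieRounds μ a x m h t j l).card : ℝ) := by
    exact_mod_cast (Finset.card_le_card hsub).trans Finset.card_biUnion_le
  have h2 : (t : ℝ) / (4 * k) ≤ S.card := by
    have h3 : (pulls a t j : ℝ) ≤ S.card + M := by exact_mod_cast hcard
    have h4 : (1 : ℝ) ≤ t / (4 * k) := by rw [le_div_iff₀ (by positivity)]; linarith
    have h5 : (t : ℝ) / k = t / (4 * k) + t / (4 * k) + t / (2 * k) := by field_simp; norm_num
    linarith
  have hne : Lj.Nonempty := by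
    rw [Finset.nonempty_iff_ne_empty]
    intro h0
    rw [h0, Finset.sum_empty] at h1
    have : (0 : ℝ) < t / (4 * k) := by positivity
    linarith
  have h3 : ∑ l ∈ Lj, ((tieRounds μ a x m h t j l).card : ℝ)
      < ∑ _l ∈ Lj, (t : ℝ) / (4 * k ^ 2) :=
    Finset.sum_lt_sum_of_nonempty hne fun l hl => by
      rw [hLj, Finset.mem_filter] at hl
      exact hcon j l hl.2.1 hl.2.2
  rw [Finset.sum_const, nsmul_eq_mul] at h3
  have h4 : (Lj.card : ℝ) ≤ k := by
    have := Finset.card_le_univ Lj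
    rw [Fintype.card_fin] at this
    exact_mod_cast this
  have h5 : (Lj.card : ℝ) * ((t : ℝ) / (4 * k ^ 2)) ≤ k * ((t : ℝ) / (4 * k ^ 2)) := by gcongr
  have h6 : (k : ℝ) * ((t : ℝ) / (4 * k ^ 2)) = t / (4 * k) := by field_simp
  linarith

lemma gap_bounds (hk : 2 ≤ k) {μ σ : Fin k → ℝ} (hσ : ∀ i, 0 < σ i) {dm dM e : ℝ}
    (hdm : ∀ i, dm ≤ gap μ i) (hdM : ∀ i, gap μ i ≤ dM) (he : 4 * e ≤ dm)
    {a : ℕ → Fin k} {x : ℕ → ℝ} {s : ℕ}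
    (hacc : ∀ i, 0 < pulls a s i ∧ |sampleErr μ a x s i| ≤ e) (i : Fin k) :
    dm / 2 ≤ gap (postMean σ a x s) i ∧ gap (postMean σ a x s) i ≤ 2 * dM ∧
      |gap (postMean σ a x s) i - gap μ i| ≤ 2 * e := by
  have h1 := abs_gap_sub_gap_le hk (y := postMean σ a x s) (z := μ) (e := e) (fun p => by
    rw [postMean_sub_eq hσ μ x (hacc p).1]; exact (hacc p).2) i
  have h2 := abs_sub_le_iff.1 h1
  have := hdm i
  have := hdM i
  exact ⟨by linarith, by linarith, h1⟩

/-- Once all sample means are accurate, all knowledge gradients decay at comparable exponential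
rates, so that all arms are pulled linearly often. -/
lemma linear_le_pulls (hk : 2 ≤ k) {μ σ : Fin k → ℝ} {sm sM dm dM e : ℝ}
    (hsm : 0 < sm) (hσm : ∀ i, sm ≤ σ i) (hσM : ∀ i, σ i ≤ sM)
    (hdm0 : 0 < dm) (hdm : ∀ i, dm ≤ gap μ i) (hdM : ∀ i, gap μ i ≤ dM) (he : 4 * e ≤ dm)
    {a : ℕ → Fin k} {x : ℕ → ℝ} (hKG : IsKGPath σ a x) {u t : ℕ} (hut : 2 * u ≤ t) (ht : 0 < t)
    (hacc : ∀ s, u ≤ s → s < t → ∀ i, 0 < pulls a s i ∧ |sampleErr μ a x s i| ≤ e) (i : Fin k) :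
    sm / sM * (dm / (4 * dM)) * ((t : ℝ) / (2 * k) - 1) ≤ pulls a t i + 1 := by
  have hσ : ∀ i, 0 < σ i := fun i => hsm.trans_le (hσm i)
  have hk0 : (0 : ℝ) < k := by exact_mod_cast (by omega : 0 < k)
  have hsM : 0 < sM := (hσ i).trans_le (hσM i)
  have hdM0 : 0 < dM := hdm0.trans_le ((hdm i).trans (hdM i))
  have hdmM : dm ≤ dM := (hdm i).trans (hdM i)
  have hut' : 2 * (u : ℝ) ≤ t := by exact_mod_cast hut
  have ht' : (0 : ℝ) < t := by exact_mod_cast ht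
  -- some arm takes at least its share of the last `t / 2` rounds
  obtain ⟨j, hj⟩ : ∃ j, (t : ℝ) / (2 * k) ≤ pulls a t j - pulls a u j := by
    by_contra! h
    have : Nonempty (Fin k) := ⟨i⟩
    have h1 : ∑ p, ((pulls a t p : ℝ) - pulls a u p) < ∑ _p : Fin k, (t : ℝ) / (2 * k) :=
      Finset.sum_lt_sum_of_nonempty Finset.univ_nonempty fun i _ => h i
    have h2 : ∑ i, (pulls a t i : ℝ) = t := by exact_mod_cast sum_pulls a t
    have h3 : ∑ i, (pulls a u i : ℝ) = u := by exact_mod_cast sum_pulls a u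
    simp only [Finset.sum_const, Finset.card_univ, Fintype.card_fin, nsmul_eq_mul,
      Finset.sum_sub_distrib] at h1
    have h4 : (k : ℝ) * (t / (2 * k)) = t / 2 := by field_simp
    rw [h2, h3, h4] at h1
    linarith
  have hlt : pulls a u j < pulls a t j := by
    have : (0 : ℝ) < t / (2 * k) := by positivity
    have h1 : (pulls a u j : ℝ) < pulls a t j := by linarith
    exact_mod_cast h1
  obtain ⟨s, hus, hst, hsj, hsn⟩ := exists_last_pull a j (by omega : u ≤ t) hlt
  have hacc' := hacc s hus hst
  have hpj : 0 < pulls a s j := (hacc' j).1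
  have hpi : 0 < pulls a s i := (hacc' i).1
  have hnj : (0 : ℝ) < pulls a s j := by exact_mod_cast hpj
  have hni : (0 : ℝ) < pulls a s i := by exact_mod_cast hpi
  have hv := value_le_of_pulled hσ hKG (by rw [hsj]; exact hpj) i
  rw [hsj] at hv
  obtain ⟨hgj1, -, -⟩ := gap_bounds hk hσ hdm hdM he hacc' j
  obtain ⟨-, hgi2, -⟩ := gap_bounds hk hσ hdm hdM he hacc' i
  have hmono : (pulls a s i : ℝ) ≤ pulls a t i := by exact_mod_cast pulls_mono a i hst.le
  have hsn' : (pulls a s j : ℝ) + 1 = pulls a t j := by exact_mod_cast hsn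
  have hu0 : (0 : ℝ) ≤ pulls a u j := by positivity
  have hnjt : (t : ℝ) / (2 * k) - 1 ≤ pulls a s j := by linarith
  have hc : dm / (4 * dM) ≤ 1 := by rw [div_le_one (by positivity)]; linarith
  have hc0 : 0 < dm / (4 * dM) := by positivity
  have hz0 := zeta_pos hσ hpi
  have hzj0 := zeta_pos hσ hpj
  -- in both cases `ζ_j` is at least a constant multiple of `ζ_i`
  have hz : dm / (4 * dM) * zeta σ a s i ≤ zeta σ a s j := by
    rcases le_total (zeta σ a s j) (zeta σ a s i) with h | h
    · have h1 := div_le_div_of_value_le hz0 h hv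
      rw [div_le_div_iff₀ hzj0 hz0] at h1
      have h2 : dm / 2 * zeta σ a s i ≤ 2 * dM * zeta σ a s j :=
        (mul_le_mul_of_nonneg_right hgj1 hz0.le).trans
          (h1.trans (mul_le_mul_of_nonneg_right hgi2 hzj0.le))
      rw [div_mul_eq_mul_div, div_le_iff₀ (by positivity)]
      linarith
    · nlinarith
  have h1 : dm / (4 * dM) * (sm / (pulls a s i + 1)) ≤ sM / pulls a s j := by
    calc _ ≤ dm / (4 * dM) * (σ i / (pulls a s i + 1)) := by gcongr; exact hσm i
      _ ≤ dm / (4 * dM) * zeta σ a s i := by gcongr; exact le_zeta hσ hpi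
      _ ≤ σ j / pulls a s j := hz.trans (zeta_le hσ hpj)
      _ ≤ sM / pulls a s j := by gcongr; exact hσM j
  have h2 : sm / sM * (dm / (4 * dM)) * pulls a s j ≤ pulls a s i + 1 := by
    rw [← mul_div_assoc, div_le_div_iff₀ (by positivity) hnj] at h1
    rw [div_mul_eq_mul_div, div_mul_eq_mul_div, div_le_iff₀ hsM]
    linarith
  have h3 : sm / sM * (dm / (4 * dM)) * ((t : ℝ) / (2 * k) - 1)
      ≤ sm / sM * (dm / (4 * dM)) * pulls a s j := by gcongr
  linarith

/-- Comparison of the exponents `n_i d_i / σ_i` of the knowledge gradients, at the last pull of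
arm `j`. -/
lemma pulls_balance (hk : 2 ≤ k) {μ σ : Fin k → ℝ} {sm sM dm dM e y : ℝ}
    (hsm : 0 < sm) (hσm : ∀ i, sm ≤ σ i) (hσM : ∀ i, σ i ≤ sM)
    (hdm0 : 0 < dm) (hdm : ∀ i, dm ≤ gap μ i) (hdM : ∀ i, gap μ i ≤ dM) (he0 : 0 ≤ e)
    (he : 4 * e ≤ dm)
    {a : ℕ → Fin k} {x : ℕ → ℝ} (hKG : IsKGPath σ a x) {v t : ℕ} (hvt : v ≤ t) (hy0 : 0 < y)
    (hy : ∀ i, y ≤ pulls a v i)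
    (hacc : ∀ s, v ≤ s → s < t → ∀ i, |sampleErr μ a x s i| ≤ e)
    (hexp : sM / sm * ((t + 1) / y) < Real.exp (dm / 2 * (y / sM)))
    (i j : Fin k) (hlt : pulls a v j < pulls a t j) :
    pulls a t j * (gap μ j / σ j) ≤
      pulls a t i * (gap μ i / σ i) + (2 * (dM / sm) + 1 + 6 * (e / sm) * t) := by
  have hσ : ∀ i, 0 < σ i := fun i => hsm.trans_le (hσm i)
  have hsM : 0 < sM := (hσ i).trans_le (hσM i)
  have hdM0 : 0 < dM := hdm0.trans_le ((hdm i).trans (hdM i))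
  obtain ⟨s, hvs, hst, hsj, hsn⟩ := exists_last_pull a j hvt hlt
  have hys : ∀ i, y ≤ pulls a s i := fun i =>
    (hy i).trans (by exact_mod_cast pulls_mono a i hvs)
  have hpos : ∀ i, 0 < pulls a s i := fun i => by
    have : (0 : ℝ) < pulls a s i := hy0.trans_le (hys i)
    exact_mod_cast this
  have hacc' : ∀ i, 0 < pulls a s i ∧ |sampleErr μ a x s i| ≤ e :=
    fun i => ⟨hpos i, hacc s hvs hst i⟩
  have hpj := hpos j
  have hpi := hpos i
  have hnj : (0 : ℝ) < pulls a s j := by exact_mod_cast hpj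
  have hni : (0 : ℝ) < pulls a s i := by exact_mod_cast hpi
  have hv := value_le_of_pulled hσ hKG (by rw [hsj]; exact hpj) i
  rw [hsj] at hv
  obtain ⟨-, -, hgj⟩ := gap_bounds hk hσ hdm hdM he hacc' j
  obtain ⟨hgi1, -, hgi⟩ := gap_bounds hk hσ hdm hdM he hacc' i
  have hmono : (pulls a s i : ℝ) ≤ pulls a t i := by exact_mod_cast pulls_mono a i hst.le
  have hsn' : (pulls a s j : ℝ) + 1 = pulls a t j := by exact_mod_cast hsn
  have hst' : (s : ℝ) + 1 ≤ t := by exact_mod_cast hst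
  have hjs : (pulls a s j : ℝ) ≤ s := by exact_mod_cast pulls_le a s j
  have his : (pulls a s i : ℝ) ≤ s := by exact_mod_cast pulls_le a s i
  have hz0 := zeta_pos hσ hpi
  have hzj0 := zeta_pos hσ hpj
  have hC : zeta σ a s j ≤ sM / sm * ((t + 1) / y) * zeta σ a s i := by
    have h1 : zeta σ a s j ≤ sM / y :=
      (zeta_le hσ hpj).trans (div_le_div₀ hsM.le (hσM j) hy0 (hys j))
    have h2 : sm / (t + 1) ≤ zeta σ a s i :=
      le_trans (div_le_div₀ (hσ i).le (hσm i) (by positivity) (by linarith)) (le_zeta hσ hpi)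
    calc zeta σ a s j ≤ sM / y := h1
      _ = sM / sm * ((t + 1) / y) * (sm / (t + 1)) := by field_simp
      _ ≤ _ := by gcongr
  have hx : dm / 2 * (y / sM) ≤ gap (postMean σ a x s) i / zeta σ a s i := by
    rw [le_div_iff₀ hz0]
    have h1 : zeta σ a s i ≤ sM / y :=
      (zeta_le hσ hpi).trans (div_le_div₀ hsM.le (hσM i) hy0 (hys i))
    calc dm / 2 * (y / sM) * zeta σ a s i ≤ dm / 2 * (y / sM) * (sM / y) := by gcongr
      _ = dm / 2 := by field_simp
      _ ≤ _ := hgi1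
  have hq := div_le_div_add_one_of_value_le hz0 hC
    (hexp.trans_le (Real.exp_le_exp.2 hx)) hv
  have h1 : pulls a s j * (gap (postMean σ a x s) j / σ j) ≤
      gap (postMean σ a x s) j / zeta σ a s j := by
    have h3 := div_le_div_of_nonneg_left (gap_nonneg (postMean σ a x s) j) hzj0 (zeta_le hσ hpj)
    rw [div_div_eq_mul_div] at h3
    rwa [← mul_div_assoc, mul_comm]
  have h2 : gap (postMean σ a x s) i / zeta σ a s i ≤
      (pulls a s i + 1) * (gap (postMean σ a x s) i / σ i) := by
    have h3 := div_le_div_of_nonneg_left (gap_nonneg (postMean σ a x s) i)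
      (div_pos (hσ i) (by positivity)) (le_zeta hσ hpi)
    rw [div_div_eq_mul_div] at h3
    rwa [← mul_div_assoc, mul_comm _ (gap _ _)]
  have hratio : ∀ (w b : ℝ) (p : Fin k), 0 ≤ b → w ≤ b → w / σ p ≤ b / sm := fun w b p hb hw =>
    (div_le_div_of_nonneg_right hw (hσ p).le).trans (div_le_div_of_nonneg_left hb hsm (hσm p))
  have h3 : gap μ j / σ j ≤ gap (postMean σ a x s) j / σ j + 2 * (e / sm) := by
    have := hratio _ (2 * e) j (by linarith) ((neg_sub _ _).ge.trans
      ((neg_le_abs _).trans hgj))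
    rw [sub_div, mul_div_assoc] at this
    linarith
  have h4 : gap (postMean σ a x s) i / σ i ≤ gap μ i / σ i + 2 * (e / sm) := by
    have := hratio _ (2 * e) i (by linarith) ((le_abs_self _).trans hgi)
    rw [sub_div, mul_div_assoc] at this
    linarith
  have h5 := hratio _ dM j hdM0.le (hdM j)
  have h6 := hratio _ dM i hdM0.le (hdM i)
  have h7 : 0 ≤ gap μ i / σ i := div_nonneg (gap_nonneg _ _) (hσ i).le
  have h8 : 0 ≤ e / sm := div_nonneg he0 hsm.le
  rw [← hsn']
  have h9 : pulls a s j * (gap μ j / σ j) ≤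
      pulls a s j * (gap (postMean σ a x s) j / σ j) + t * (2 * (e / sm)) := by
    have := mul_le_mul_of_nonneg_left h3 hnj.le
    have h10 : pulls a s j * (2 * (e / sm)) ≤ t * (2 * (e / sm)) :=
      mul_le_mul_of_nonneg_right (by linarith) (by linarith)
    linarith
  have h11 : (pulls a s i + 1) * (gap (postMean σ a x s) i / σ i) ≤
      pulls a s i * (gap μ i / σ i) + gap μ i / σ i + t * (2 * (e / sm)) := by
    have := mul_le_mul_of_nonneg_left h4 (by positivity : (0 : ℝ) ≤ pulls a s i + 1)
    have h10 : ((pulls a s i : ℝ) + 1) * (2 * (e / sm)) ≤ t * (2 * (e / sm)) :=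
      mul_le_mul_of_nonneg_right (by linarith) (by linarith)
    linarith
  have h12 := mul_le_mul_of_nonneg_right hmono h7
  have h13 : 0 ≤ e / sm * t := mul_nonneg h8 (by positivity)
  linarith

/-- The shares `n_i / t` in equilibrium. -/
lemma abs_pulls_sub_le {c : Fin k → ℝ} (hc : ∀ i, 0 < c i) {n : Fin k → ℝ} {t E : ℝ}
    (hn : ∑ i, n i = t)
    (h : ∀ i j, n j * (c j)⁻¹ ≤ n i * (c i)⁻¹ + E) (i : Fin k) :
    |n i - c i / (∑ l, c l) * t| ≤ c i * E := by
  have hA : 0 < ∑ l, c l := Finset.sum_pos (fun l _ => hc l) ⟨i, Finset.mem_univ _⟩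
  have h1 : t ≤ (∑ l, c l) * (n i * (c i)⁻¹ + E) := by
    rw [← hn, Finset.sum_mul]
    refine Finset.sum_le_sum fun j _ => ?_
    have := mul_le_mul_of_nonneg_left (h i j) (hc j).le
    rwa [mul_left_comm, mul_inv_cancel₀ (hc j).ne', mul_one] at this
  have h2 : (∑ l, c l) * (n i * (c i)⁻¹ - E) ≤ t := by
    rw [← hn, Finset.sum_mul]
    refine Finset.sum_le_sum fun j _ => ?_
    have := mul_le_mul_of_nonneg_left (sub_le_iff_le_add.2 (h j i)) (hc j).le
    rwa [mul_left_comm, mul_inv_cancel₀ (hc j).ne', mul_one] at this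
  have hci := hc i
  have e1 : (n i * (c i)⁻¹) = n i / c i := by rw [div_eq_mul_inv]
  rw [e1] at h1 h2
  have h3 : n i - c i / (∑ l, c l) * t = c i * (n i / c i - t / ∑ l, c l) := by
    field_simp
  rw [h3, abs_mul, abs_of_pos hci]
  refine mul_le_mul_of_nonneg_left (abs_sub_le_iff.2 ⟨?_, ?_⟩) hci.le
  · have : n i / c i - E ≤ t / ∑ l, c l := by rw [le_div_iff₀ hA]; linarith
    linarith
  · have : t / ∑ l, c l ≤ n i / c i + E := by rw [div_le_iff₀ hA]; linarith
    linarith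

end KG

/-! ### Asymptotics of the numbers of pulls on typical paths -/

namespace KG

variable {k : ℕ}

/-- For no two arms of the same mean a positive fraction of the first `t` rounds is spent close to
a tie, at the scale `t ^ (-13/16)`. -/
def FewTies (μ : Fin k → ℝ) (a : ℕ → Fin k) (x : ℕ → ℝ) (c : ℝ) (t : ℕ) : Prop :=
  ∀ j l, j ≠ l → μ j = μ l →
    ((tieRounds μ a x (c * t) ((t : ℝ) ^ (-(13 / 16) : ℝ)) t j l).card : ℝ) < t / (4 * k ^ 2)

/-- The noise of the first `t` rounds is typical. -/
def Typical (μ : Fin k → ℝ) (a : ℕ → Fin k) (x : ℕ → ℝ) (c : ℝ) (t : ℕ) : Prop :=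
  NoiseBound μ a x ((t : ℝ) ^ (1 / 32 : ℝ)) t ∧ FewTies μ a x c t

lemma tendsto_natCast_rpow {p : ℝ} (hp : 0 < p) :
    Tendsto (fun t : ℕ => (t : ℝ) ^ p) atTop atTop :=
  (tendsto_rpow_atTop hp).comp tendsto_natCast_atTop_atTop

lemma tendsto_natCast_rpow_neg {p : ℝ} (hp : 0 < p) :
    Tendsto (fun t : ℕ => (t : ℝ) ^ (-p)) atTop (𝓝 0) :=
  (tendsto_rpow_neg_atTop hp).comp tendsto_natCast_atTop_atTop

lemma rpow_div_sqrt {c t : ℝ} (hc : 0 < c) (ht : 0 < t) :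
    t ^ (1 / 32 : ℝ) / √(c * t) = t ^ (-(15 / 32) : ℝ) / √c := by
  rw [Real.sqrt_mul hc.le, Real.sqrt_eq_rpow t]
  have : t ^ (1 / 32 : ℝ) = t ^ (-(15 / 32) : ℝ) * t ^ (1 / 2 : ℝ) := by
    rw [← Real.rpow_add ht]; norm_num
  rw [this, mul_div_mul_right _ _ (Real.rpow_pos_of_pos ht _).ne']

/-- No arm is starved: `t ^ (1/8)` samples are enough for accurate means, as the errors on a typical
path are at most `t ^ (1/32)` divided by the root of the sample size. -/
lemma eventually_rpow_le_pulls (hk : 2 ≤ k) {μ σ : Fin k → ℝ} {sm sM dM : ℝ}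
    (hsm : 0 < sm) (hσm : ∀ i, sm ≤ σ i) (hσM : ∀ i, σ i ≤ sM) (hdM : ∀ i, gap μ i ≤ dM) :
    ∀ᶠ t : ℕ in atTop, ∀ (a : ℕ → Fin k) (x : ℕ → ℝ), IsKGPath σ a x →
      Typical μ a x (sm / sM / (4 * k)) t → ∀ i, (t : ℝ) ^ (1 / 8 : ℝ) ≤ pulls a t i := by
  have hk0 : (0 : ℝ) < k := by exact_mod_cast (by omega : 0 < k)
  have i0 : Fin k := ⟨0, by omega⟩
  have hsM : 0 < sM := hsm.trans_le ((hσm i0).trans (hσM i0))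
  have hdM0 : 0 ≤ dM := (gap_nonneg μ i0).trans (hdM i0)
  set c : ℝ := sm / sM / (4 * k) with hc
  have hc0 : 0 < c := by positivity
  have hT : Tendsto (fun t : ℕ => (t : ℝ)) atTop atTop := tendsto_natCast_atTop_atTop
  have hlim : Tendsto (fun t : ℕ => (t : ℝ) ^ (-(13 / 16) : ℝ)
      + 2 * ((t : ℝ) ^ (-(15 / 32) : ℝ) / √c)) atTop (𝓝 0) := by
    have h1 := (tendsto_natCast_rpow_neg (p := 13 / 16) (by norm_num)).add
      (((tendsto_natCast_rpow_neg (p := 15 / 32) (by norm_num)).div_const √c).const_mul 2)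
    simpa using h1
  have hlim2 : Tendsto (fun t : ℕ => (t : ℝ) ^ (-(15 / 32) : ℝ) / √c) atTop (𝓝 0) := by
    simpa using (tendsto_natCast_rpow_neg (p := 15 / 32) (by norm_num)).div_const √c
  have hμ : ∀ᶠ t : ℕ in atTop, ∀ j l, μ j ≠ μ l → (t : ℝ) ^ (-(13 / 16) : ℝ)
      + 2 * ((t : ℝ) ^ (-(15 / 32) : ℝ) / √c) < |μ j - μ l| := by
    refine eventually_all.2 fun j => eventually_all.2 fun l => ?_
    by_cases hjl : μ j = μ l
    · exact Eventually.of_forall fun t h => absurd hjl h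
    · filter_upwards [hlim.eventually_lt_const (abs_pos.2 (sub_ne_zero.2 hjl))] with t ht _
      exact ht
  filter_upwards [hT.eventually_ge_atTop (4 * (k : ℝ)), hT.eventually_ge_atTop (1 / c),
    hT.eventually_ge_atTop 1, hμ, hlim2.eventually_lt_const one_pos,
    (tendsto_natCast_rpow (p := 1 / 32) (by norm_num)).eventually_ge_atTop ((dM + 2) / c),
    (tendsto_natCast_rpow (p := 7 / 8) (by norm_num)).eventually_ge_atTop (1 / c)]
    with t h4k h1c h1 hμt hacc hdc h78
  intro a x hKG hgood i
  by_contra! hi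
  have ht0 : (0 : ℝ) < t := by linarith
  set r : ℝ := (t : ℝ) ^ (1 / 32 : ℝ) with hr
  set n₀ : ℝ := (t : ℝ) ^ (1 / 8 : ℝ) with hn0
  have hr1 : 1 ≤ r := Real.one_le_rpow h1 (by norm_num)
  have hn1 : 1 ≤ n₀ := Real.one_le_rpow h1 (by norm_num)
  rw [div_le_iff₀ hc0] at h1c hdc h78
  have e1 : r / √(c * t) = (t : ℝ) ^ (-(15 / 32) : ℝ) / √c := rpow_div_sqrt hc0 ht0
  have e2 : (t : ℝ) = n₀ * (t : ℝ) ^ (7 / 8 : ℝ) := by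
    rw [hn0, ← Real.rpow_add ht0]; norm_num
  have e3 : (t : ℝ) * (t : ℝ) ^ (-(13 / 16) : ℝ) = r * r * n₀ := by
    rw [hr, hn0, ← Real.rpow_add ht0, ← Real.rpow_add ht0]
    nth_rewrite 1 [← Real.rpow_one (t : ℝ)]
    rw [← Real.rpow_add ht0]; norm_num
  obtain ⟨j, l, hjl, hμjl, hcard⟩ := exists_many_tieRounds hk hsm hσm hσM hdM hKG
    (m := c * t) (h := (t : ℝ) ^ (-(13 / 16) : ℝ)) (by linarith) hgood.1 h4k
    (by linarith) (by rw [hc])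
    (n₀ := n₀)
    (by
      have h2 : n₀ * 1 ≤ n₀ * ((t : ℝ) ^ (7 / 8 : ℝ) * c) :=
        mul_le_mul_of_nonneg_left h78 (by linarith)
      have h3 : n₀ * ((t : ℝ) ^ (7 / 8 : ℝ) * c) = c * t := by
        nth_rewrite 2 [e2]; ring
      linarith)
    (by
      have e4 : 2 * (c * t) * (t : ℝ) ^ (-(13 / 16) : ℝ) = 2 * (r * c) * (r * n₀) := by
        rw [mul_assoc 2, mul_assoc c, e3]; ring
      rw [e4]
      have h2 : dM + 2 * r ≤ (dM + 2) * r := by nlinarith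
      calc (dM + 2 * r) * (n₀ + 1) ≤ ((dM + 2) * r) * (2 * n₀) :=
            mul_le_mul h2 (by linarith) (by linarith) (by positivity)
        _ = 2 * (dM + 2) * (r * n₀) := by ring
        _ ≤ 2 * (r * c) * (r * n₀) :=
            mul_le_mul_of_nonneg_right (by linarith) (by positivity))
    (by rw [e1]; exact hacc.le)
    (by rw [e1]; exact hμt) hi
  exact absurd (hgood.2 j l hjl hμjl) (not_lt.2 hcard)

lemma div_le_natDiv {M t : ℕ} (hM : 0 < M) (ht : 2 * M ≤ t) :
    (t : ℝ) / (2 * M) ≤ (t / M : ℕ) := by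
  have h1 : t < M * (t / M + 1) := Nat.lt_mul_div_succ t hM
  have h2 : (t : ℝ) < M * ((t / M : ℕ) + 1) := by exact_mod_cast h1
  have h3 : 2 * (M : ℝ) ≤ t := by exact_mod_cast ht
  have h4 : (0 : ℝ) < M := by exact_mod_cast hM
  rw [div_le_iff₀ (by positivity)]
  nlinarith

/-- On typical paths all arms are pulled linearly often. Typicality at time `t / 2` keeps the sample
means accurate in all rounds from `t / 2` on. -/
lemma eventually_linear_le_pulls (hk : 2 ≤ k) {μ σ : Fin k → ℝ} {sm sM dm dM : ℝ}
    (hsm : 0 < sm) (hσm : ∀ i, sm ≤ σ i) (hσM : ∀ i, σ i ≤ sM)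
    (hdm0 : 0 < dm) (hdm : ∀ i, dm ≤ gap μ i) (hdM : ∀ i, gap μ i ≤ dM) :
    ∃ c₁ : ℝ, 0 < c₁ ∧
    ∀ᶠ t : ℕ in atTop, ∀ (a : ℕ → Fin k) (x : ℕ → ℝ), IsKGPath σ a x →
      Typical μ a x (sm / sM / (4 * k)) (t / 2) → NoiseBound μ a x ((t : ℝ) ^ (1 / 32 : ℝ)) t →
      ∀ i, c₁ * t ≤ pulls a t i := by
  have hk0 : (0 : ℝ) < k := by exact_mod_cast (by omega : 0 < k)
  have i0 : Fin k := ⟨0, by omega⟩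
  have hsM : 0 < sM := hsm.trans_le ((hσm i0).trans (hσM i0))
  have hdM0 : 0 < dM := hdm0.trans_le ((hdm i0).trans (hdM i0))
  set c₀ : ℝ := sm / sM * (dm / (4 * dM)) with hc₀
  have hc₀0 : 0 < c₀ := by positivity
  have hT : Tendsto (fun t : ℕ => (t : ℝ)) atTop atTop := tendsto_natCast_atTop_atTop
  refine ⟨c₀ / (4 * k), by positivity, ?_⟩
  have hhalf : Tendsto (fun t : ℕ => t / 2) atTop atTop := Nat.tendsto_div_const_atTop two_ne_zero
  have hlim : Tendsto (fun t : ℕ => (4 : ℝ) ^ (1 / 16 : ℝ) * (t : ℝ) ^ (-(1 / 32) : ℝ))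
      atTop (𝓝 0) := by
    simpa using (tendsto_natCast_rpow_neg (p := 1 / 32) (by norm_num)).const_mul
      ((4 : ℝ) ^ (1 / 16 : ℝ))
  filter_upwards [hhalf.eventually (eventually_rpow_le_pulls hk hsm hσm hσM hdM),
    eventually_ge_atTop 4, hT.eventually_ge_atTop ((c₀ + 1) * (4 * k) / c₀),
    hlim.eventually_lt_const (by positivity : 0 < dm / 4)] with t hu ht4 htc hlimt
  intro a x hKG hgood hA i
  have ht0 : (0 : ℝ) < t := by exact_mod_cast (by omega : 0 < t)
  have hu4 : (t : ℝ) / 4 ≤ (t / 2 : ℕ) := by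
    have := div_le_natDiv (M := 2) two_pos ht4
    norm_num at this ⊢
    exact this
  have hpull : ∀ s, t / 2 ≤ s → ∀ i, ((t : ℝ) / 4) ^ (1 / 8 : ℝ) ≤ pulls a s i := fun s hs i =>
    (Real.rpow_le_rpow (by positivity) hu4 (by norm_num)).trans
      ((hu a x hKG hgood i).trans (by exact_mod_cast pulls_mono a i hs))
  have hq0 : 0 < ((t : ℝ) / 4) ^ (1 / 8 : ℝ) := by positivity
  have hacc : ∀ s, t / 2 ≤ s → s < t → ∀ i, 0 < pulls a s i ∧
      |sampleErr μ a x s i| ≤ (4 : ℝ) ^ (1 / 16 : ℝ) * (t : ℝ) ^ (-(1 / 32) : ℝ) := by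
    intro s hs hst i
    refine ⟨?_, ?_⟩
    · have := hq0.trans_le (hpull s hs i)
      exact_mod_cast this
    · refine (hA.sampleErr_le (by positivity) hst.le hq0 (hpull s hs i)).trans (le_of_eq ?_)
      rw [Real.sqrt_eq_rpow, ← Real.rpow_mul (by positivity),
        Real.div_rpow ht0.le (by norm_num), div_div_eq_mul_div, mul_comm, mul_div_assoc,
        ← Real.rpow_sub ht0]
      norm_num
  have h := linear_le_pulls hk hsm hσm hσM hdm0 hdm hdM (by linarith) hKG (by omega) (by omega)
    hacc i
  rw [← hc₀] at h
  rw [div_le_iff₀ hc₀0] at htc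
  have h1 : c₀ / (4 * k) * t = c₀ * (t / (2 * k)) - t * c₀ / (4 * k) := by field_simp; ring
  have h2 : c₀ + 1 ≤ t * c₀ / (4 * k) := by rw [le_div_iff₀ (by positivity)]; linarith
  rw [h1]
  linarith

/-- Here `M` is so large that every arm is pulled between the times `t / M` and `t`, while at time
`t / M` it already has linearly many samples. -/
lemma eventually_pulls_balance (hk : 2 ≤ k) {μ σ : Fin k → ℝ} {sm sM dm dM : ℝ}
    (hsm : 0 < sm) (hσm : ∀ i, sm ≤ σ i) (hσM : ∀ i, σ i ≤ sM)
    (hdm0 : 0 < dm) (hdm : ∀ i, dm ≤ gap μ i) (hdM : ∀ i, gap μ i ≤ dM) :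
    ∃ (C : ℝ) (M : ℕ), 0 < M ∧
    ∀ᶠ t : ℕ in atTop, ∀ (a : ℕ → Fin k) (x : ℕ → ℝ), IsKGPath σ a x →
      Typical μ a x (sm / sM / (4 * k)) (t / 2) → NoiseBound μ a x ((t : ℝ) ^ (1 / 32 : ℝ)) t →
      Typical μ a x (sm / sM / (4 * k)) (t / M / 2) →
      NoiseBound μ a x (((t / M : ℕ) : ℝ) ^ (1 / 32 : ℝ)) (t / M) →
      ∀ i j, pulls a t j * (gap μ j / σ j) ≤
        pulls a t i * (gap μ i / σ i) + C * (t : ℝ) ^ (17 / 32 : ℝ) := by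
  obtain ⟨c₁, hc₁, hlin⟩ := eventually_linear_le_pulls hk hsm hσm hσM hdm0 hdm hdM
  have i0 : Fin k := ⟨0, by omega⟩
  have hsM : 0 < sM := hsm.trans_le ((hσm i0).trans (hσM i0))
  have hdM0 : 0 < dM := hdm0.trans_le ((hdm i0).trans (hdM i0))
  obtain ⟨M, hM⟩ := exists_nat_gt (1 / c₁)
  have hM0' : (0 : ℝ) < M := lt_trans (by positivity) hM
  have hM0 : 0 < M := by exact_mod_cast hM0'
  rw [div_lt_iff₀ hc₁] at hM
  set c₂ : ℝ := c₁ / (2 * M) with hc₂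
  have hc₂0 : 0 < c₂ := by positivity
  have hT : Tendsto (fun t : ℕ => (t : ℝ)) atTop atTop := tendsto_natCast_atTop_atTop
  have hdiv : Tendsto (fun t : ℕ => t / M) atTop atTop :=
    Nat.tendsto_div_const_atTop hM0.ne'
  have hlim : Tendsto (fun t : ℕ => (t : ℝ) ^ (-(15 / 32) : ℝ) / √c₂) atTop (𝓝 0) := by
    simpa using (tendsto_natCast_rpow_neg (p := 15 / 32) (by norm_num)).div_const √c₂
  have hexp : Tendsto (fun t : ℕ => Real.exp (dm / 2 * (c₂ * t / sM))) atTop atTop := by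
    refine Real.tendsto_exp_atTop.comp ?_
    have h1 := hT.const_mul_atTop (by positivity : 0 < dm / 2 * (c₂ / sM))
    refine h1.congr fun t => ?_
    ring
  refine ⟨2 * (dM / sm) + 1 + 6 / sm / √c₂, M, hM0, ?_⟩
  filter_upwards [hlin, hdiv.eventually hlin, eventually_ge_atTop (2 * M), eventually_ge_atTop 1,
    hlim.eventually_lt_const (by positivity : 0 < dm / 4),
    hexp.eventually_gt_atTop (sM / sm * (2 / c₂))] with t hl1 hl2 htM ht1 hlimt hexpt
  intro a x hKG hg1 hA1 hg2 hA2 i j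
  have ht1' : (1 : ℝ) ≤ t := by exact_mod_cast ht1
  have ht0 : (0 : ℝ) < t := by linarith
  have hv : c₂ * t ≤ c₁ * (t / M : ℕ) := by
    have := mul_le_mul_of_nonneg_left (div_le_natDiv hM0 htM) hc₁.le
    calc c₂ * t = c₁ * (t / (2 * M)) := by rw [hc₂]; ring
      _ ≤ _ := this
  have hy : ∀ i, c₂ * t ≤ pulls a (t / M) i := fun i => hv.trans (hl2 a x hKG hg2 hA2 i)
  have hlt : pulls a (t / M) j < pulls a t j := by
    have h1 : (pulls a (t / M) j : ℝ) ≤ (t / M : ℕ) := by exact_mod_cast pulls_le a _ _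
    have h2 : ((t / M : ℕ) : ℝ) ≤ t / M := Nat.cast_div_le
    have h3 := hl1 a x hKG hg1 hA1 j
    have h4 : (t : ℝ) / M < c₁ * t := by
      rw [div_lt_iff₀ hM0']
      nlinarith
    have h5 : (pulls a (t / M) j : ℝ) < pulls a t j := by linarith
    exact_mod_cast h5
  have he : (t : ℝ) ^ (1 / 32 : ℝ) / √(c₂ * t) = (t : ℝ) ^ (-(15 / 32) : ℝ) / √c₂ :=
    rpow_div_sqrt hc₂0 ht0
  have h := pulls_balance hk hsm hσm hσM hdm0 hdm hdM
    (e := (t : ℝ) ^ (-(15 / 32) : ℝ) / √c₂) (y := c₂ * t) (by positivity)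
    (by linarith) hKG (Nat.div_le_self t M) (by positivity) hy
    (fun s hs hst i => by
      rw [← he]
      exact hA1.sampleErr_le (by positivity) hst.le (by positivity)
        ((hy i).trans (by exact_mod_cast pulls_mono a i hs)))
    (lt_of_le_of_lt (by
      have h1 : ((t : ℝ) + 1) / (c₂ * t) ≤ 2 / c₂ := by
        rw [div_le_div_iff₀ (by positivity) hc₂0]
        nlinarith
      gcongr) hexpt) i j hlt
  refine h.trans (add_le_add le_rfl ?_)
  have hp1 : 1 ≤ (t : ℝ) ^ (17 / 32 : ℝ) := Real.one_le_rpow ht1' (by norm_num)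
  have hp2 : (t : ℝ) ^ (-(15 / 32) : ℝ) * t = (t : ℝ) ^ (17 / 32 : ℝ) := by
    nth_rewrite 2 [← Real.rpow_one (t : ℝ)]
    rw [← Real.rpow_add ht0]; norm_num
  have e1 : 6 * ((t : ℝ) ^ (-(15 / 32) : ℝ) / √c₂ / sm) * t
      = 6 / sm / √c₂ * (t : ℝ) ^ (17 / 32 : ℝ) := by
    rw [← hp2]; field_simp
  rw [e1, add_mul]
  have h3 : 0 ≤ 2 * (dM / sm) + 1 := by positivity
  nlinarith

/-- On a path with typical noise the share of each arm is close to its equilibrium value, which is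
proportional to `σ_i / d_i` where `d_i` is the gap of the true means. -/
lemma eventually_abs_pulls_sub_le (hk : 2 ≤ k) {μ σ : Fin k → ℝ} {sm sM dm dM : ℝ}
    (hsm : 0 < sm) (hσm : ∀ i, sm ≤ σ i) (hσM : ∀ i, σ i ≤ sM)
    (hdm0 : 0 < dm) (hdm : ∀ i, dm ≤ gap μ i) (hdM : ∀ i, gap μ i ≤ dM) :
    ∃ (C : ℝ) (M : ℕ), 0 < M ∧
    ∀ᶠ t : ℕ in atTop, ∀ (a : ℕ → Fin k) (x : ℕ → ℝ), IsKGPath σ a x →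
      Typical μ a x (sm / sM / (4 * k)) (t / 2) → NoiseBound μ a x ((t : ℝ) ^ (1 / 32 : ℝ)) t →
      Typical μ a x (sm / sM / (4 * k)) (t / M / 2) →
      NoiseBound μ a x (((t / M : ℕ) : ℝ) ^ (1 / 32 : ℝ)) (t / M) →
      ∀ i, |pulls a t i - σ i / gap μ i / (∑ l, σ l / gap μ l) * t| ≤
        C * (t : ℝ) ^ (17 / 32 : ℝ) := by
  obtain ⟨C, M, hM, h⟩ := eventually_pulls_balance hk hsm hσm hσM hdm0 hdm hdM
  have i0 : Fin k := ⟨0, by omega⟩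
  have hsM : 0 < sM := hsm.trans_le ((hσm i0).trans (hσM i0))
  refine ⟨sM / dm * |C|, M, hM, ?_⟩
  filter_upwards [h] with t ht a x hKG h1 h2 h3 h4 i
  have hc : ∀ i, 0 < σ i / gap μ i := fun i =>
    div_pos (hsm.trans_le (hσm i)) (hdm0.trans_le (hdm i))
  have := abs_pulls_sub_le hc (n := fun i => (pulls a t i : ℝ)) (t := t)
    (E := C * (t : ℝ) ^ (17 / 32 : ℝ)) (by exact_mod_cast sum_pulls a t)
    (fun i j => by simpa only [inv_div] using ht a x hKG h1 h2 h3 h4 i j) i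
  refine this.trans ?_
  have hp : 0 ≤ (t : ℝ) ^ (17 / 32 : ℝ) := by positivity
  calc σ i / gap μ i * (C * (t : ℝ) ^ (17 / 32 : ℝ))
      ≤ σ i / gap μ i * (|C| * (t : ℝ) ^ (17 / 32 : ℝ)) :=
        mul_le_mul_of_nonneg_left (mul_le_mul_of_nonneg_right (le_abs_self C) hp) (hc i).le
    _ ≤ sM / dm * (|C| * (t : ℝ) ^ (17 / 32 : ℝ)) :=
        mul_le_mul_of_nonneg_right (div_le_div₀ hsM.le (hσM i) hdm0 (hdm i)) (by positivity)
    _ = _ := by ring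

end KG

/-! ### The sampling model: moments and tails of the noise -/

namespace KG

variable {k : ℕ} {Ω : Type*} {mΩ : MeasurableSpace Ω}

/-- The sampling model: Gaussian rewards, where those of round `t` are jointly independent of the
information `ℱ t` that determines the arm `I t`. Independence of the rewards of different arms is
not needed. -/
structure IsSampling (P : Measure Ω) (μ σ : Fin k → ℝ) (X : ℕ → Fin k → Ω → ℝ)
    (I : ℕ → Ω → Fin k) (ℱ : Filtration ℕ mΩ) : Prop where
  law : ∀ t i, HasLaw (X t i) (gaussianReal (μ i) (Real.toNNReal (σ i ^ 2))) P
  adapted : ∀ t i, Measurable[ℱ (t + 1)] (X t i)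
  future : ∀ t, Indep (MeasurableSpace.comap (fun ω i => X t i ω) MeasurableSpace.pi) (ℱ t) P
  pull_adapted : ∀ t, Measurable[ℱ t] (I t)

/-- The arms pulled in the outcome `ω`. -/
abbrev arms (I : ℕ → Ω → Fin k) (ω : Ω) : ℕ → Fin k := fun s => I s ω

/-- The rewards observed in the outcome `ω`. -/
abbrev rewards (X : ℕ → Fin k → Ω → ℝ) (I : ℕ → Ω → Fin k) (ω : Ω) : ℕ → ℝ :=
  fun s => X s (I s ω) ω

namespace IsSampling

variable {P : Measure Ω} {μ σ : Fin k → ℝ} {X : ℕ → Fin k → Ω → ℝ} {I : ℕ → Ω → Fin k}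
  {ℱ : Filtration ℕ mΩ}

lemma measurable_reward (hS : IsSampling P μ σ X I ℱ) (t : ℕ) (i : Fin k) : Measurable (X t i) :=
  (hS.adapted t i).mono (ℱ.le _) le_rfl

lemma measurableSet_pull (hS : IsSampling P μ σ X I ℱ) (t : ℕ) (i : Fin k) :
    MeasurableSet[ℱ t] {ω | I t ω = i} :=
  hS.pull_adapted t (measurableSet_singleton i)

lemma measurable_pulls (hS : IsSampling P μ σ X I ℱ) (t : ℕ) (i : Fin k) :
    Measurable[ℱ t] fun ω => pulls (arms I ω) t i := by
  induction t with
  | zero => simp only [pulls_zero]; exact measurable_const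
  | succ t ih =>
    have hle : ℱ t ≤ ℱ (t + 1) := ℱ.mono t.le_succ
    simp only [pulls_succ]
    exact (ih.mono hle le_rfl).add
      (Measurable.ite (hle _ (hS.measurableSet_pull t i)) measurable_const measurable_const)

lemma noiseSum_rewards_succ (t : ℕ) (i : Fin k) (ω : Ω) :
    noiseSum μ (arms I ω) (rewards X I ω) (t + 1) i =
      noiseSum μ (arms I ω) (rewards X I ω) t i + if I t ω = i then X t i ω - μ i else 0 := by
  rw [noiseSum_succ]
  congr 1
  by_cases h : I t ω = i
  · simp [arms, rewards, h]
  · simp [arms, h]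

lemma measurable_noiseSum (hS : IsSampling P μ σ X I ℱ) (t : ℕ) (i : Fin k) :
    Measurable[ℱ t] fun ω => noiseSum μ (arms I ω) (rewards X I ω) t i := by
  induction t with
  | zero => simp only [noiseSum_zero]; exact measurable_const
  | succ t ih =>
    have hle : ℱ t ≤ ℱ (t + 1) := ℱ.mono t.le_succ
    simp only [noiseSum_rewards_succ]
    exact (ih.mono hle le_rfl).add
      (Measurable.ite (hle _ (hS.measurableSet_pull t i))
        ((hS.adapted t i).sub measurable_const) measurable_const)

lemma measurable_reward_comap (X : ℕ → Fin k → Ω → ℝ) (t : ℕ) (i : Fin k) :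
    Measurable[MeasurableSpace.comap (fun ω i => X t i ω) MeasurableSpace.pi] (X t i) :=
  (@measurable_pi_iff _ _ _ (MeasurableSpace.comap (fun ω i => X t i ω) MeasurableSpace.pi) _ _).1
    (comap_measurable fun ω i => X t i ω) i

lemma indepFun (hS : IsSampling P μ σ X I ℱ) {t : ℕ} {Y : Ω → ℝ} (hY : Measurable[ℱ t] Y)
    (i : Fin k) : IndepFun Y (X t i) P := by
  rw [IndepFun_iff_Indep]
  refine indep_of_indep_of_le_left (indep_of_indep_of_le_right (hS.future t).symm ?_) hY.comap_le
  exact (measurable_reward_comap X t i).comap_le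

lemma integral_mul_comp (hS : IsSampling P μ σ X I ℱ) {t : ℕ} {Y : Ω → ℝ}
    (hY : Measurable[ℱ t] Y) (i : Fin k) {g : ℝ → ℝ} (hg : Measurable g) :
    ∫ ω, Y ω * g (X t i ω) ∂P = (∫ ω, Y ω ∂P) * ∫ ω, g (X t i ω) ∂P :=
  ((hS.indepFun hY i).comp measurable_id hg).integral_fun_mul_eq_mul_integral
    (hY.mono (ℱ.le t) le_rfl).aestronglyMeasurable
    (hg.comp (hS.measurable_reward t i)).aestronglyMeasurable

lemma memLp_noise (hS : IsSampling P μ σ X I ℱ) [IsProbabilityMeasure P] (t : ℕ) (i : Fin k) :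
    MemLp (fun ω => X t i ω - μ i) 2 P := by
  have h1 : MemLp (X t i) 2 P := by
    have h2 := memLp_id_gaussianReal' (μ := μ i) (v := Real.toNNReal (σ i ^ 2)) 2 (by norm_num)
    rw [← (hS.law t i).map_eq] at h2
    exact (memLp_map_measure_iff aestronglyMeasurable_id (hS.law t i).aemeasurable).1 h2
  exact h1.sub (memLp_const _)

lemma integral_noise (hS : IsSampling P μ σ X I ℱ) [IsProbabilityMeasure P] (t : ℕ) (i : Fin k) :
    ∫ ω, (X t i ω - μ i) ∂P = 0 := by
  have h := (hS.law t i).integral_eq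
  rw [integral_id_gaussianReal] at h
  have hi : Integrable (X t i) P := by
    have := ((hS.memLp_noise t i).integrable (by norm_num)).add (integrable_const (μ i))
    refine this.congr (Eventually.of_forall fun ω => ?_)
    simp
  rw [integral_sub hi (integrable_const _), h]
  simp

lemma integral_noise_sq (hS : IsSampling P μ σ X I ℱ) [IsProbabilityMeasure P] (t : ℕ)
    (i : Fin k) : ∫ ω, (X t i ω - μ i) ^ 2 ∂P = σ i ^ 2 := by
  have h := (hS.law t i).variance_eq
  rw [variance_id_gaussianReal, variance_eq_integral (hS.law t i).aemeasurable,
    (hS.law t i).integral_eq, integral_id_gaussianReal] at h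
  rw [h, Real.coe_toNNReal _ (sq_nonneg _)]

lemma lintegral_exp_noise (hS : IsSampling P μ σ X I ℱ) [IsProbabilityMeasure P] (t : ℕ)
    (i : Fin k) (c : ℝ) :
    ∫⁻ ω, ENNReal.ofReal (Real.exp (c * (X t i ω - μ i) - c ^ 2 * σ i ^ 2 / 2)) ∂P = 1 := by
  have h := mgf_gaussianReal (hS.law t i).map_eq c
  rw [Real.coe_toNNReal _ (sq_nonneg _)] at h
  have hint : Integrable (fun ω => Real.exp (c * X t i ω)) P := by
    by_contra hn
    rw [mgf, integral_undef hn] at h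
    exact (Real.exp_pos _).ne h
  have e : ∀ ω, Real.exp (c * (X t i ω - μ i) - c ^ 2 * σ i ^ 2 / 2)
      = Real.exp (c * X t i ω) * Real.exp (-(μ i * c + σ i ^ 2 * c ^ 2 / 2)) := fun ω => by
    rw [← Real.exp_add]; ring_nf
  simp only [e]
  rw [← ofReal_integral_eq_lintegral_ofReal (hint.mul_const _)
    (Eventually.of_forall fun ω => by positivity), integral_mul_const]
  rw [mgf] at h
  rw [h, ← Real.exp_add]
  simp

/-- The exponential martingale of the noise sums. -/
lemma lintegral_exp_noiseSum (hS : IsSampling P μ σ X I ℱ) [IsProbabilityMeasure P] (t : ℕ)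
    (i : Fin k) (c : ℝ) :
    ∫⁻ ω, ENNReal.ofReal (Real.exp (c * noiseSum μ (arms I ω) (rewards X I ω) t i
      - c ^ 2 * σ i ^ 2 / 2 * pulls (arms I ω) t i)) ∂P = 1 := by
  induction t with
  | zero => simp [noiseSum_zero, pulls_zero]
  | succ t ih =>
    set Z : Ω → ℝ≥0∞ := fun ω => ENNReal.ofReal (Real.exp
      (c * noiseSum μ (arms I ω) (rewards X I ω) t i
      - c ^ 2 * σ i ^ 2 / 2 * pulls (arms I ω) t i)) with hZ
    have hZm : Measurable[ℱ t] Z := by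
      refine ENNReal.measurable_ofReal.comp (Real.measurable_exp.comp ?_)
      exact ((hS.measurable_noiseSum t i).const_mul c).sub
        (((measurable_from_top (f := fun n : ℕ => (n : ℝ))).comp
          (hS.measurable_pulls t i)).const_mul _)
    set A : Set Ω := {ω | I t ω = i} with hA
    have hAm : MeasurableSet[ℱ t] A := hS.measurableSet_pull t i
    have hAm' : MeasurableSet A := ℱ.le t _ hAm
    set w : ℝ → ℝ≥0∞ := fun y => ENNReal.ofReal (Real.exp (c * (y - μ i) - c ^ 2 * σ i ^ 2 / 2))
      with hw
    have hwm : Measurable w := by fun_prop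
    have e : ∀ ω, ENNReal.ofReal (Real.exp
        (c * noiseSum μ (arms I ω) (rewards X I ω) (t + 1) i
          - c ^ 2 * σ i ^ 2 / 2 * pulls (arms I ω) (t + 1) i))
        = A.indicator Z ω * w (X t i ω) + Aᶜ.indicator Z ω := by
      intro ω
      rw [noiseSum_rewards_succ, pulls_succ]
      by_cases h : I t ω = i
      · rw [if_pos h, if_pos h, Set.indicator_of_mem (by exact h),
          Set.indicator_of_notMem (by simpa [hA] using h), add_zero, hZ, hw]
        simp only
        rw [← ENNReal.ofReal_mul (Real.exp_pos _).le, ← Real.exp_add]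
        congr 2
        push_cast
        ring
      · rw [if_neg h, if_neg h, Set.indicator_of_notMem (by exact h),
          Set.indicator_of_mem (by exact h), zero_mul, zero_add]
        simp [hZ]
    have hZA : Measurable[ℱ t] (A.indicator Z) := hZm.indicator hAm
    have hind : ∫⁻ ω, A.indicator Z ω * w (X t i ω) ∂P
        = (∫⁻ ω, A.indicator Z ω ∂P) * ∫⁻ ω, w (X t i ω) ∂P := by
      refine lintegral_mul_eq_lintegral_mul_lintegral_of_independent_measurableSpace (ℱ.le t)
        (Measurable.comap_le (measurable_pi_lambda _ fun i => hS.measurable_reward t i))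
        (hS.future t).symm hZA (hwm.comp (measurable_reward_comap X t i))
    simp only [e]
    rw [lintegral_add_right _ ((hZm.mono (ℱ.le t) le_rfl).indicator hAm'.compl), hind,
      hS.lintegral_exp_noise t i c, mul_one, lintegral_indicator hAm',
      lintegral_indicator hAm'.compl, lintegral_add_compl Z hAm']
    exact ih

/-- The Gaussian tail of a noise sum, on the event that it has a given number of terms. -/
lemma measure_noiseSum_gt (hS : IsSampling P μ σ X I ℱ) [IsProbabilityMeasure P]
    {i : Fin k} (hσi : 0 < σ i) (s n : ℕ) {r : ℝ} (hr : 0 ≤ r) :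
    P.real {ω | pulls (arms I ω) s i = n ∧
      r * √n < |noiseSum μ (arms I ω) (rewards X I ω) s i|}
      ≤ 2 * Real.exp (-(r ^ 2 / (2 * σ i ^ 2))) := by
  have hone : ∀ sgn : ℝ, sgn ^ 2 = 1 → P.real {ω | pulls (arms I ω) s i = n ∧
      r * √n < sgn * noiseSum μ (arms I ω) (rewards X I ω) s i}
      ≤ Real.exp (-(r ^ 2 / (2 * σ i ^ 2))) := by
    intro sgn hsgn
    rcases Nat.eq_zero_or_pos n with hn | hn
    · have h0 : {ω | pulls (arms I ω) s i = n ∧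
          r * √n < sgn * noiseSum μ (arms I ω) (rewards X I ω) s i} = ∅ := by
        ext ω
        simp only [Set.mem_ofPred_eq, Set.mem_empty_iff_false, iff_false, not_and, hn]
        intro h0
        have : noiseSum μ (arms I ω) (rewards X I ω) s i = 0 := by
          refine Finset.sum_eq_zero fun u hu => if_neg fun hui => ?_
          have : u ∈ (Finset.range s).filter (fun u => arms I ω u = i) :=
            Finset.mem_filter.2 ⟨hu, hui⟩
          rw [Finset.card_eq_zero.1 h0] at this
          simp at this
        simp [this]
      rw [h0, measureReal_empty]
      positivity
    have hn' : (0 : ℝ) < n := by exact_mod_cast hn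
    have hsq : 0 < √(n : ℝ) := Real.sqrt_pos.2 hn'
    -- the exponent `c` that is optimal in the Chernoff bound
    set c : ℝ := r / (σ i ^ 2 * √n) with hc
    have hc0 : 0 ≤ c := by positivity
    set Z : Ω → ℝ≥0∞ := fun ω => ENNReal.ofReal (Real.exp
      ((sgn * c) * noiseSum μ (arms I ω) (rewards X I ω) s i
      - (sgn * c) ^ 2 * σ i ^ 2 / 2 * pulls (arms I ω) s i)) with hZ
    have hZm : Measurable Z := by
      refine ENNReal.measurable_ofReal.comp (Real.measurable_exp.comp ?_)
      exact (((hS.measurable_noiseSum s i).mono (ℱ.le s) le_rfl).const_mul _).sub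
        (((measurable_from_top (f := fun n : ℕ => (n : ℝ))).comp
          ((hS.measurable_pulls s i).mono (ℱ.le s) le_rfl)).const_mul _)
    have hsub : {ω | pulls (arms I ω) s i = n ∧
        r * √n < sgn * noiseSum μ (arms I ω) (rewards X I ω) s i}
        ⊆ {ω | ENNReal.ofReal (Real.exp (r ^ 2 / (2 * σ i ^ 2))) ≤ Z ω} := by
      rintro ω ⟨h1, h2⟩
      refine ENNReal.ofReal_le_ofReal (Real.exp_le_exp.2 ?_)
      rw [h1, mul_pow, hsgn, one_mul]
      have h3 := mul_le_mul_of_nonneg_left h2.le hc0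
      have h4 : c * (r * √n) = r ^ 2 / σ i ^ 2 := by rw [hc]; field_simp
      have h5 : c ^ 2 * σ i ^ 2 / 2 * n = r ^ 2 / (2 * σ i ^ 2) := by
        rw [hc, div_pow, mul_pow, Real.sq_sqrt hn'.le]; field_simp
      have h6 : r ^ 2 / σ i ^ 2 = r ^ 2 / (2 * σ i ^ 2) + r ^ 2 / (2 * σ i ^ 2) := by
        field_simp; norm_num
      rw [h5]
      linarith
    have hmk := mul_meas_ge_le_lintegral hZm (μ := P)
      (ENNReal.ofReal (Real.exp (r ^ 2 / (2 * σ i ^ 2))))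
    rw [hS.lintegral_exp_noiseSum s i (sgn * c)] at hmk
    have h7 : P {ω | ENNReal.ofReal (Real.exp (r ^ 2 / (2 * σ i ^ 2))) ≤ Z ω}
        ≤ ENNReal.ofReal (Real.exp (-(r ^ 2 / (2 * σ i ^ 2)))) := by
      rw [Real.exp_neg, ENNReal.ofReal_inv_of_pos (Real.exp_pos _)]
      rw [mul_comm] at hmk
      exact ENNReal.le_inv_iff_mul_le.2 hmk
    exact ENNReal.toReal_le_of_le_ofReal (Real.exp_pos _).le ((measure_mono hsub).trans h7)
  have hsub : {ω | pulls (arms I ω) s i = n ∧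
      r * √n < |noiseSum μ (arms I ω) (rewards X I ω) s i|} ⊆
      {ω | pulls (arms I ω) s i = n ∧
        r * √n < 1 * noiseSum μ (arms I ω) (rewards X I ω) s i} ∪
      {ω | pulls (arms I ω) s i = n ∧
        r * √n < (-1) * noiseSum μ (arms I ω) (rewards X I ω) s i} := by
    rintro ω ⟨h1, h2⟩
    rcases lt_abs.1 h2 with h | h
    · exact Or.inl ⟨h1, by linarith⟩
    · exact Or.inr ⟨h1, by linarith⟩
  refine (measureReal_mono hsub).trans ((measureReal_union_le _ _).trans ?_)
  linarith [hone 1 (by norm_num), hone (-1) (by norm_num)]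

lemma measure_not_noiseBound (hS : IsSampling P μ σ X I ℱ) [IsProbabilityMeasure P]
    (hσ : ∀ i, 0 < σ i) {sM : ℝ} (hσM : ∀ i, σ i ≤ sM) (t : ℕ) {r : ℝ} (hr : 0 ≤ r) :
    P.real {ω | ¬ NoiseBound μ (arms I ω) (rewards X I ω) r t}
      ≤ (t + 1) ^ 2 * k * (2 * Real.exp (-(r ^ 2 / (2 * sM ^ 2)))) := by
  set B : ℕ × ℕ × Fin k → Set Ω := fun p => {ω | pulls (arms I ω) p.1 p.2.2 = p.2.1 ∧
      r * √(p.2.1) < |noiseSum μ (arms I ω) (rewards X I ω) p.1 p.2.2|} with hB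
  set F : Finset (ℕ × ℕ × Fin k) :=
    Finset.range (t + 1) ×ˢ Finset.range (t + 1) ×ˢ Finset.univ with hF
  have hsub : {ω | ¬ NoiseBound μ (arms I ω) (rewards X I ω) r t} ⊆ ⋃ p ∈ F, B p := by
    intro ω hω
    simp only [NoiseBound, Set.mem_ofPred_eq, not_forall, not_le] at hω
    obtain ⟨s, hs, i, h⟩ := hω
    refine Set.mem_iUnion₂.2 ⟨(s, pulls (arms I ω) s i, i), ?_, rfl, h⟩
    have := pulls_le (arms I ω) s i
    simp only [hF, Finset.mem_product, Finset.mem_range, Finset.mem_univ, and_true]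
    omega
  refine (measureReal_mono hsub (measure_ne_top _ _)).trans
    ((measureReal_biUnion_finset_le F B).trans ?_)
  have hterm : ∀ p ∈ F, P.real (B p) ≤ 2 * Real.exp (-(r ^ 2 / (2 * sM ^ 2))) := by
    rintro ⟨s, n, i⟩ -
    refine (hS.measure_noiseSum_gt (hσ i) s n hr).trans ?_
    have h1 := hσ i
    have h2 := hσM i
    gcongr
  refine (Finset.sum_le_card_nsmul F _ _ hterm).trans (le_of_eq ?_)
  rw [nsmul_eq_mul, hF, Finset.card_product, Finset.card_product]
  simp
  ring

lemma memLp_noiseSum (hS : IsSampling P μ σ X I ℱ) [IsProbabilityMeasure P] (t : ℕ) (i : Fin k) :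
    MemLp (fun ω => noiseSum μ (arms I ω) (rewards X I ω) t i) 2 P := by
  induction t with
  | zero => simp only [noiseSum_zero]; exact memLp_const _
  | succ t ih =>
    simp only [noiseSum_rewards_succ]
    refine ih.add (((hS.memLp_noise t i).indicator
      (ℱ.le t _ (hS.measurableSet_pull t i))).ae_eq (Eventually.of_forall fun ω => ?_))
    simp [Set.indicator_apply]

lemma integral_noiseSum_sq_le (hS : IsSampling P μ σ X I ℱ) [IsProbabilityMeasure P] (t : ℕ)
    (i : Fin k) :
    ∫ ω, noiseSum μ (arms I ω) (rewards X I ω) t i ^ 2 ∂P ≤ σ i ^ 2 * t := by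
  induction t with
  | zero => simp [noiseSum_zero]
  | succ t ih =>
    set A : Set Ω := {ω | I t ω = i} with hA
    have hAm : MeasurableSet[ℱ t] A := hS.measurableSet_pull t i
    set S : Ω → ℝ := fun ω => noiseSum μ (arms I ω) (rewards X I ω) t i with hSdef
    have hSm : Measurable[ℱ t] S := hS.measurable_noiseSum t i
    have hS2 : MemLp S 2 P := hS.memLp_noiseSum t i
    have hN := hS.memLp_noise t i
    have hSA : MemLp (A.indicator S) 2 P := hS2.indicator (ℱ.le t _ hAm)
    have e : ∀ ω, noiseSum μ (arms I ω) (rewards X I ω) (t + 1) i ^ 2 =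
        S ω ^ 2 + 2 * (A.indicator S ω * (X t i ω - μ i))
          + A.indicator (fun ω => (X t i ω - μ i) ^ 2) ω := fun ω => by
      rw [noiseSum_rewards_succ]
      by_cases h : I t ω = i
      · rw [if_pos h, Set.indicator_of_mem (by exact h), Set.indicator_of_mem (by exact h)]
        ring
      · rw [if_neg h, Set.indicator_of_notMem (by exact h), Set.indicator_of_notMem (by exact h)]
        simp [hSdef]
    have h0 : ∫ ω, A.indicator S ω * (X t i ω - μ i) ∂P = 0 := by
      rw [hS.integral_mul_comp (hSm.indicator hAm) i (g := fun y => y - μ i) (by fun_prop),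
        hS.integral_noise, mul_zero]
    have i1 : Integrable (fun ω => S ω ^ 2) P := hS2.integrable_sq
    have i2 : Integrable (fun ω => A.indicator S ω * (X t i ω - μ i)) P := hSA.integrable_mul hN
    have i3 : Integrable (A.indicator (fun ω => (X t i ω - μ i) ^ 2)) P :=
      hN.integrable_sq.indicator (ℱ.le t _ hAm)
    have h3 : ∫ ω, A.indicator (fun ω => (X t i ω - μ i) ^ 2) ω ∂P ≤ σ i ^ 2 := by
      rw [← hS.integral_noise_sq t i]
      exact integral_mono i3 hN.integrable_sq
        (Set.indicator_le_self' fun ω _ => sq_nonneg _)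
    have i4 : Integrable (fun ω => S ω ^ 2 + 2 * (A.indicator S ω * (X t i ω - μ i))) P :=
      i1.add (i2.const_mul 2)
    simp only [e]
    rw [integral_add i4 i3, integral_add i1 (i2.const_mul 2),
      integral_const_mul, h0]
    push_cast
    linarith

lemma integral_abs_noiseSum_le (hS : IsSampling P μ σ X I ℱ) [IsProbabilityMeasure P]
    {i : Fin k} (hσi : 0 ≤ σ i) (t : ℕ) :
    ∫ ω, |noiseSum μ (arms I ω) (rewards X I ω) t i| ∂P ≤ σ i * √t := by
  have hS2 : MemLp (fun ω => |noiseSum μ (arms I ω) (rewards X I ω) t i|) 2 P :=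
    (hS.memLp_noiseSum t i).abs
  have h1 : 0 ≤ Var[fun ω => |noiseSum μ (arms I ω) (rewards X I ω) t i|; P] := variance_nonneg _ _
  rw [variance_eq_sub hS2] at h1
  have h2 := hS.integral_noiseSum_sq_le t i
  simp only [Pi.pow_apply, sq_abs] at h1
  refine abs_le_of_sq_le_sq' ?_ (by positivity) |>.2
  rw [mul_pow, Real.sq_sqrt (by positivity)]
  linarith

end IsSampling

end KG

/-! ### The potential of two arms -/

namespace KG

variable {k : ℕ}

/-- The truncation of `x` to `[-2h, 2h]`, the derivative of `huber h`. -/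
noncomputable def clamp (h x : ℝ) : ℝ := max (-(2 * h)) (min (2 * h) x)

/-- The convex function that equals `x² / 2` on `[-2h, 2h]` and is linear outside, a smooth version
of `2h |x|`. -/
noncomputable def huber (h x : ℝ) : ℝ := x ^ 2 / 2 - (x - clamp h x) ^ 2 / 2

lemma abs_clamp_le {h : ℝ} (hh : 0 ≤ h) (x : ℝ) : |clamp h x| ≤ 2 * h :=
  abs_le.2 ⟨le_max_left _ _, max_le (by linarith) (min_le_left _ _)⟩

lemma clamp_of_abs_le {h x : ℝ} (hx : |x| ≤ 2 * h) : clamp h x = x := by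
  obtain ⟨h1, h2⟩ := abs_le.1 hx
  rw [clamp, min_eq_right h2, max_eq_right h1]

lemma clamp_cases (h x : ℝ) :
    clamp h x = x ∨ (x ≤ clamp h x ∧ clamp h x = -(2 * h)) ∨
      (clamp h x ≤ x ∧ clamp h x = 2 * h) ∨ h < 0 := by
  unfold clamp
  rcases le_total x (2 * h) with h1 | h1
  · rw [min_eq_right h1]
    rcases le_total (-(2 * h)) x with h2 | h2
    · rw [max_eq_right h2]; exact Or.inl rfl
    · rw [max_eq_left h2]; exact Or.inr (Or.inl ⟨h2, rfl⟩)
  · rw [min_eq_left h1]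
    rcases lt_or_ge h 0 with h3 | h3
    · exact Or.inr (Or.inr (Or.inr h3))
    · rw [max_eq_right (by linarith)]; exact Or.inr (Or.inr (Or.inl ⟨h1, rfl⟩))

/-- The supporting lines of `huber h`: `clamp h y` maximizes `p y - p² / 2` over `|p| ≤ 2h`. -/
lemma huber_ge {h p : ℝ} (hp : |p| ≤ 2 * h) (y : ℝ) : p * y - p ^ 2 / 2 ≤ huber h y := by
  obtain ⟨h1, h2⟩ := abs_le.1 hp
  have : huber h y = clamp h y * y - clamp h y ^ 2 / 2 := by rw [huber]; ring
  rw [this]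
  rcases clamp_cases h y with hc | ⟨hc1, hc2⟩ | ⟨hc1, hc2⟩ | hc
  · rw [hc]; nlinarith [sq_nonneg (p - y)]
  · nlinarith [mul_nonneg (by linarith : 0 ≤ p - clamp h y) (sub_nonneg.2 hc1),
      sq_nonneg (p - clamp h y)]
  · nlinarith [mul_nonneg (by linarith : 0 ≤ clamp h y - p) (sub_nonneg.2 hc1),
      sq_nonneg (p - clamp h y)]
  · linarith

lemma huber_nonneg {h : ℝ} (hh : 0 ≤ h) (x : ℝ) : 0 ≤ huber h x := by
  simpa using huber_ge (h := h) (p := 0) (by simpa using hh) x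

lemma huber_le {h : ℝ} (hh : 0 ≤ h) (x : ℝ) : huber h x ≤ 2 * h * |x| := by
  have : huber h x = clamp h x * x - clamp h x ^ 2 / 2 := by rw [huber]; ring
  have h1 : clamp h x * x ≤ |clamp h x| * |x| := by rw [← abs_mul]; exact le_abs_self _
  have h2 := mul_le_mul_of_nonneg_right (abs_clamp_le hh x) (abs_nonneg x)
  nlinarith [sq_nonneg (clamp h x)]

lemma huber_convex {h : ℝ} (hh : 0 ≤ h) (x y : ℝ) :
    huber h x + clamp h x * (y - x) ≤ huber h y := by
  have h1 := huber_ge (abs_clamp_le hh x) y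
  have : huber h x = clamp h x * x - clamp h x ^ 2 / 2 := by rw [huber]; ring
  nlinarith

lemma huber_quadratic {h x y : ℝ} (hx : |x| ≤ h) (hy : |y - x| ≤ h) :
    huber h x + clamp h x * (y - x) + (y - x) ^ 2 / 2 = huber h y := by
  have h0 : 0 ≤ h := (abs_nonneg x).trans hx
  have hy2 : |y| ≤ 2 * h := by
    have := abs_add_le (y - x) x
    rw [sub_add_cancel] at this
    linarith
  rw [huber, huber, clamp_of_abs_le hy2, clamp_of_abs_le (by linarith : |x| ≤ 2 * h)]
  ring

lemma measurable_clamp (h : ℝ) : Measurable (clamp h) := by unfold clamp; fun_prop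

lemma measurable_huber (h : ℝ) : Measurable (huber h) := by
  have := measurable_clamp h
  unfold huber
  fun_prop

open Classical in
/-- A convex function of the difference of the errors of two arms. By convexity its drift is up to
lower order terms nonnegative, and it is bounded below in the rounds that are close to a tie, just
as in Tanaka's formula for the local time of a random walk. -/
noncomputable def tiePotential (μ : Fin k → ℝ) (a : ℕ → Fin k) (x : ℕ → ℝ) (m h : ℝ) (s : ℕ)
    (j l : Fin k) : ℝ :=
  if m ≤ pulls a s j ∧ m ≤ pulls a s l then
    huber h (sampleErr μ a x s j - sampleErr μ a x s l) else 0

open Classical in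
/-- The coefficient with which the noise of arm `i` enters the increment of the potential. -/
noncomputable def tieWeight (μ : Fin k → ℝ) (a : ℕ → Fin k) (x : ℕ → ℝ) (m h : ℝ) (s : ℕ)
    (j l i : Fin k) : ℝ :=
  if a s = i ∧ m ≤ pulls a s j ∧ m ≤ pulls a s l then
    clamp h (sampleErr μ a x s j - sampleErr μ a x s l) / (pulls a s i + 1) else 0

lemma sampleErr_succ_of_ne (μ : Fin k → ℝ) {a : ℕ → Fin k} (x : ℕ → ℝ) {s : ℕ} {i : Fin k}
    (h : a s ≠ i) : sampleErr μ a x (s + 1) i = sampleErr μ a x s i := by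
  rw [sampleErr, sampleErr, noiseSum_succ, pulls_succ, if_neg h, if_neg h, add_zero, add_zero]

lemma sampleErr_succ_of_eq (μ : Fin k → ℝ) {a : ℕ → Fin k} (x : ℕ → ℝ) {s : ℕ} {i : Fin k}
    (h : a s = i) (hn : 0 < pulls a s i) : sampleErr μ a x (s + 1) i =
      sampleErr μ a x s i + (x s - μ i - sampleErr μ a x s i) / (pulls a s i + 1) := by
  have hn' : (0 : ℝ) < pulls a s i := by exact_mod_cast hn
  rw [sampleErr, sampleErr, noiseSum_succ, pulls_succ, if_pos h, if_pos h]
  push_cast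
  field_simp
  ring

lemma tiePotential_nonneg (μ : Fin k → ℝ) (a : ℕ → Fin k) (x : ℕ → ℝ) (m : ℝ) {h : ℝ}
    (hh : 0 ≤ h) (s : ℕ) (j l : Fin k) : 0 ≤ tiePotential μ a x m h s j l := by
  unfold tiePotential
  split_ifs
  · exact huber_nonneg hh _
  · exact le_rfl

lemma abs_sampleErr_le {μ : Fin k → ℝ} {a : ℕ → Fin k} {x : ℕ → ℝ} {m : ℝ} (hm : 0 < m) {s : ℕ}
    {i : Fin k} (h : m ≤ pulls a s i) : |sampleErr μ a x s i| ≤ |noiseSum μ a x s i| / m := by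
  rw [sampleErr, abs_div, Nat.abs_cast]
  exact div_le_div_of_nonneg_left (abs_nonneg _) hm h

lemma tiePotential_le (μ : Fin k → ℝ) (a : ℕ → Fin k) (x : ℕ → ℝ) {m h : ℝ} (hm : 0 < m)
    (hh : 0 ≤ h) (s : ℕ) (j l : Fin k) :
    tiePotential μ a x m h s j l ≤
      2 * h / m * (|noiseSum μ a x s j| + |noiseSum μ a x s l|) := by
  unfold tiePotential
  split_ifs with hact
  · have h1 := abs_sampleErr_le (μ := μ) (x := x) hm hact.1
    have h2 := abs_sampleErr_le (μ := μ) (x := x) hm hact.2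
    have h3 := abs_sub (sampleErr μ a x s j) (sampleErr μ a x s l)
    calc _ ≤ 2 * h * |sampleErr μ a x s j - sampleErr μ a x s l| := huber_le hh _
      _ ≤ 2 * h * (|noiseSum μ a x s j| / m + |noiseSum μ a x s l| / m) :=
          mul_le_mul_of_nonneg_left (by linarith) (by linarith)
      _ = _ := by ring
  · positivity

lemma clamp_mul_err_le {μ : Fin k → ℝ} {a : ℕ → Fin k} {x : ℕ → ℝ} {m h : ℝ} (hm : 0 < m)
    (hh : 0 ≤ h) {s : ℕ} {i : Fin k} (hi : m ≤ pulls a s i) (D : ℝ) :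
    |clamp h D * sampleErr μ a x s i / (pulls a s i + 1)| ≤
      2 * h / m ^ 2 * |noiseSum μ a x s i| := by
  have hn : (0 : ℝ) < (pulls a s i : ℝ) + 1 := by positivity
  rw [abs_div, abs_mul, abs_of_pos hn]
  calc _ ≤ (2 * h) * (|noiseSum μ a x s i| / m) / m :=
        div_le_div₀ (by positivity)
          (mul_le_mul (abs_clamp_le hh D) (abs_sampleErr_le hm hi) (abs_nonneg _) (by linarith))
          hm (by linarith)
    _ = _ := by field_simp

open Classical in
/-- One step of the potential. The second order term is only needed when the sample is between `2`
and `3` above the mean: then the sample mean moves by between `1` and `4` times `1 / (n + 1)`. -/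
lemma tiePotential_succ_ge {μ : Fin k → ℝ} {a : ℕ → Fin k} {x : ℕ → ℝ} {m h : ℝ} (hm : 1 ≤ m)
    (hh : 0 < h) (hmh : 4 ≤ h * m) {s t : ℕ} (hst : s < t) {j l : Fin k} (hjl : j ≠ l)
    {z : Fin k → ℝ} (hz : x s = z (a s)) :
    tiePotential μ a x m h s j l + tieWeight μ a x m h s j l j * (z j - μ j)
      - tieWeight μ a x m h s j l l * (z l - μ l)
      - 2 * h / m ^ 2 * (|noiseSum μ a x s j| + |noiseSum μ a x s l|)
      + 1 / (2 * (t : ℝ) ^ 2) * ((if NearTie μ a x m h s j l then 1 else 0)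
          * (if z j ∈ Set.Icc (μ j + 2) (μ j + 3) then 1 else 0))
      ≤ tiePotential μ a x m h (s + 1) j l := by
  have hm0 : 0 < m := by linarith
  have hcoef : 0 ≤ 2 * h / m ^ 2 := by positivity
  by_cases hact : m ≤ pulls a s j ∧ m ≤ pulls a s l
  swap
  · have h1 : ¬ NearTie μ a x m h s j l := fun h => hact h.2.1
    have h2 := tiePotential_nonneg μ a x m hh.le (s + 1) j l
    have h3 : 0 ≤ 2 * h / m ^ 2 * (|noiseSum μ a x s j| + |noiseSum μ a x s l|) := by positivity
    rw [tiePotential, tieWeight, tieWeight, if_neg hact, if_neg (fun h => hact h.2),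
      if_neg (fun h => hact h.2), if_neg h1]
    linarith
  have hmono : ∀ i, (pulls a s i : ℝ) ≤ pulls a (s + 1) i := fun i => by
    exact_mod_cast pulls_mono a i s.le_succ
  have hact' : m ≤ pulls a (s + 1) j ∧ m ≤ pulls a (s + 1) l :=
    ⟨hact.1.trans (hmono j), hact.2.trans (hmono l)⟩
  have hnj : (0 : ℝ) < pulls a s j := hm0.trans_le hact.1
  have hnl : (0 : ℝ) < pulls a s l := hm0.trans_le hact.2
  have hSj := abs_nonneg (noiseSum μ a x s j)
  have hSl := abs_nonneg (noiseSum μ a x s l)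
  rw [tiePotential, tiePotential, if_pos hact, if_pos hact', tieWeight, tieWeight]
  set ej := sampleErr μ a x s j with hej
  set el := sampleErr μ a x s l with hel
  by_cases hj : a s = j
  · have hl : a s ≠ l := by rw [hj]; exact hjl
    rw [if_pos ⟨hj, hact⟩, if_neg (fun h => hl h.1), sampleErr_succ_of_ne μ x hl,
      sampleErr_succ_of_eq μ x hj (by exact_mod_cast hnj), hz, hj, ← hej, ← hel]
    set D := ej - el with hD
    set d := (z j - μ j - ej) / ((pulls a s j : ℝ) + 1) with hd
    have e1 : ej + d - el = D + d := by rw [hD]; ring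
    have hb := (abs_le.1 (clamp_mul_err_le (μ := μ) (x := x) hm0 hh.le hact.1 D)).2
    rw [← hej] at hb
    have e2 : clamp h D * d = clamp h D / (pulls a s j + 1) * (z j - μ j)
        - clamp h D * ej / (pulls a s j + 1) := by rw [hd]; ring
    have hcl : 0 ≤ 2 * h / m ^ 2 * |noiseSum μ a x s l| := by positivity
    rw [e1]
    by_cases hq : NearTie μ a x m h s j l ∧ z j ∈ Set.Icc (μ j + 2) (μ j + 3)
    · obtain ⟨hnt, hzj1, hzj2⟩ := hq
      have hnt' := hnt.2.2
      rw [← hej, ← hel, ← hD] at hnt'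
      obtain ⟨he1, he2⟩ := abs_le.1 hnt'.2
      have hn1 : (0 : ℝ) < (pulls a s j : ℝ) + 1 := by positivity
      have hd1 : 1 / ((pulls a s j : ℝ) + 1) ≤ d :=
        div_le_div_of_nonneg_right (by linarith) hn1.le
      have hd2 : d ≤ h := by
        rw [hd, div_le_iff₀ hn1]
        have : h * m ≤ h * ((pulls a s j : ℝ) + 1) :=
          mul_le_mul_of_nonneg_left (by linarith [hact.1]) hh.le
        linarith
      have hd0 : 0 < 1 / ((pulls a s j : ℝ) + 1) := by positivity
      have hquad := huber_quadratic (h := h) (x := D) (y := D + d) hnt'.1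
        (by rw [add_sub_cancel_left, abs_of_pos (hd0.trans_le hd1)]; exact hd2)
      rw [add_sub_cancel_left] at hquad
      have hnt1 : ((pulls a s j : ℝ) + 1) ≤ t := by
        have := pulls_le a s j
        exact_mod_cast (by omega : pulls a s j + 1 ≤ t)
      have hsq : 1 / (2 * (t : ℝ) ^ 2) ≤ d ^ 2 / 2 := by
        have h1 : 1 / (t : ℝ) ≤ d := (div_le_div_of_nonneg_left one_pos.le hn1 hnt1).trans hd1
        have h2 : (1 / (t : ℝ)) ^ 2 ≤ d ^ 2 := pow_le_pow_left₀ (by positivity) h1 2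
        have h3 : 1 / (2 * (t : ℝ) ^ 2) = (1 / (t : ℝ)) ^ 2 / 2 := by
          rw [div_pow, one_pow]; field_simp
        rw [h3]; linarith
      rw [if_pos hnt, if_pos ⟨hzj1, hzj2⟩]
      linarith
    · have hzero : ((if NearTie μ a x m h s j l then 1 else 0)
          * (if z j ∈ Set.Icc (μ j + 2) (μ j + 3) then 1 else 0) : ℝ) = 0 := by
        by_cases h1 : NearTie μ a x m h s j l
        · rw [if_neg (fun h2 => hq ⟨h1, h2⟩), mul_zero]
        · rw [if_neg h1, zero_mul]
      have hconv := huber_convex hh.le D (D + d)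
      rw [add_sub_cancel_left] at hconv
      rw [hzero]
      linarith
  · have hnt : ¬ NearTie μ a x m h s j l := fun h => hj h.1
    rw [if_neg (fun h => hj h.1), if_neg hnt, sampleErr_succ_of_ne μ x hj, ← hej]
    have hcj : 0 ≤ 2 * h / m ^ 2 * |noiseSum μ a x s j| := by positivity
    by_cases hl : a s = l
    · rw [if_pos ⟨hl, hact⟩, sampleErr_succ_of_eq μ x hl (by exact_mod_cast hnl), hz, hl, ← hel]
      set D := ej - el with hD
      set d := (z l - μ l - el) / ((pulls a s l : ℝ) + 1) with hd
      have e1 : ej - (el + d) = D + -d := by rw [hD]; ring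
      have hb := (abs_le.1 (clamp_mul_err_le (μ := μ) (x := x) hm0 hh.le hact.2 D)).1
      rw [← hel] at hb
      have e2 : clamp h D * -d = -(clamp h D / (pulls a s l + 1) * (z l - μ l))
          + clamp h D * el / (pulls a s l + 1) := by rw [hd]; ring
      have hconv := huber_convex hh.le D (D + -d)
      rw [add_sub_cancel_left] at hconv
      rw [e1]
      linarith
    · rw [if_neg (fun h => hl h.1), sampleErr_succ_of_ne μ x hl, ← hel]
      have hcl : 0 ≤ 2 * h / m ^ 2 * |noiseSum μ a x s l| := by positivity
      linarith

namespace IsSampling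

variable {Ω : Type*} {mΩ : MeasurableSpace Ω}
  {P : Measure Ω} {μ σ : Fin k → ℝ} {X : ℕ → Fin k → Ω → ℝ} {I : ℕ → Ω → Fin k}
  {ℱ : Filtration ℕ mΩ}

lemma measurable_pulls_real (hS : IsSampling P μ σ X I ℱ) (s : ℕ) (i : Fin k) :
    Measurable[ℱ s] fun ω => (pulls (arms I ω) s i : ℝ) :=
  (measurable_from_top (f := fun n : ℕ => (n : ℝ))).comp (hS.measurable_pulls s i)

lemma measurable_sampleErr (hS : IsSampling P μ σ X I ℱ) (s : ℕ) (i : Fin k) :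
    Measurable[ℱ s] fun ω => sampleErr μ (arms I ω) (rewards X I ω) s i :=
  (hS.measurable_noiseSum s i).div (hS.measurable_pulls_real s i)

lemma measurableSet_active (hS : IsSampling P μ σ X I ℱ) (m : ℝ) (s : ℕ) (j l : Fin k) :
    MeasurableSet[ℱ s] {ω | m ≤ pulls (arms I ω) s j ∧ m ≤ pulls (arms I ω) s l} :=
  (hS.measurable_pulls_real s j measurableSet_Ici).inter
    (hS.measurable_pulls_real s l measurableSet_Ici)

lemma measurable_tiePotential (hS : IsSampling P μ σ X I ℱ) (m h : ℝ) (s : ℕ) (j l : Fin k) :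
    Measurable[ℱ s] fun ω => tiePotential μ (arms I ω) (rewards X I ω) m h s j l :=
  Measurable.ite (hS.measurableSet_active m s j l)
    ((measurable_huber h).comp ((hS.measurable_sampleErr s j).sub (hS.measurable_sampleErr s l)))
    measurable_const

lemma measurable_tieWeight (hS : IsSampling P μ σ X I ℱ) (m h : ℝ) (s : ℕ) (j l i : Fin k) :
    Measurable[ℱ s] fun ω => tieWeight μ (arms I ω) (rewards X I ω) m h s j l i :=
  Measurable.ite ((hS.measurableSet_pull s i).inter (hS.measurableSet_active m s j l))
    (((measurable_clamp h).comp
      ((hS.measurable_sampleErr s j).sub (hS.measurable_sampleErr s l))).div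
      ((hS.measurable_pulls_real s i).add measurable_const))
    measurable_const

lemma measurableSet_nearTie (hS : IsSampling P μ σ X I ℱ) (m h : ℝ) (s : ℕ) (j l : Fin k) :
    MeasurableSet[ℱ s] {ω | NearTie μ (arms I ω) (rewards X I ω) m h s j l} := by
  have habs : Measurable (fun y : ℝ => |y|) := continuous_abs.measurable
  exact (hS.measurableSet_pull s j).inter ((hS.measurableSet_active m s j l).inter
    (((habs.comp ((hS.measurable_sampleErr s j).sub (hS.measurable_sampleErr s l)))
      measurableSet_Iic).inter ((habs.comp (hS.measurable_sampleErr s j)) measurableSet_Iic)))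

end IsSampling

end KG

/-! ### Ties are rare -/

namespace KG

namespace IsSampling

variable {k : ℕ} {Ω : Type*} {mΩ : MeasurableSpace Ω}
  {P : Measure Ω} {μ σ : Fin k → ℝ} {X : ℕ → Fin k → Ω → ℝ} {I : ℕ → Ω → Fin k}
  {ℱ : Filtration ℕ mΩ}

lemma integrable_tiePotential (hS : IsSampling P μ σ X I ℱ) [IsProbabilityMeasure P] {m h : ℝ}
    (hm : 0 < m) (hh : 0 ≤ h) (s : ℕ) (j l : Fin k) :
    Integrable (fun ω => tiePotential μ (arms I ω) (rewards X I ω) m h s j l) P := by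
  have hj := ((hS.memLp_noiseSum s j).integrable (by norm_num)).abs
  have hl := ((hS.memLp_noiseSum s l).integrable (by norm_num)).abs
  refine ((hj.add hl).const_mul (2 * h / m)).mono'
    ((hS.measurable_tiePotential m h s j l).mono (ℱ.le s) le_rfl).aestronglyMeasurable
    (Eventually.of_forall fun ω => ?_)
  rw [Real.norm_eq_abs, abs_of_nonneg (tiePotential_nonneg _ _ _ _ hh _ _ _)]
  exact tiePotential_le _ _ _ hm hh _ _ _

lemma abs_tieWeight_le {a : ℕ → Fin k} {x : ℕ → ℝ} {h : ℝ} (m : ℝ) (hh : 0 ≤ h) (s : ℕ)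
    (j l i : Fin k) : |tieWeight μ a x m h s j l i| ≤ 2 * h := by
  unfold tieWeight
  split_ifs
  · rw [abs_div, abs_of_pos (by positivity : (0 : ℝ) < (pulls a s i : ℝ) + 1)]
    exact (div_le_self (abs_nonneg _) (by simp)).trans (abs_clamp_le hh _)
  · simpa using hh

lemma integrable_tieWeight_mul (hS : IsSampling P μ σ X I ℱ) [IsProbabilityMeasure P] (m : ℝ)
    {h : ℝ} (hh : 0 ≤ h) (s : ℕ) (j l i : Fin k) :
    Integrable (fun ω => tieWeight μ (arms I ω) (rewards X I ω) m h s j l i * (X s i ω - μ i))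
      P :=
  ((hS.memLp_noise s i).integrable (by norm_num)).bdd_mul
    ((hS.measurable_tieWeight m h s j l i).mono (ℱ.le s) le_rfl).aestronglyMeasurable
    (Eventually.of_forall fun ω => by
      rw [Real.norm_eq_abs]; exact abs_tieWeight_le m hh s j l i)

lemma integral_tieWeight_mul (hS : IsSampling P μ σ X I ℱ) [IsProbabilityMeasure P] (m h : ℝ)
    (s : ℕ) (j l i : Fin k) :
    ∫ ω, tieWeight μ (arms I ω) (rewards X I ω) m h s j l i * (X s i ω - μ i) ∂P = 0 := by
  rw [hS.integral_mul_comp (hS.measurable_tieWeight m h s j l i) i (g := fun y => y - μ i)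
    (by fun_prop), hS.integral_noise, mul_zero]

open Classical in
/-- The expected one-step drift of the potential. The noise terms drop out since the weights are
determined before the rewards of the round. -/
lemma integral_tiePotential_succ_ge (hS : IsSampling P μ σ X I ℱ) [IsProbabilityMeasure P]
    (hσ : ∀ i, 0 < σ i) {sM : ℝ} (hσM : ∀ i, σ i ≤ sM) {m h : ℝ} (hm : 1 ≤ m)
    (hh : 0 < h) (hmh : 4 ≤ h * m) {s t : ℕ} (hst : s < t) {j l : Fin k} (hjl : j ≠ l) :
    ∫ ω, tiePotential μ (arms I ω) (rewards X I ω) m h s j l ∂P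
      - 4 * h * sM * √t / m ^ 2
      + 1 / (2 * (t : ℝ) ^ 2) *
        (P.real {ω | NearTie μ (arms I ω) (rewards X I ω) m h s j l} *
          (gaussianReal (μ j) (Real.toNNReal (σ j ^ 2))).real (Set.Icc (μ j + 2) (μ j + 3)))
      ≤ ∫ ω, tiePotential μ (arms I ω) (rewards X I ω) m h (s + 1) j l ∂P := by
  have hm0 : 0 < m := by linarith
  set T : Set Ω := {ω | NearTie μ (arms I ω) (rewards X I ω) m h s j l} with hT
  have hTm : MeasurableSet[ℱ s] T := hS.measurableSet_nearTie m h s j l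
  have hTm' : MeasurableSet T := ℱ.le s _ hTm
  have i0 := hS.integrable_tiePotential hm0 hh.le s j l
  have i1 := hS.integrable_tieWeight_mul m hh.le s j l j
  have i2 := hS.integrable_tieWeight_mul m hh.le s j l l
  have i3 : Integrable (fun ω => |noiseSum μ (arms I ω) (rewards X I ω) s j|
      + |noiseSum μ (arms I ω) (rewards X I ω) s l|) P :=
    ((hS.memLp_noiseSum s j).integrable (by norm_num)).abs.add
      ((hS.memLp_noiseSum s l).integrable (by norm_num)).abs
  set g : ℝ → ℝ := fun y => if y ∈ Set.Icc (μ j + 2) (μ j + 3) then 1 else 0 with hg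
  have hgm : Measurable g := Measurable.ite measurableSet_Icc measurable_const measurable_const
  set Y : Ω → ℝ := fun ω => if NearTie μ (arms I ω) (rewards X I ω) m h s j l then 1 else 0 with hY
  have hYm : Measurable[ℱ s] Y := Measurable.ite hTm measurable_const measurable_const
  have hYi : Y = T.indicator 1 := by
    ext ω
    simp only [hY, hT, Set.indicator_apply, Set.mem_ofPred_eq, Pi.one_apply]
  have i4 : Integrable (fun ω => Y ω * g (X s j ω)) P := by
    refine Integrable.of_bound ((hYm.mono (ℱ.le s) le_rfl).mul
      (hgm.comp (hS.measurable_reward s j))).aestronglyMeasurable 1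
      (Eventually.of_forall fun ω => ?_)
    simp only [hY, hg]
    split_ifs <;> simp
  have h4 : ∫ ω, Y ω * g (X s j ω) ∂P = P.real T *
      (gaussianReal (μ j) (Real.toNNReal (σ j ^ 2))).real (Set.Icc (μ j + 2) (μ j + 3)) := by
    rw [hS.integral_mul_comp hYm j hgm]
    congr 1
    · rw [hYi, integral_indicator_one hTm']
    · have h5 := (hS.law s j).integral_comp (f := g) hgm.aestronglyMeasurable
      simp only [Function.comp_def] at h5
      rw [h5]
      have h6 : g = (Set.Icc (μ j + 2) (μ j + 3)).indicator 1 := by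
        ext y
        simp only [hg, Set.indicator_apply, Pi.one_apply]
      rw [h6, integral_indicator_one measurableSet_Icc]
  have h3 : ∫ ω, (|noiseSum μ (arms I ω) (rewards X I ω) s j|
      + |noiseSum μ (arms I ω) (rewards X I ω) s l|) ∂P ≤ 2 * (sM * √t) := by
    have hsq : √(s : ℝ) ≤ √(t : ℝ) := Real.sqrt_le_sqrt (by exact_mod_cast hst.le)
    have hb : ∀ i, ∫ ω, |noiseSum μ (arms I ω) (rewards X I ω) s i| ∂P ≤ sM * √t := fun i =>
      (hS.integral_abs_noiseSum_le (hσ i).le s).trans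
        (mul_le_mul (hσM i) hsq (Real.sqrt_nonneg _) ((hσ i).le.trans (hσM i)))
    rw [integral_add ((hS.memLp_noiseSum s j).integrable (by norm_num)).abs
      ((hS.memLp_noiseSum s l).integrable (by norm_num)).abs]
    linarith [hb j, hb l]
  have i12 := (i0.add i1).sub i2
  have i123 := i12.sub (i3.const_mul (2 * h / m ^ 2))
  have i1234 := i123.add (i4.const_mul (1 / (2 * (t : ℝ) ^ 2)))
  have hmono := integral_mono i1234 (hS.integrable_tiePotential hm0 hh.le (s + 1) j l)
    fun ω => tiePotential_succ_ge (a := arms I ω) (x := rewards X I ω) hm hh hmh hst hjl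
      (z := fun i => X s i ω) rfl
  rw [integral_add' i123 (i4.const_mul _), integral_sub' i12 (i3.const_mul _),
    integral_sub' (i0.add i1) i2, integral_add' i0 i1, hS.integral_tieWeight_mul,
    hS.integral_tieWeight_mul, integral_const_mul, integral_const_mul, h4] at hmono
  have h7 := mul_le_mul_of_nonneg_left h3 (by positivity : 0 ≤ 2 * h / m ^ 2)
  have h8 : 2 * h / m ^ 2 * (2 * (sM * √t)) = 4 * h * sM * √t / m ^ 2 := by ring
  linarith

/-- Two arms spend few rounds close to a tie, in expectation. -/
lemma integral_card_tieRounds_le (hS : IsSampling P μ σ X I ℱ) [IsProbabilityMeasure P]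
    (hσ : ∀ i, 0 < σ i) {sM : ℝ} (hσM : ∀ i, σ i ≤ sM) {m h : ℝ} (hm : 1 ≤ m)
    (hh : 0 < h) (hmh : 4 ≤ h * m) (t : ℕ) {j l : Fin k} (hjl : j ≠ l) :
    (gaussianReal (μ j) (Real.toNNReal (σ j ^ 2))).real (Set.Icc (μ j + 2) (μ j + 3)) /
      (2 * (t : ℝ) ^ 2) *
        ∫ ω, ((tieRounds μ (arms I ω) (rewards X I ω) m h t j l).card : ℝ) ∂P
      ≤ 4 * h * sM * √t / m + t * (4 * h * sM * √t / m ^ 2) := by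
  classical
  have hm0 : 0 < m := by linarith
  set p := (gaussianReal (μ j) (Real.toNNReal (σ j ^ 2))).real (Set.Icc (μ j + 2) (μ j + 3))
    with hp
  set T : ℕ → Set Ω := fun s => {ω | NearTie μ (arms I ω) (rewards X I ω) m h s j l} with hT
  have hTm : ∀ s, MeasurableSet (T s) := fun s => ℱ.le s _ (hS.measurableSet_nearTie m h s j l)
  have hcard : ∫ ω, ((tieRounds μ (arms I ω) (rewards X I ω) m h t j l).card : ℝ) ∂P
      = ∑ s ∈ Finset.range t, P.real (T s) := by
    have e : ∀ ω, ((tieRounds μ (arms I ω) (rewards X I ω) m h t j l).card : ℝ)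
        = ∑ s ∈ Finset.range t, (T s).indicator 1 ω := fun ω => by
      simp only [tieRounds, Finset.card_filter, Nat.cast_sum, hT, Set.indicator_apply,
        Set.mem_ofPred_eq, Pi.one_apply, Nat.cast_ite, Nat.cast_one, Nat.cast_zero]
    have hi : ∀ s ∈ Finset.range t, Integrable ((T s).indicator (1 : Ω → ℝ)) P := fun s _ =>
      (integrable_const (1 : ℝ)).indicator (hTm s)
    simp only [e]
    rw [integral_finsetSum _ hi]
    exact Finset.sum_congr rfl fun s _ => integral_indicator_one (hTm s)
  have hind : ∀ s ≤ t, ∑ u ∈ Finset.range s, 1 / (2 * (t : ℝ) ^ 2) * (P.real (T u) * p)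
      - s * (4 * h * sM * √t / m ^ 2)
      ≤ ∫ ω, tiePotential μ (arms I ω) (rewards X I ω) m h s j l ∂P := by
    intro s
    induction s with
    | zero =>
      intro _
      simp only [Finset.range_zero, Finset.sum_empty, Nat.cast_zero, zero_mul, sub_zero]
      exact integral_nonneg fun ω => tiePotential_nonneg _ _ _ _ hh.le _ _ _
    | succ s ih =>
      intro hs
      have h1 := ih (by omega)
      have h2 := hS.integral_tiePotential_succ_ge hσ hσM hm hh hmh (by omega : s < t) hjl
      rw [Finset.sum_range_succ]
      push_cast
      simp only [hT, hp] at h1 h2 ⊢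
      linarith
  have hub : ∫ ω, tiePotential μ (arms I ω) (rewards X I ω) m h t j l ∂P
      ≤ 4 * h * sM * √t / m := by
    have hb : ∀ i, ∫ ω, |noiseSum μ (arms I ω) (rewards X I ω) t i| ∂P ≤ sM * √t := fun i =>
      (hS.integral_abs_noiseSum_le (hσ i).le t).trans
        (mul_le_mul_of_nonneg_right (hσM i) (Real.sqrt_nonneg _))
    have ij := ((hS.memLp_noiseSum t j).integrable (by norm_num)).abs
    have il := ((hS.memLp_noiseSum t l).integrable (by norm_num)).abs
    have h1 := integral_mono (hS.integrable_tiePotential hm0 hh.le t j l)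
      ((ij.add il).const_mul (2 * h / m)) fun ω => tiePotential_le _ _ _ hm0 hh.le _ _ _
    rw [integral_const_mul, integral_add' ij il] at h1
    refine h1.trans ?_
    calc _ ≤ 2 * h / m * (sM * √t + sM * √t) :=
          mul_le_mul_of_nonneg_left (add_le_add (hb j) (hb l)) (by positivity)
      _ = _ := by ring
  have h1 := (hind t le_rfl).trans hub
  have h2 : ∑ u ∈ Finset.range t, 1 / (2 * (t : ℝ) ^ 2) * (P.real (T u) * p)
      = p / (2 * (t : ℝ) ^ 2) * ∑ s ∈ Finset.range t, P.real (T s) := by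
    rw [Finset.mul_sum]
    exact Finset.sum_congr rfl fun u _ => by ring
  rw [hcard, ← h2]
  linarith

lemma card_tieRounds_le (μ : Fin k → ℝ) (a : ℕ → Fin k) (x : ℕ → ℝ) (m h : ℝ) (t : ℕ)
    (j l : Fin k) : (tieRounds μ a x m h t j l).card ≤ t := by
  classical
  rw [tieRounds]
  exact (Finset.card_filter_le _ _).trans (Finset.card_range t).le

lemma measurable_card_tieRounds (hS : IsSampling P μ σ X I ℱ) (m h : ℝ) (t : ℕ) (j l : Fin k) :
    Measurable fun ω => ((tieRounds μ (arms I ω) (rewards X I ω) m h t j l).card : ℝ) := by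
  classical
  simp only [tieRounds, Finset.card_filter, Nat.cast_sum]
  refine Finset.measurable_sum _ fun s _ => ?_
  have h1 : MeasurableSet {ω | NearTie μ (arms I ω) (rewards X I ω) m h s j l} :=
    ℱ.le s _ (hS.measurableSet_nearTie m h s j l)
  simp only [Nat.cast_ite]
  exact Measurable.ite h1 measurable_const measurable_const

lemma gaussian_Icc_pos (m : ℝ) {s : ℝ} (hs : 0 < s) :
    0 < (gaussianReal m (Real.toNNReal (s ^ 2))).real (Set.Icc (m + 2) (m + 3)) := by
  have hv : Real.toNNReal (s ^ 2) ≠ 0 := by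
    rw [Ne, Real.toNNReal_eq_zero, not_le]; positivity
  rw [Measure.real, ENNReal.toReal_pos_iff]
  refine ⟨pos_iff_ne_zero.2 fun h0 => ?_, measure_lt_top _ _⟩
  have h1 := gaussianReal_absolutelyContinuous' m hv h0
  rw [Real.volume_Icc] at h1
  norm_num at h1

/-- With `h = t ^ (-13/16)` the expected number of ties is `O(t ^ (11/16))`; Markov's inequality
compares it with a fraction of `t`. -/
lemma eventually_measure_not_fewTies_le (hS : IsSampling P μ σ X I ℱ) [IsProbabilityMeasure P]
    (hσ : ∀ i, 0 < σ i) {c : ℝ} (hc : 0 < c) :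
    ∃ C : ℝ, ∀ᶠ t : ℕ in atTop,
      P.real {ω | ¬ FewTies μ (arms I ω) (rewards X I ω) c t} ≤ C * (t : ℝ) ^ (-(5 / 16) : ℝ) := by
  obtain ⟨sM, hσM⟩ : ∃ sM, ∀ i, σ i ≤ sM := by
    obtain ⟨sM, h⟩ := (Set.finite_range σ).bddAbove
    exact ⟨sM, fun i => h ⟨i, rfl⟩⟩
  set p : Fin k → ℝ := fun j =>
    (gaussianReal (μ j) (Real.toNNReal (σ j ^ 2))).real (Set.Icc (μ j + 2) (μ j + 3)) with hp
  have hp0 : ∀ j, 0 < p j := fun j => gaussian_Icc_pos (μ j) (hσ j)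
  set K : ℝ := 8 * sM * (1 / c + 1 / c ^ 2) * (4 * (k : ℝ) ^ 2) with hK
  refine ⟨∑ q : Fin k × Fin k, K / p q.1, ?_⟩
  have hT : Tendsto (fun t : ℕ => (t : ℝ)) atTop atTop := tendsto_natCast_atTop_atTop
  filter_upwards [hT.eventually_ge_atTop (1 / c), hT.eventually_ge_atTop 1,
    (tendsto_natCast_rpow (p := 3 / 16) (by norm_num)).eventually_ge_atTop (4 / c)]
    with t h1c ht1 h4c
  have ht0 : (0 : ℝ) < t := by linarith
  rw [div_le_iff₀ hc] at h1c h4c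
  set h : ℝ := (t : ℝ) ^ (-(13 / 16) : ℝ) with hh
  have hh0 : 0 < h := Real.rpow_pos_of_pos ht0 _
  have hmh : 4 ≤ h * (c * t) := by
    have e : h * t = (t : ℝ) ^ (3 / 16 : ℝ) := by
      rw [hh]
      nth_rewrite 2 [← Real.rpow_one (t : ℝ)]
      rw [← Real.rpow_add ht0]; norm_num
    calc (4 : ℝ) ≤ (t : ℝ) ^ (3 / 16 : ℝ) * c := h4c
      _ = h * (c * t) := by rw [← e]; ring
  set B : Fin k × Fin k → Set Ω := fun q => {ω | q.1 ≠ q.2 ∧ (t : ℝ) / (4 * k ^ 2) ≤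
    (tieRounds μ (arms I ω) (rewards X I ω) (c * t) h t q.1 q.2).card} with hB
  have hsub : {ω | ¬ FewTies μ (arms I ω) (rewards X I ω) c t} ⊆
      ⋃ q ∈ (Finset.univ : Finset (Fin k × Fin k)), B q := by
    intro ω hω
    simp only [FewTies, Set.mem_ofPred_eq, not_forall, not_lt] at hω
    obtain ⟨j, l, hjl, -, hle⟩ := hω
    exact Set.mem_iUnion₂.2 ⟨(j, l), Finset.mem_univ _, hjl, hle⟩
  refine (measureReal_mono hsub (measure_ne_top _ _)).trans
    ((measureReal_biUnion_finset_le _ B).trans ?_)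
  rw [Finset.sum_mul]
  refine Finset.sum_le_sum ?_
  rintro ⟨j, l⟩ -
  by_cases hjl : j = l
  · have : B (j, l) = ∅ := by
      ext ω
      simp [hB, hjl]
    rw [this, measureReal_empty]
    have hsM : 0 < sM := (hσ j).trans_le (hσM j)
    have := hp0 j
    positivity
  have hk0 : (0 : ℝ) < k := by exact_mod_cast Fin.pos j
  set N : Ω → ℝ := fun ω =>
    ((tieRounds μ (arms I ω) (rewards X I ω) (c * t) h t j l).card : ℝ) with hN
  have hNint : Integrable N P := by
    refine Integrable.of_bound (hS.measurable_card_tieRounds _ _ t j l).aestronglyMeasurable t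
      (Eventually.of_forall fun ω => ?_)
    rw [Real.norm_eq_abs, Nat.abs_cast]
    exact_mod_cast card_tieRounds_le _ _ _ _ _ t j l
  have hmk := mul_meas_ge_le_integral_of_nonneg (μ := P)
    (Eventually.of_forall fun ω => (Nat.cast_nonneg _ : (0 : ℝ) ≤ N ω)) hNint
    ((t : ℝ) / (4 * k ^ 2))
  have hbd := hS.integral_card_tieRounds_le hσ hσM (m := c * t) (h := h) (by linarith) hh0 hmh t hjl
  have hBle : P.real (B (j, l)) ≤ P.real {ω | (t : ℝ) / (4 * k ^ 2) ≤ N ω} :=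
    measureReal_mono (fun ω hω => hω.2) (measure_ne_top _ _)
  have hpj := hp0 j
  change p j / (2 * (t : ℝ) ^ 2) * ∫ ω, N ω ∂P ≤ _ at hbd
  have e1 : √(t : ℝ) * h = (t : ℝ) ^ (-(5 / 16) : ℝ) := by
    rw [hh, Real.sqrt_eq_rpow, ← Real.rpow_add ht0]; norm_num
  have e2 : 4 * h * sM * √t / (c * t) + t * (4 * h * sM * √t / (c * t) ^ 2)
      = 4 * sM * (1 / c + 1 / c ^ 2) * (t : ℝ) ^ (-(5 / 16) : ℝ) / t := by
    rw [← e1]; field_simp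
  rw [e2] at hbd
  have h5 := mul_le_mul_of_nonneg_left hmk
    (by positivity : 0 ≤ p j / (2 * (t : ℝ) ^ 2))
  have h6 := h5.trans hbd
  have h7 := mul_le_mul_of_nonneg_left (hBle)
    (by positivity : 0 ≤ p j / (2 * (t : ℝ) ^ 2) * ((t : ℝ) / (4 * k ^ 2)))
  have h8 : p j / (2 * (t : ℝ) ^ 2) * ((t : ℝ) / (4 * k ^ 2)) * P.real (B (j, l))
      ≤ 4 * sM * (1 / c + 1 / c ^ 2) * (t : ℝ) ^ (-(5 / 16) : ℝ) / t := by
    refine h7.trans (le_trans (le_of_eq ?_) h6)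
    ring
  have e3 : p j / (2 * (t : ℝ) ^ 2) * ((t : ℝ) / (4 * k ^ 2)) * P.real (B (j, l))
      = p j * P.real (B (j, l)) / (8 * k ^ 2) / t := by
    field_simp; ring
  rw [e3, div_le_div_iff_of_pos_right ht0, div_le_iff₀ (by positivity)] at h8
  rw [div_mul_eq_mul_div, le_div_iff₀ hpj, hK]
  linarith

lemma eventually_measure_not_noiseBound_le (hS : IsSampling P μ σ X I ℱ) [IsProbabilityMeasure P]
    (hσ : ∀ i, 0 < σ i) :
    ∀ᶠ t : ℕ in atTop,
      P.real {ω | ¬ NoiseBound μ (arms I ω) (rewards X I ω) ((t : ℝ) ^ (1 / 32 : ℝ)) t} ≤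
        (t : ℝ) ^ (-(5 / 16) : ℝ) := by
  obtain ⟨sM, hsM1, hσM⟩ : ∃ sM, 1 ≤ sM ∧ ∀ i, σ i ≤ sM := by
    obtain ⟨sM, h⟩ := (Set.finite_range σ).bddAbove
    exact ⟨max 1 sM, le_max_left _ _, fun i => (h ⟨i, rfl⟩).trans (le_max_right _ _)⟩
  have hlim := ((tendsto_rpow_mul_exp_neg_mul_atTop_nhds_zero 37 (1 / (2 * sM ^ 2))
    (by positivity)).comp
    (tendsto_natCast_rpow (p := 1 / 16) (by norm_num))).const_mul (8 * (k : ℝ))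
  rw [mul_zero] at hlim
  filter_upwards [hlim.eventually_lt_const one_pos, eventually_ge_atTop 1] with t ht ht1
  have ht1' : (1 : ℝ) ≤ t := by exact_mod_cast ht1
  have ht0 : (0 : ℝ) < t := by linarith
  refine (hS.measure_not_noiseBound hσ hσM t (by positivity)).trans ?_
  have e1 : ((t : ℝ) ^ (1 / 32 : ℝ)) ^ 2 = (t : ℝ) ^ (1 / 16 : ℝ) := by
    rw [← Real.rpow_natCast, ← Real.rpow_mul ht0.le]; norm_num
  have e2 : ((t : ℝ) ^ (1 / 16 : ℝ)) ^ (37 : ℝ) = (t : ℝ) ^ 2 * (t : ℝ) ^ (5 / 16 : ℝ) := by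
    rw [← Real.rpow_mul ht0.le, ← Real.rpow_natCast (t : ℝ) 2, ← Real.rpow_add ht0]; norm_num
  simp only [Function.comp_apply] at ht
  rw [e2] at ht
  have hq : 0 < (t : ℝ) ^ (5 / 16 : ℝ) := Real.rpow_pos_of_pos ht0 _
  have e3 : -(1 / (2 * sM ^ 2)) * (t : ℝ) ^ (1 / 16 : ℝ) =
      -((t : ℝ) ^ (1 / 16 : ℝ) / (2 * sM ^ 2)) := by ring
  rw [e3] at ht
  rw [e1, Real.rpow_neg ht0.le, ← one_div, le_div_iff₀ hq]
  set E := Real.exp (-((t : ℝ) ^ (1 / 16 : ℝ) / (2 * sM ^ 2)))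
  have hE : 0 < E := Real.exp_pos _
  have h1 : ((t : ℝ) + 1) ^ 2 ≤ 4 * (t : ℝ) ^ 2 := by nlinarith
  calc ((t : ℝ) + 1) ^ 2 * k * (2 * E) * (t : ℝ) ^ (5 / 16 : ℝ)
      ≤ 4 * (t : ℝ) ^ 2 * k * (2 * E) * (t : ℝ) ^ (5 / 16 : ℝ) := by gcongr
    _ = 8 * k * ((t : ℝ) ^ 2 * (t : ℝ) ^ (5 / 16 : ℝ) * E) := by ring
    _ ≤ 1 := ht.le

end IsSampling

end KG

/-! ### Expected numbers of pulls, and the bounds on the ratios -/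

namespace KG

variable {k : ℕ}

lemma exists_pos_bounds (hk : 2 ≤ k) {g : Fin k → ℝ} (hg : ∀ i, 0 < g i) :
    ∃ gm gM : ℝ, 0 < gm ∧ (∀ i, gm ≤ g i) ∧ ∀ i, g i ≤ gM := by
  have : Nonempty (Fin k) := ⟨⟨0, by omega⟩⟩
  obtain ⟨i, hi⟩ := Finite.exists_min g
  obtain ⟨j, hj⟩ := Finite.exists_max g
  exact ⟨g i, g j, hg i, hi, hj⟩

namespace IsSampling

variable {Ω : Type*} {mΩ : MeasurableSpace Ω}
  {P : Measure Ω} {μ σ : Fin k → ℝ} {X : ℕ → Fin k → Ω → ℝ} {I : ℕ → Ω → Fin k}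
  {ℱ : Filtration ℕ mΩ}

/-- The rate `t ^ (-5/16)` survives the passage from time `t` to time `t / M`. -/
lemma eventually_measure_div_le {B : ℕ → Set Ω} {C : ℝ}
    (h : ∀ᶠ t : ℕ in atTop, P.real (B t) ≤ C * (t : ℝ) ^ (-(5 / 16) : ℝ)) {M : ℕ} (hM : 0 < M) :
    ∃ C' : ℝ, ∀ᶠ t : ℕ in atTop, P.real (B (t / M)) ≤ C' * (t : ℝ) ^ (-(5 / 16) : ℝ) := by
  refine ⟨|C| * (2 * (M : ℝ)) ^ (5 / 16 : ℝ), ?_⟩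
  filter_upwards [(Nat.tendsto_div_const_atTop hM.ne').eventually h, eventually_ge_atTop (2 * M)]
    with t ht htM
  have hM' : (0 : ℝ) < M := by exact_mod_cast hM
  have ht0 : (0 : ℝ) < t := by exact_mod_cast (by omega : 0 < t)
  have h1 := div_le_natDiv hM htM
  have h2 : ((t / M : ℕ) : ℝ) ^ (-(5 / 16) : ℝ) ≤ (t / (2 * M) : ℝ) ^ (-(5 / 16) : ℝ) :=
    Real.rpow_le_rpow_of_nonpos (by positivity) h1 (by norm_num)
  have h3 : ((t : ℝ) / (2 * M)) ^ (-(5 / 16) : ℝ)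
      = (2 * (M : ℝ)) ^ (5 / 16 : ℝ) * (t : ℝ) ^ (-(5 / 16) : ℝ) := by
    rw [Real.div_rpow ht0.le (by positivity), Real.rpow_neg (by positivity : (0 : ℝ) ≤ 2 * M),
      div_inv_eq_mul, mul_comm]
  calc _ ≤ C * ((t / M : ℕ) : ℝ) ^ (-(5 / 16) : ℝ) := ht
    _ ≤ |C| * ((t / M : ℕ) : ℝ) ^ (-(5 / 16) : ℝ) :=
        mul_le_mul_of_nonneg_right (le_abs_self C) (by positivity)
    _ ≤ |C| * ((2 * (M : ℝ)) ^ (5 / 16 : ℝ) * (t : ℝ) ^ (-(5 / 16) : ℝ)) := by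
        rw [← h3]; exact mul_le_mul_of_nonneg_left h2 (abs_nonneg C)
    _ = _ := by ring

/-- The expected share of each arm is within `O(t ^ (-5/16))` of its equilibrium value. -/
lemma eventually_abs_integral_pulls_sub_le (hk : 2 ≤ k) (hS : IsSampling P μ σ X I ℱ)
    [IsProbabilityMeasure P] (hσ : ∀ i, 0 < σ i) (hgap : ∀ i, 0 < gap μ i)
    (hKG : ∀ ω, IsKGPath σ (arms I ω) (rewards X I ω)) :
    ∃ C : ℝ, ∀ᶠ t : ℕ in atTop, ∀ i,
      |∫ ω, (pulls (arms I ω) t i : ℝ) ∂P - σ i / gap μ i / (∑ l, σ l / gap μ l) * t| ≤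
        C * (t : ℝ) ^ (11 / 16 : ℝ) := by
  obtain ⟨sm, sM, hsm, hσm, hσM⟩ := exists_pos_bounds hk hσ
  obtain ⟨dm, dM, hdm0, hdm, hdM⟩ := exists_pos_bounds hk hgap
  have hk0 : (0 : ℝ) < k := by exact_mod_cast (by omega : 0 < k)
  have i0 : Fin k := ⟨0, by omega⟩
  have hsM : 0 < sM := hsm.trans_le ((hσm i0).trans (hσM i0))
  obtain ⟨C, M, hM, hdet⟩ := eventually_abs_pulls_sub_le hk hsm hσm hσM hdm0 hdm hdM
  set c : ℝ := sm / sM / (4 * k) with hc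
  have hc0 : 0 < c := by positivity
  set A : ℕ → Set Ω := fun t =>
    {ω | ¬ NoiseBound μ (arms I ω) (rewards X I ω) ((t : ℝ) ^ (1 / 32 : ℝ)) t} with hA
  set B : ℕ → Set Ω := fun t => {ω | ¬ FewTies μ (arms I ω) (rewards X I ω) c t} with hB
  have hA1 : ∀ᶠ t : ℕ in atTop, P.real (A t) ≤ 1 * (t : ℝ) ^ (-(5 / 16) : ℝ) := by
    simpa only [one_mul] using hS.eventually_measure_not_noiseBound_le hσ
  obtain ⟨CB, hB1⟩ := hS.eventually_measure_not_fewTies_le hσ hc0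
  obtain ⟨C1, hC1⟩ := eventually_measure_div_le hA1 (M := 2) two_pos
  obtain ⟨C2, hC2⟩ := eventually_measure_div_le hB1 (M := 2) two_pos
  obtain ⟨C3, hC3⟩ := eventually_measure_div_le hA1 hM
  obtain ⟨C4, hC4⟩ := eventually_measure_div_le hA1 (M := M * 2) (by omega)
  obtain ⟨C5, hC5⟩ := eventually_measure_div_le hB1 (M := M * 2) (by omega)
  refine ⟨|C| + (1 + C1 + C2 + C3 + C4 + C5), ?_⟩
  filter_upwards [hdet, hA1, hC1, hC2, hC3, hC4, hC5, eventually_ge_atTop 1]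
    with t hdet h0 h1 h2 h3 h4 h5 ht1 i
  have ht1' : (1 : ℝ) ≤ t := by exact_mod_cast ht1
  have ht0 : (0 : ℝ) < t := by linarith
  set bad : Set Ω := A t ∪ A (t / 2) ∪ B (t / 2) ∪ A (t / M) ∪ A (t / (M * 2)) ∪ B (t / (M * 2))
    with hbad
  have hPbad : P.real bad ≤ (1 + C1 + C2 + C3 + C4 + C5) * (t : ℝ) ^ (-(5 / 16) : ℝ) := by
    have u1 := measureReal_union_le (μ := P) (A t) (A (t / 2))
    have u2 := measureReal_union_le (μ := P) (A t ∪ A (t / 2)) (B (t / 2))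
    have u3 := measureReal_union_le (μ := P) (A t ∪ A (t / 2) ∪ B (t / 2)) (A (t / M))
    have u4 := measureReal_union_le (μ := P) (A t ∪ A (t / 2) ∪ B (t / 2) ∪ A (t / M))
      (A (t / (M * 2)))
    have u5 := measureReal_union_le (μ := P)
      (A t ∪ A (t / 2) ∪ B (t / 2) ∪ A (t / M) ∪ A (t / (M * 2))) (B (t / (M * 2)))
    linarith
  -- a measurable hull, so that its indicator can be integrated
  set T := toMeasurable P bad with hT
  have hTm : MeasurableSet T := measurableSet_toMeasurable _ _
  have hPT : P.real T = P.real bad := by rw [hT, Measure.real, measure_toMeasurable, Measure.real]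
  have hcpos : ∀ l, 0 < σ l / gap μ l := fun l => div_pos (hσ l) (hgap l)
  set w : ℝ := σ i / gap μ i / (∑ l, σ l / gap μ l) with hw
  have hsum : 0 < ∑ l, σ l / gap μ l :=
    Finset.sum_pos (fun l _ => hcpos l) ⟨i, Finset.mem_univ _⟩
  have hw0 : 0 ≤ w := (div_pos (hcpos i) hsum).le
  have hw1 : w ≤ 1 := by
    rw [hw, div_le_one hsum]
    exact Finset.single_le_sum (f := fun l => σ l / gap μ l) (fun l _ => (hcpos l).le)
      (Finset.mem_univ i)
  have hpt : ∀ ω, |(pulls (arms I ω) t i : ℝ) - w * t| ≤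
      |C| * (t : ℝ) ^ (17 / 32 : ℝ) + t * T.indicator 1 ω := by
    intro ω
    by_cases hω : ω ∈ T
    · rw [Set.indicator_of_mem hω, Pi.one_apply, mul_one]
      have hp : (pulls (arms I ω) t i : ℝ) ≤ t := by exact_mod_cast pulls_le _ t i
      have hp0 : (0 : ℝ) ≤ pulls (arms I ω) t i := Nat.cast_nonneg _
      have hwt : w * t ≤ t := by nlinarith
      have hwt0 : 0 ≤ w * t := by positivity
      have : |(pulls (arms I ω) t i : ℝ) - w * t| ≤ t := abs_le.2 ⟨by linarith, by linarith⟩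
      have hC0 : 0 ≤ |C| * (t : ℝ) ^ (17 / 32 : ℝ) := by positivity
      linarith
    · rw [Set.indicator_of_notMem hω, mul_zero, add_zero]
      have hnb : ω ∉ bad := fun h => hω (subset_toMeasurable P bad h)
      simp only [hbad, Set.mem_union, not_or, hA, hB, Set.mem_ofPred_eq, not_not] at hnb
      obtain ⟨⟨⟨⟨⟨g0, g1⟩, g2⟩, g3⟩, g4⟩, g5⟩ := hnb
      rw [← Nat.div_div_eq_div_mul] at g4 g5
      refine (hdet _ _ (hKG ω) ⟨g1, g2⟩ g0 ⟨g4, g5⟩ g3 i).trans ?_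
      exact mul_le_mul_of_nonneg_right (le_abs_self C) (by positivity)
  have hint : Integrable (fun ω => (pulls (arms I ω) t i : ℝ)) P := by
    refine Integrable.of_bound
      ((hS.measurable_pulls_real t i).mono (ℱ.le t) le_rfl).aestronglyMeasurable t
      (Eventually.of_forall fun ω => ?_)
    rw [Real.norm_eq_abs, Nat.abs_cast]
    exact_mod_cast pulls_le _ t i
  have hTi : Integrable (T.indicator (1 : Ω → ℝ)) P := (integrable_const (1 : ℝ)).indicator hTm
  have e1 : ∫ ω, (pulls (arms I ω) t i : ℝ) ∂P - w * t
      = ∫ ω, ((pulls (arms I ω) t i : ℝ) - w * t) ∂P := by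
    rw [integral_sub hint (integrable_const _)]
    simp
  rw [e1]
  refine abs_integral_le_integral_abs.trans ?_
  have h6 := integral_mono (hint.sub (integrable_const (w * t))).abs
    ((integrable_const (|C| * (t : ℝ) ^ (17 / 32 : ℝ))).add (hTi.const_mul (t : ℝ))) hpt
  rw [integral_add' (integrable_const _) (hTi.const_mul _),
    integral_const_mul (t : ℝ) (T.indicator (1 : Ω → ℝ)), integral_indicator_one hTm, hPT] at h6
  simp only [integral_const, probReal_univ, smul_eq_mul, one_mul] at h6
  refine h6.trans ?_
  have h7 : (t : ℝ) ^ (17 / 32 : ℝ) ≤ (t : ℝ) ^ (11 / 16 : ℝ) :=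
    Real.rpow_le_rpow_of_exponent_le ht1' (by norm_num)
  have h8 : (t : ℝ) * (t : ℝ) ^ (-(5 / 16) : ℝ) = (t : ℝ) ^ (11 / 16 : ℝ) := by
    nth_rewrite 1 [← Real.rpow_one (t : ℝ)]
    rw [← Real.rpow_add ht0]; norm_num
  have h9 := mul_le_mul_of_nonneg_left hPbad ht0.le
  have h10 := mul_le_mul_of_nonneg_left h7 (abs_nonneg C)
  rw [mul_left_comm, h8] at h9
  rw [add_mul]
  linarith

end IsSampling

lemma maxOther_eq_best (hk : 2 ≤ k) {μ : Fin k → ℝ} {b : Fin k} (hb : ∀ i, i ≠ b → μ i < μ b)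
    {i : Fin k} (hi : i ≠ b) : maxOther μ i = μ b := by
  refine le_antisymm (maxOther_le hk fun j _ => ?_) (le_maxOther μ hi.symm)
  by_cases hj : j = b
  · rw [hj]
  · exact (hb j hj).le

lemma maxOther_best_lt (hk : 2 ≤ k) {μ : Fin k → ℝ} {b : Fin k} (hb : ∀ i, i ≠ b → μ i < μ b) :
    maxOther μ b < μ b := by
  obtain ⟨j, hj, h⟩ := exists_eq_maxOther hk μ b
  rw [h]
  exact hb j hj

lemma gap_of_ne (hk : 2 ≤ k) {μ : Fin k → ℝ} {b : Fin k} (hb : ∀ i, i ≠ b → μ i < μ b)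
    {i : Fin k} (hi : i ≠ b) : gap μ i = μ b - μ i := by
  rw [gap, maxOther_eq_best hk hb hi, abs_sub_comm, abs_of_pos (sub_pos.2 (hb i hi))]

lemma gap_best (hk : 2 ≤ k) {μ : Fin k → ℝ} {b : Fin k} (hb : ∀ i, i ≠ b → μ i < μ b) :
    gap μ b = μ b - maxOther μ b := by
  rw [gap, abs_of_pos (sub_pos.2 (maxOther_best_lt hk hb))]

lemma logTerm_nonneg (μ σ : Fin k → ℝ) : 0 ≤ logTerm μ σ := le_max_right _ _

lemma q_nonneg {σ : Fin k → ℝ} (hσ : ∀ i, 0 < σ i) {s : ℝ} (hs : 0 ≤ s) : 0 ≤ q σ s := by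
  have h1 : 0 ≤ sigmaMax σ := Real.iSup_nonneg fun i => (hσ i).le
  unfold q
  positivity

/-- The first order term of the upper bound on the ratio `N_i / N_b`. -/
lemma le_rhoUp {μ σ : Fin k → ℝ} (hσ : ∀ i, 0 < σ i) {b i : Fin k}
    (hm : 0 < μ b - maxOther μ b) (hi : μ i < μ b) {t : ℝ} (ht : 0 < t)
    (hti : t ^ (-(1 / 4) : ℝ) < μ b - μ i) :
    (μ b - maxOther μ b) * σ i / (σ b * (μ b - μ i)) * (1 + t ^ (-(1 / 4) : ℝ) / (μ b - μ i))
      ≤ rhoUp μ σ b i t := by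
  refine le_trans ?_ (le_max_left _ _)
  unfold rhoUp1
  set m := μ b - maxOther μ b
  set d := μ b - μ i with hd
  set τ := t ^ (-(1 / 4) : ℝ)
  have hτ : 0 < τ := Real.rpow_pos_of_pos ht _
  have hd0 : 0 < d := sub_pos.2 hi
  have hsi := hσ i
  have hsb := hσ b
  have hlog := logTerm_nonneg μ σ
  have h1 : 1 ≤ 1 + (t / k) ^ (-(3 / 4) : ℝ) := by
    have : 0 ≤ (t / k) ^ (-(3 / 4) : ℝ) := by positivity
    linarith
  have h2 : m / σ b ≤ ((m + τ) ^ 2 / σ b ^ 2 + 8 * k / √t + 2 * k * logTerm μ σ / t)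
      ^ (1 / 2 : ℝ) := by
    rw [← Real.sqrt_eq_rpow]
    refine Real.le_sqrt_of_sq_le ?_
    have h3 : (m / σ b) ^ 2 ≤ (m + τ) ^ 2 / σ b ^ 2 := by
      rw [div_pow]
      gcongr
      linarith
    have h4 : 0 ≤ 8 * k / √t := by positivity
    have h5 : 0 ≤ 2 * k * logTerm μ σ / t := by positivity
    linarith
  have h3 : σ i * ((1 + τ / d) / d) ≤ (1 + (t / k) ^ (-(3 / 4) : ℝ)) * σ i / (d - τ) := by
    have h4 : (1 + τ / d) / d ≤ 1 / (d - τ) := by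
      rw [div_le_div_iff₀ hd0 (by linarith)]
      have : (1 + τ / d) * (d - τ) = d - τ ^ 2 / d := by field_simp; ring
      rw [this]
      have : 0 ≤ τ ^ 2 / d := by positivity
      linarith
    calc σ i * ((1 + τ / d) / d) ≤ σ i * (1 / (d - τ)) := by gcongr
      _ = 1 * σ i / (d - τ) := by ring
      _ ≤ _ := by
        have : 0 < d - τ := by linarith
        gcongr
  calc m * σ i / (σ b * d) * (1 + τ / d) = σ i * ((1 + τ / d) / d) * (m / σ b) := by field_simp
    _ ≤ _ := mul_le_mul h3 h2 (by positivity)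
        (le_trans (by positivity) h3)

/-- The logarithmic and root terms in `rhoLow` only decrease it, so that it stays below the limiting
ratio. -/
lemma rhoLow_le {μ σ : Fin k → ℝ} (hσ : ∀ i, 0 < σ i) {b i : Fin k} (hi : μ i < μ b) {t : ℝ}
    (ht : 0 < t) (hti : t ^ (-(1 / 4) : ℝ) ≤ μ b - maxOther μ b) :
    rhoLow μ σ b i t ≤ (μ b - maxOther μ b) * σ i / (σ b * (μ b - μ i)) := by
  refine (min_le_right _ _).trans ?_
  unfold rhoLow2
  set m := μ b - maxOther μ b
  set d := μ b - μ i with hd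
  set τ := t ^ (-(1 / 4) : ℝ)
  have hτ : 0 < τ := Real.rpow_pos_of_pos ht _
  have hd0 : 0 < d := sub_pos.2 hi
  have hsi := hσ i
  have hsb := hσ b
  have hlog := logTerm_nonneg μ σ
  have h1 : 1 ≤ 1 + (t / k) ^ (-(3 / 4) : ℝ) := by
    have : 0 ≤ (t / k) ^ (-(3 / 4) : ℝ) := by positivity
    linarith
  have h2 : ((d + τ) ^ 2 / σ i ^ 2 + 8 * k / √t + 2 * k * logTerm μ σ / t) ^ (-(1 / 2) : ℝ)
      ≤ σ i / d := by
    have h3 : (d / σ i) ^ 2 ≤ (d + τ) ^ 2 / σ i ^ 2 := by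
      rw [div_pow]
      gcongr
      linarith
    have h4 : 0 ≤ 8 * k / √t := by positivity
    have h5 : 0 ≤ 2 * k * logTerm μ σ / t := by positivity
    have h6 : ((d / σ i) ^ 2) ^ (-(1 / 2) : ℝ) = σ i / d := by
      rw [Real.rpow_neg (by positivity), ← Real.sqrt_eq_rpow, Real.sqrt_sq (by positivity), inv_div]
    rw [← h6]
    exact Real.rpow_le_rpow_of_nonpos (by positivity) (by linarith) (by norm_num)
  have h3 : (m - τ) / ((1 + (t / k) ^ (-(3 / 4) : ℝ)) * σ b) ≤ m / σ b :=
    div_le_div₀ (by linarith) (by linarith) hsb (by nlinarith)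
  calc _ ≤ m / σ b * (σ i / d) :=
        mul_le_mul h3 h2 (by positivity) (div_nonneg (by linarith) hsb.le)
    _ = _ := by field_simp

lemma rhoLow_nonneg {μ σ : Fin k → ℝ} (hσ : ∀ i, 0 < σ i) {b i : Fin k} {t : ℝ}
    (ht : 0 < t) (h1 : t ^ (-(1 / 4) : ℝ) ≤ μ b - maxOther μ b)
    (h2 : (3 / 4 * t) ^ (-(1 / 4) : ℝ) ≤ μ b - maxOther μ b) : 0 ≤ rhoLow μ σ b i t := by
  have hsb := hσ b
  have hlog := logTerm_nonneg μ σ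
  refine le_min ?_ ?_
  · unfold rhoLow1
    have := sub_nonneg.2 h2
    positivity
  · unfold rhoLow2
    have := sub_nonneg.2 h1
    positivity

end KG

/-! ### The theorem -/

namespace KG

/-- The algebra that identifies the limit: the regret rate is determined by the limits
`ρ_i = m σ_i / (σ_b δ_i)` of the ratios `N_i / N_b`. -/
lemma regret_rate_eq {ι : Type*} (s : Finset ι) {δ σ : ι → ℝ} {m σb : ℝ} (hm : 0 < m)
    (hσb : 0 < σb) (hδ : ∀ i ∈ s, 0 < δ i) :
    (∑ i ∈ s, δ i * (m * σ i / (σb * δ i))) / (1 + ∑ i ∈ s, m * σ i / (σb * δ i))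
      = (∑ i ∈ s, σ i) / (σb / m + ∑ i ∈ s, σ i / δ i) := by
  have h1 : ∑ i ∈ s, δ i * (m * σ i / (σb * δ i)) = m / σb * ∑ i ∈ s, σ i := by
    rw [Finset.mul_sum]
    refine Finset.sum_congr rfl fun i hi => ?_
    have := hδ i hi
    field_simp
  have h2 : 1 + ∑ i ∈ s, m * σ i / (σb * δ i) = m / σb * (σb / m + ∑ i ∈ s, σ i / δ i) := by
    rw [mul_add, Finset.mul_sum]
    congr 1
    · field_simp
    · refine Finset.sum_congr rfl fun i hi => ?_
      have := hδ i hi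
      field_simp
  rw [h1, h2, mul_div_mul_left _ _ (by positivity)]

end KG

theorem theorem3
    {k : ℕ} (hk : 2 ≤ k)
    (μ σ : Fin k → ℝ) (hσ : ∀ i, 0 < σ i)
    (b : Fin k) (hb : ∀ i, i ≠ b → μ i < μ b)
    {Ω : Type*} [mΩ : MeasurableSpace Ω] (P : Measure Ω) [IsProbabilityMeasure P]
    -- `X t i` is the reward of arm `i` in round `t`, `I t` the arm pulled in round `t`,
    -- `ℱ t` the information available before round `t`
    (X : ℕ → Fin k → Ω → ℝ) (I : ℕ → Ω → Fin k) (ℱ : Filtration ℕ mΩ)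
    (hX_law : ∀ t i, HasLaw (X t i) (gaussianReal (μ i) (Real.toNNReal (σ i ^ 2))) P)
    (hX_indep : iIndepFun (fun p : ℕ × Fin k => X p.1 p.2) P)
    (hX_adapted : ∀ t i, Measurable[ℱ (t + 1)] (X t i))
    (hX_future : ∀ t, Indep (MeasurableSpace.comap (fun ω i => X t i ω) MeasurableSpace.pi) (ℱ t) P)
    (hI_adapted : ∀ t, Measurable[ℱ t] (I t))
    (hKG : ∀ ω, KG.IsKGPath σ (fun s => I s ω) (fun s => X s (I s ω) ω)) :
    (∃ T : ℕ, ∀ t : ℕ, T < t →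
      KG.cumRegret P μ b I t <
        (∑ i ∈ Finset.univ.erase b, (μ b - μ i) * KG.rhoUp μ σ b i t) /
            (1 + ∑ i ∈ Finset.univ.erase b, KG.rhoLow μ σ b i t) * t
          + k * (∑ i ∈ Finset.univ.erase b, (μ b - μ i) * KG.q σ (3 / 4 * t)) * t) ∧
    Tendsto (fun t : ℕ => KG.cumRegret P μ b I t / t) atTop
      (𝓝 ((∑ i ∈ Finset.univ.erase b, σ i) /
        (σ b / (μ b - KG.maxOther μ b)
          + ∑ i ∈ Finset.univ.erase b, σ i / (μ b - μ i)))) := by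
  have hS : KG.IsSampling P μ σ X I ℱ := ⟨hX_law, hX_adapted, hX_future, hI_adapted⟩
  have hm : 0 < μ b - KG.maxOther μ b := sub_pos.2 (KG.maxOther_best_lt hk hb)
  have hδ : ∀ i ∈ Finset.univ.erase b, 0 < μ b - μ i := fun i hi =>
    sub_pos.2 (hb i (Finset.ne_of_mem_erase hi))
  have hgap : ∀ i, 0 < KG.gap μ i := fun i => by
    by_cases hi : i = b
    · rw [hi, KG.gap_best hk hb]; exact hm
    · rw [KG.gap_of_ne hk hb hi]; exact hδ i (Finset.mem_erase.2 ⟨hi, Finset.mem_univ _⟩)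
  have hne : (Finset.univ.erase b).Nonempty := by
    have : Nontrivial (Fin k) := Fin.nontrivial_iff_two_le.2 hk
    obtain ⟨j, hj⟩ := exists_ne b
    exact ⟨j, Finset.mem_erase.2 ⟨hj, Finset.mem_univ _⟩⟩
  have hsumgap : ∑ l, σ l / KG.gap μ l = σ b / (μ b - KG.maxOther μ b)
      + ∑ i ∈ Finset.univ.erase b, σ i / (μ b - μ i) := by
    rw [← Finset.add_sum_erase _ _ (Finset.mem_univ b), KG.gap_best hk hb]
    congr 1
    refine Finset.sum_congr rfl fun i hi => ?_
    rw [KG.gap_of_ne hk hb (Finset.ne_of_mem_erase hi)]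
  set L : ℝ := (∑ i ∈ Finset.univ.erase b, σ i) / (σ b / (μ b - KG.maxOther μ b)
          + ∑ i ∈ Finset.univ.erase b, σ i / (μ b - μ i)) with hL
  -- the regret is `L t` up to an error of order `t ^ (11/16)`
  obtain ⟨C, hC⟩ : ∃ C : ℝ, ∀ᶠ t : ℕ in atTop,
      |KG.cumRegret P μ b I t - L * t| ≤ C * (t : ℝ) ^ (11 / 16 : ℝ) := by
    obtain ⟨C, hC⟩ := hS.eventually_abs_integral_pulls_sub_le hk hσ hgap hKG
    refine ⟨∑ i ∈ Finset.univ.erase b, (μ b - μ i) * C, ?_⟩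
    filter_upwards [hC] with t ht
    have e : KG.cumRegret P μ b I t - L * t = ∑ i ∈ Finset.univ.erase b, (μ b - μ i) *
        (∫ ω, (KG.pulls (KG.arms I ω) t i : ℝ) ∂P
          - σ i / KG.gap μ i / (∑ l, σ l / KG.gap μ l) * t) := by
      have e1 : L * t = ∑ i ∈ Finset.univ.erase b, (μ b - μ i) *
          (σ i / KG.gap μ i / (∑ l, σ l / KG.gap μ l) * t) := by
        rw [hL, ← hsumgap, Finset.sum_div, Finset.sum_mul]
        refine Finset.sum_congr rfl fun i hi => ?_
        rw [KG.gap_of_ne hk hb (Finset.ne_of_mem_erase hi)]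
        have := hδ i hi
        field_simp
      rw [e1, KG.cumRegret, ← Finset.sum_sub_distrib]
      exact Finset.sum_congr rfl fun i _ => by ring
    rw [e, Finset.sum_mul]
    refine (Finset.abs_sum_le_sum_abs _ _).trans (Finset.sum_le_sum fun i hi => ?_)
    rw [abs_mul, abs_of_pos (hδ i hi), mul_assoc]
    exact mul_le_mul_of_nonneg_left (ht i) (hδ i hi).le
  refine ⟨?_, ?_⟩
  · set ρ : Fin k → ℝ := fun i => (μ b - KG.maxOther μ b) * σ i / (σ b * (μ b - μ i)) with hρ
    have hρ0 : ∀ i ∈ Finset.univ.erase b, 0 < ρ i := fun i hi =>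
      div_pos (mul_pos hm (hσ i)) (mul_pos (hσ b) (hδ i hi))
    have hLρ : (∑ i ∈ Finset.univ.erase b, (μ b - μ i) * ρ i) /
        (1 + ∑ i ∈ Finset.univ.erase b, ρ i) = L :=
      KG.regret_rate_eq _ hm (hσ b) hδ
    have hSρ : 0 < ∑ i ∈ Finset.univ.erase b, ρ i := Finset.sum_pos hρ0 hne
    set c : ℝ := (∑ i ∈ Finset.univ.erase b, ρ i) / (1 + ∑ i ∈ Finset.univ.erase b, ρ i) with hc
    have hc0 : 0 < c := by positivity
    have hT : Tendsto (fun t : ℕ => (t : ℝ)) atTop atTop := tendsto_natCast_atTop_atTop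
    have hτ := KG.tendsto_natCast_rpow_neg (p := 1 / 4) (by norm_num)
    have hτ' : Tendsto (fun t : ℕ => (3 / 4 * (t : ℝ)) ^ (-(1 / 4) : ℝ)) atTop (𝓝 0) :=
      (tendsto_rpow_neg_atTop (by norm_num)).comp (hT.const_mul_atTop (by norm_num))
    have hτδ : ∀ᶠ t : ℕ in atTop, ∀ i ∈ Finset.univ.erase b,
        (t : ℝ) ^ (-(1 / 4) : ℝ) < μ b - μ i :=
      (Finset.eventually_all _).2 fun i hi => hτ.eventually_lt_const (hδ i hi)
    have hev : ∀ᶠ t : ℕ in atTop, KG.cumRegret P μ b I t <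
        (∑ i ∈ Finset.univ.erase b, (μ b - μ i) * KG.rhoUp μ σ b i t) /
            (1 + ∑ i ∈ Finset.univ.erase b, KG.rhoLow μ σ b i t) * t
          + k * (∑ i ∈ Finset.univ.erase b, (μ b - μ i) * KG.q σ (3 / 4 * t)) * t := by
      filter_upwards [hC, eventually_ge_atTop 1, hτδ, hτ.eventually_lt_const hm,
        hτ'.eventually_lt_const hm,
        (KG.tendsto_natCast_rpow (p := 1 / 16) (by norm_num)).eventually_gt_atTop (C / c)]
        with t ht ht1 hti htm htm' htC
      have ht0 : (0 : ℝ) < t := by exact_mod_cast ht1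
      set τ := (t : ℝ) ^ (-(1 / 4) : ℝ) with hτdef
      have hup : ∑ i ∈ Finset.univ.erase b, (μ b - μ i) * ρ i
          + τ * ∑ i ∈ Finset.univ.erase b, ρ i
          ≤ ∑ i ∈ Finset.univ.erase b, (μ b - μ i) * KG.rhoUp μ σ b i t := by
        rw [Finset.mul_sum, ← Finset.sum_add_distrib]
        refine Finset.sum_le_sum fun i hi => ?_
        have h1 := mul_le_mul_of_nonneg_left
          (KG.le_rhoUp hσ hm (sub_pos.1 (hδ i hi)) ht0 (hti i hi)) (hδ i hi).le
        refine le_trans (le_of_eq ?_) h1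
        have := hδ i hi
        have h2 := hσ b
        simp only [hρ]
        rw [← hτdef]
        field_simp
      have hlow0 : ∀ i ∈ Finset.univ.erase b, 0 ≤ KG.rhoLow μ σ b i t := fun i _ =>
        KG.rhoLow_nonneg hσ ht0 htm.le htm'.le
      have hlow : ∑ i ∈ Finset.univ.erase b, KG.rhoLow μ σ b i t
          ≤ ∑ i ∈ Finset.univ.erase b, ρ i :=
        Finset.sum_le_sum fun i hi => KG.rhoLow_le hσ (sub_pos.1 (hδ i hi)) ht0 htm.le
      have hden : 0 < 1 + ∑ i ∈ Finset.univ.erase b, KG.rhoLow μ σ b i t := by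
        have := Finset.sum_nonneg hlow0
        linarith
      have hτ0 : 0 < τ := Real.rpow_pos_of_pos ht0 _
      have hmain : L + c * τ ≤ (∑ i ∈ Finset.univ.erase b, (μ b - μ i) * KG.rhoUp μ σ b i t) /
            (1 + ∑ i ∈ Finset.univ.erase b, KG.rhoLow μ σ b i t) := by
        have hnum0 : 0 ≤ ∑ i ∈ Finset.univ.erase b, (μ b - μ i) * ρ i :=
          Finset.sum_nonneg fun i hi => (mul_pos (hδ i hi) (hρ0 i hi)).le
        calc L + c * τ = (∑ i ∈ Finset.univ.erase b, (μ b - μ i) * ρ i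
              + τ * ∑ i ∈ Finset.univ.erase b, ρ i) / (1 + ∑ i ∈ Finset.univ.erase b, ρ i) := by
              rw [← hLρ, hc]; ring
          _ ≤ _ := div_le_div₀ (le_trans (by positivity) hup) hup hden (by linarith)
      have hq : 0 ≤ k * (∑ i ∈ Finset.univ.erase b, (μ b - μ i) * KG.q σ (3 / 4 * t)) * t := by
        have : 0 ≤ ∑ i ∈ Finset.univ.erase b, (μ b - μ i) * KG.q σ (3 / 4 * t) :=
          Finset.sum_nonneg fun i hi =>
            mul_nonneg (hδ i hi).le (KG.q_nonneg hσ (by positivity))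
        positivity
      -- the margin `c t ^ (3/4)` beats the error `C t ^ (11/16)`
      have hgt : C * (t : ℝ) ^ (11 / 16 : ℝ) < c * τ * t := by
        rw [div_lt_iff₀ hc0] at htC
        have e1 : τ * t = (t : ℝ) ^ (1 / 16 : ℝ) * (t : ℝ) ^ (11 / 16 : ℝ) := by
          rw [← Real.rpow_add ht0, hτdef]
          nth_rewrite 2 [← Real.rpow_one (t : ℝ)]
          rw [← Real.rpow_add ht0]; norm_num
        have h1 := mul_lt_mul_of_pos_right htC
          (Real.rpow_pos_of_pos ht0 (11 / 16 : ℝ))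
        calc _ < _ := h1
          _ = c * τ * t := by rw [mul_assoc c, e1]; ring
      have h1 := mul_le_mul_of_nonneg_right hmain ht0.le
      have h2 := (le_abs_self _).trans ht
      linarith
    obtain ⟨T, hT⟩ := eventually_atTop.1 hev
    exact ⟨T, fun t ht => hT t ht.le⟩
  · rw [tendsto_iff_norm_sub_tendsto_zero]
    have hlim := (KG.tendsto_natCast_rpow_neg (p := 5 / 16) (by norm_num)).const_mul C
    rw [mul_zero] at hlim
    refine squeeze_zero' (Eventually.of_forall fun t => norm_nonneg _) ?_ hlim
    filter_upwards [hC, eventually_ge_atTop 1] with t ht ht1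
    have ht0 : (0 : ℝ) < t := by exact_mod_cast ht1
    have e1 : KG.cumRegret P μ b I t / t - L = (KG.cumRegret P μ b I t - L * t) / t := by
      field_simp
    have e2 : (t : ℝ) ^ (-(5 / 16) : ℝ) * t = (t : ℝ) ^ (11 / 16 : ℝ) := by
      nth_rewrite 2 [← Real.rpow_one (t : ℝ)]
      rw [← Real.rpow_add ht0]; norm_num
    rw [e1, Real.norm_eq_abs, abs_div, abs_of_pos ht0, div_le_iff₀ ht0, mul_assoc, e2]
    exact ht
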